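/- **Definitions.** Let $T=\begin{pmatrix}1&0\\1&1\end{pmatrix}$, and call a (compact) convex polygon in $\mathbb{R}^2$ rational if each of its edges is directed along an integer vector. Let $v$ be a vertex of such a polygon, and let $u_1,u_2$ be the primitive integer vectors directing the edges emanating from $v$, ordered so that $\det(u_1,u_2)>0$. The vertex $v$ satisfies the *Delzant condition* if $\det(u_1,u_2)=1$, the *fake corner condition for $k$ cuts* if $\det(u_1,T^ku_2)=0$, and the *hidden corner condition for $k$ cuts* if $\det(u_1,T^ku_2)=1$. A *semitoric polygon representative* is a triple $(\Delta,\vec c,\vec\epsilon)$ where $\Delta$ is a rational convex polygon, $\vec c=(c_1,\dots,c_m)$ are points of $\operatorname{int}\Delta$ (the marked points), and $\vec\epsilon\in\{\pm1\}^m$. The $i$-th *cut* is the part in $\Delta$ of the vertical ray starting at $c_i$ and pointing in direction $(0,\epsilon_i)$. It is required that each point of $\partial\Delta$ met by exactly $k\ge1$ cuts is a vertex satisfying the fake or the hidden corner condition for $k$ cuts, and that every other vertex satisfies the Delzant condition; these other vertices are called *Delzant corners*. Let $\mathcal T$ be the group of maps of the plane generated by $T$ and the vertical translations, and for $j\in\mathbb{R}$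 let $\mathfrak t_j(x,y)=(x,y+x-j)$ if $x\ge j$ and $\mathfrak t_j(x,y)=(x,y)$ otherwise. An element $(\tau,\vec\epsilon')\in\mathcal T\times\{\pm1\}^m$ sends $(\Delta,\vec c,\vec\epsilon)$ to $(\sigma(\Delta),\sigma(\vec c),(\epsilon_i'\epsilon_i)_i)$, where $\sigma=\tau\circ\mathfrak t_{x_1}^{u_1}\circ\cdots\circ\mathfrak t_{x_m}^{u_m}$, $x_i$ is the first coordinate of $c_i$, and $u_i=\epsilon_i(1-\epsilon_i')/2$. The orbit $[\Delta,\vec c,\vec\epsilon]$ is called a *semitoric polygon*. For $\lambda>0$ put $B(\lambda)=\{(x,y): x,y\ge0,\ x+y<\lambda\}$. An *admissibly packed triangle* at a vertex $p$ of $\Delta$ is a set $B\subset\Delta$ for which there is an element of $\mathcal T\times\{\pm1\}^m$, with associated map $\sigma$, such that $\sigma(p)$ is a Delzant corner of the transformed representative, $\sigma(B)$ contains no $\sigma(c_i)$, $\sigma(B)=M(B(\lambda))+\sigma(p)$ for some $M\in\mathrm{SL}_2(\mathbb{Z})$ and $\lambda>0$, and $\sigma(B)$ and $\sigma(\Delta)$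 coincide near $\sigma(p)$. A *packing* is a union of finitely many pairwise disjoint admissibly packed triangles. The *packing density* $\rho_{\mathrm{ST}}$ of a semitoric polygon is the supremum of $\operatorname{area}(P)/\operatorname{area}(\Delta)$ over packings $P$ of its representatives $(\Delta,\vec c,\vec\epsilon)$. **Theorem.** 1. *(Type (1).)* Let $a>0$ and $0<h<a/2$, and let $\Delta$ have vertices $(0,0),(a,\frac a2),(2a,0)$. Then $[\Delta,((a,h)),(+1)]$ has $$\rho_{\mathrm{ST}}=\frac{a^2+2h^2-2ah}{a^2}.$$ 2. *(Type (2).)* Let $a>0$, $b\ge0$ and $h_1,h_2\in(0,a)$, and let $\Delta$ have vertices $(0,0),(a,a),(a+b,a),(2a+b,0)$. Then $[\Delta,((a,h_1),(a+b,h_2)),(+1,+1)]$ has $$\rho_{\mathrm{ST}}=\frac{a}{a+b}.$$ 3. *(Type (3a).)* Let $a,b>0$, $n\in\mathbb{Z}_{\ge1}$ and $h\in(0,a)$, and let $\Delta$ have vertices $(0,0),(a,a),(a+b,a),(an+b,0)$. Then $[\Delta,((a,h)),(+1)]$ has $$\rho_{\mathrm{ST}}=\begin{cases}\dfrac{2a}{na+2b}&\text{if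 }n>1,\\[2ex]\dfrac{2a}{a+2b}&\text{if }n=1,\ a\le b,\\[2ex]\dfrac{a^2+b^2+(a-b)^2}{(a+2b)a}&\text{if }n=1,\ b<a<2b,\\[2ex]\dfrac{a^2+2b^2}{(a+2b)a}&\text{if }n=1,\ a\ge2b.\end{cases}$$ 4. *(Type (3b).)* Let $a>0$, $n\in\mathbb{Z}_{\ge2}$ and $h\in(0,a)$, and let $\Delta$ have vertices $(0,0),(a,a),(an,0)$. Then $[\Delta,((a,h)),(+1)]$ has $\rho_{\mathrm{ST}}=\dfrac2n$. 5. *(Type (3c).)* Let $a>0$, $b\in(-a,0)$, $n\in\mathbb{Z}_{\ge2}$ and $h\in\bigl(0,a+\frac{b}{n-1}\bigr)$, and let $\Delta$ have vertices $(0,0),(a+b,a+b),\bigl(a,a+\frac b{n-1}\bigr),(an+b,0)$. Then $[\Delta,((a,h)),(+1)]$ has $$\rho_{\mathrm{ST}}=\frac{(a+b)^2+\min\Bigl(\bigl((n-1)a+b-(n-2)h\bigr)^2,\,a^2\Bigr)}{(na+2b)a}.$$ -/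

import Mathlib

noncomputable section

namespace Semitoric

open Set Topology MeasureTheory

/-! ### Rational convex polygons and their corners -/

/-- The integer vector `u`, seen in the plane. -/
def toPlane (u : ℤ × ℤ) : ℝ × ℝ := ((u.1 : ℝ), (u.2 : ℝ))

/-- The determinant of the matrix with columns `u` and `v`. -/
def det (u v : ℤ × ℤ) : ℤ := u.1 * v.2 - v.1 * u.2

/-- `T ^ k` applied to `u`, where `T = !![1, 0; 1, 1]`. -/
def powT (k : ℕ) (u : ℤ × ℤ) : ℤ × ℤ := (u.1, (k : ℤ) * u.1 + u.2)

/-- The intersection of finitely many closed half-planes `{p | ⟨ν i, p⟩ ≤ β i}` with integer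
normal vectors. -/
def halfPlanes {N : ℕ} (ν : Fin N → ℤ × ℤ) (β : Fin N → ℝ) : Set (ℝ × ℝ) :=
  {p | ∀ i, ((ν i).1 : ℝ) * p.1 + ((ν i).2 : ℝ) * p.2 ≤ β i}

/-- A (compact) rational convex polygon: a bounded set with non-empty interior which is a finite
intersection of closed half-planes with integer normal vectors; equivalently, a convex polygon each
of whose edges is directed along an integer vector. -/
def IsRationalPolygon (Δ : Set (ℝ × ℝ)) : Prop :=
  Bornology.IsBounded Δ ∧ (interior Δ).Nonempty ∧
    ∃ (N : ℕ) (ν : Fin N → ℤ × ℤ) (β : Fin N → ℝ), Δ = halfPlanes ν β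

/-- The vertices of a polygon are its extreme points. -/
def IsVertex (Δ : Set (ℝ × ℝ)) (v : ℝ × ℝ) : Prop := v ∈ extremePoints ℝ Δ

/-- `u` is the primitive integer vector directing an edge of `Δ` which emanates from the vertex
`v`. -/
def IsEdgeVector (Δ : Set (ℝ × ℝ)) (v : ℝ × ℝ) (u : ℤ × ℤ) : Prop :=
  IsCoprime u.1 u.2 ∧ ∃ t : ℝ, 0 < t ∧ segment ℝ v (v + t • toPlane u) ⊆ frontier Δ

/-- The Delzant condition at the vertex `v` (the two edge vectors can be ordered so that their
determinant is positive). -/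
def DelzantCondition (Δ : Set (ℝ × ℝ)) (v : ℝ × ℝ) : Prop :=
  ∃ u₁ u₂, IsEdgeVector Δ v u₁ ∧ IsEdgeVector Δ v u₂ ∧ det u₁ u₂ = 1

/-- The fake corner condition for `k` cuts at the vertex `v`. -/
def FakeCondition (Δ : Set (ℝ × ℝ)) (k : ℕ) (v : ℝ × ℝ) : Prop :=
  ∃ u₁ u₂, IsEdgeVector Δ v u₁ ∧ IsEdgeVector Δ v u₂ ∧ 0 < det u₁ u₂ ∧ det u₁ (powT k u₂) = 0

/-- The hidden corner condition for `k` cuts at the vertex `v`. -/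
def HiddenCondition (Δ : Set (ℝ × ℝ)) (k : ℕ) (v : ℝ × ℝ) : Prop :=
  ∃ u₁ u₂, IsEdgeVector Δ v u₁ ∧ IsEdgeVector Δ v u₂ ∧ 0 < det u₁ u₂ ∧ det u₁ (powT k u₂) = 1

/-! ### Semitoric polygons -/

/-- A triple `(Δ, c, ε)`: a subset of the plane, `m` marked points and `m` cut directions. -/
@[ext]
structure Triple (m : ℕ) where
  /-- the polygon -/
  Δ : Set (ℝ × ℝ)
  /-- the marked points -/
  c : Fin m → ℝ × ℝ
  /-- the cut directions -/
  ε : Fin m → ℤˣ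

/-- The sign `±1` as a real number. -/
def sign (e : ℤˣ) : ℝ := ((e : ℤ) : ℝ)

/-- The `i`-th cut: the part in `Δ` of the vertical ray which starts at the `i`-th marked point and
goes up or down according to the `i`-th cut direction. -/
def Triple.cut {m : ℕ} (R : Triple m) (i : Fin m) : Set (ℝ × ℝ) :=
  {q | q ∈ R.Δ ∧ q.1 = (R.c i).1 ∧ 0 ≤ sign (R.ε i) * (q.2 - (R.c i).2)}

/-- The number of cuts through the point `q`. -/
def Triple.numCuts {m : ℕ} (R : Triple m) (q : ℝ × ℝ) : ℕ := {i | q ∈ R.cut i}.ncard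

/-- A Delzant corner: a vertex which is on no cut and satisfies the Delzant condition. -/
def Triple.IsDelzantCorner {m : ℕ} (R : Triple m) (v : ℝ × ℝ) : Prop :=
  IsVertex R.Δ v ∧ (∀ i, v ∉ R.cut i) ∧ DelzantCondition R.Δ v

/-- The conditions for a triple to be a semitoric polygon representative. The labelling of the
marked points plays no role in what follows, so no order is imposed on them. -/
structure Triple.IsRepresentative {m : ℕ} (R : Triple m) : Prop where
  polygon : IsRationalPolygon R.Δ
  marked_mem_interior : ∀ i, R.c i ∈ interior R.Δ
  corner_of_mem_cut : ∀ q ∈ frontier R.Δ, (∃ i, q ∈ R.cut i) →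
    IsVertex R.Δ q ∧ (FakeCondition R.Δ (R.numCuts q) q ∨ HiddenCondition R.Δ (R.numCuts q) q)
  delzant : ∀ v, IsVertex R.Δ v → (∀ i, v ∉ R.cut i) → R.IsDelzantCorner v

/-- A semitoric polygon representative. -/
structure Representative (m : ℕ) extends Triple m where
  isRepresentative : toTriple.IsRepresentative

/-- An element `(τ, ε')` of `𝒯 × {±1}^m`. The group `𝒯` generated by `T` and the vertical
translations consists of the maps `(x, y) ↦ (x, k x + y + s)` with `k` an integer, `s` real. -/
structure Transf (m : ℕ) where
  /-- the exponent of `T` -/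
  k : ℤ
  /-- the vertical translation -/
  s : ℝ
  /-- the factors by which the cut directions are multiplied -/
  flip : Fin m → ℤˣ

/-- The map `σ = τ ∘ 𝔱_{x₁}^{u₁} ∘ ⋯ ∘ 𝔱_{x_m}^{u_m}`, where `x_i` is the abscissa of the `i`-th
marked point, `u_i = ε_i (1 - ε'_i) / 2`, and `𝔱_j` is the identity on `{x < j}` and maps `(x, y)`
to `(x, y + x - j)` on `{j ≤ x}`, so that `𝔱_j^u (x, y) = (x, y + u * max (x - j) 0)`. All these maps
preserve the first coordinate and add to the second one a function of the first. -/
def Transf.map {m : ℕ} (g : Transf m) (R : Triple m) (q : ℝ × ℝ) : ℝ × ℝ :=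
  (q.1, g.k * q.1 + (q.2 +
    ∑ i, sign (R.ε i) * (1 - sign (g.flip i)) / 2 * max (q.1 - (R.c i).1) 0) + g.s)

/-- The action of `𝒯 × {±1}^m`. -/
def Transf.act {m : ℕ} (g : Transf m) (R : Triple m) : Triple m where
  Δ := g.map R '' R.Δ
  c := fun i => g.map R (R.c i)
  ε := fun i => g.flip i * R.ε i

/-- The semitoric polygon `[Δ, c, ε]`: the orbit of a semitoric polygon representative. -/
def Representative.semitoricPolygon {m : ℕ} (R : Representative m) : Set (Triple m) :=
  {R' | ∃ g : Transf m, R' = g.act R.toTriple}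

/-! ### Packings -/

/-- The model triangle of size `l`. -/
def modelTriangle (l : ℝ) : Set (ℝ × ℝ) := {q | 0 ≤ q.1 ∧ 0 ≤ q.2 ∧ q.1 + q.2 < l}

/-- The linear action of `SL₂(ℤ)` on the plane. -/
def slMap (M : Matrix.SpecialLinearGroup (Fin 2) ℤ) (q : ℝ × ℝ) : ℝ × ℝ :=
  ((M.1 0 0 : ℝ) * q.1 + (M.1 0 1 : ℝ) * q.2, (M.1 1 0 : ℝ) * q.1 + (M.1 1 1 : ℝ) * q.2)

/-- `B` is an admissibly packed triangle at the vertex `p` of `R`. -/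
def Triple.IsPackedTriangle {m : ℕ} (R : Triple m) (p : ℝ × ℝ) (B : Set (ℝ × ℝ)) : Prop :=
  IsVertex R.Δ p ∧ B ⊆ R.Δ ∧ ∃ g : Transf m,
    (g.act R).IsDelzantCorner (g.map R p) ∧
    (∀ i, g.map R (R.c i) ∉ g.map R '' B) ∧
    (∃ (M : Matrix.SpecialLinearGroup (Fin 2) ℤ) (l : ℝ), 0 < l ∧
      g.map R '' B = (fun q => slMap M q + g.map R p) '' modelTriangle l) ∧
    ∀ᶠ q in 𝓝 (g.map R p), (q ∈ g.map R '' B ↔ q ∈ g.map R '' R.Δ)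

/-- `P` is a packing of `R`: a union of finitely many pairwise disjoint admissibly packed
triangles. -/
def Triple.IsPacking {m : ℕ} (R : Triple m) (P : Set (ℝ × ℝ)) : Prop :=
  ∃ (d : ℕ) (p : Fin d → ℝ × ℝ) (B : Fin d → Set (ℝ × ℝ)),
    (∀ i, R.IsPackedTriangle (p i) (B i)) ∧ (∀ i j, i ≠ j → Disjoint (B i) (B j)) ∧ P = ⋃ i, B i

/-- Area. -/
def area (A : Set (ℝ × ℝ)) : ℝ := (volume A).toReal

/-- The packing density of a semitoric polygon: the supremum of `area P / area Δ` over all packings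
`P` of its representatives `(Δ, c, ε)`. -/
def packingDensity {m : ℕ} (S : Set (Triple m)) : ℝ :=
  sSup {r | ∃ R ∈ S, ∃ P, R.IsPacking P ∧ r = area P / area R.Δ}

/-! ### Helper facts: polygons given by half-planes -/

theorem isClosed_halfPlanes {N : ℕ} (ν : Fin N → ℤ × ℤ) (β : Fin N → ℝ) :
    IsClosed (halfPlanes ν β) := by
  have : halfPlanes ν β = ⋂ i, {p : ℝ × ℝ | ((ν i).1 : ℝ) * p.1 + ((ν i).2 : ℝ) * p.2 ≤ β i} := by
    ext p; simp [halfPlanes]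
  rw [this]
  exact isClosed_iInter fun i => isClosed_le (by fun_prop) (by fun_prop)

theorem convex_halfPlanes {N : ℕ} (ν : Fin N → ℤ × ℤ) (β : Fin N → ℝ) :
    Convex ℝ (halfPlanes ν β) := by
  intro p hp q hq s t hs ht hst i
  have h1 := mul_le_mul_of_nonneg_left (hp i) hs
  have h2 := mul_le_mul_of_nonneg_left (hq i) ht
  have h3 : s * β i + t * β i = β i := by rw [← add_mul, hst, one_mul]
  simp only [Prod.fst_add, Prod.snd_add, Prod.smul_fst, Prod.smul_snd, smul_eq_mul]
  nlinarith

theorem mem_interior_halfPlanes {N : ℕ} {ν : Fin N → ℤ × ℤ} {β : Fin N → ℝ} {p : ℝ × ℝ}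
    (h : ∀ i, ((ν i).1 : ℝ) * p.1 + ((ν i).2 : ℝ) * p.2 < β i) : p ∈ interior (halfPlanes ν β) := by
  have ho : IsOpen (⋂ i, {p : ℝ × ℝ | ((ν i).1 : ℝ) * p.1 + ((ν i).2 : ℝ) * p.2 < β i}) :=
    isOpen_iInter_of_finite fun i => isOpen_lt (by fun_prop) (by fun_prop)
  refine interior_maximal ?_ ho (by simpa using h)
  intro q hq i
  exact le_of_lt (by simpa using mem_iInter.1 hq i)

theorem exists_eq_of_mem_frontier {N : ℕ} {ν : Fin N → ℤ × ℤ} {β : Fin N → ℝ} {p : ℝ × ℝ}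
    (h : p ∈ frontier (halfPlanes ν β)) :
    p ∈ halfPlanes ν β ∧ ∃ i, ((ν i).1 : ℝ) * p.1 + ((ν i).2 : ℝ) * p.2 = β i := by
  rw [(isClosed_halfPlanes ν β).frontier_eq] at h
  refine ⟨h.1, ?_⟩
  by_contra hc
  push Not at hc
  exact h.2 (mem_interior_halfPlanes fun i => lt_of_le_of_ne (h.1 i) (hc i))

theorem mem_frontier_halfPlanes {N : ℕ} {ν : Fin N → ℤ × ℤ} {β : Fin N → ℝ} {p : ℝ × ℝ}
    (hp : p ∈ halfPlanes ν β) (i : Fin N) (hi : ν i ≠ 0)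
    (h : ((ν i).1 : ℝ) * p.1 + ((ν i).2 : ℝ) * p.2 = β i) : p ∈ frontier (halfPlanes ν β) := by
  rw [(isClosed_halfPlanes ν β).frontier_eq]
  refine ⟨hp, fun hint => ?_⟩
  have hcont : Continuous fun t : ℝ => p + t • toPlane (ν i) := by fun_prop
  have hev : ∀ᶠ t in 𝓝 (0 : ℝ), p + t • toPlane (ν i) ∈ interior (halfPlanes ν β) :=
    hcont.continuousAt.eventually_mem (by simpa using isOpen_interior.mem_nhds hint)
  obtain ⟨t, htpos, ht⟩ :=
    ((eventually_mem_nhdsWithin (a := (0 : ℝ)) (s := Ioi 0)).and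
      (hev.filter_mono nhdsWithin_le_nhds)).exists
  have h1 := interior_subset ht i
  simp only [toPlane, Prod.fst_add, Prod.snd_add, Prod.smul_mk, smul_eq_mul] at h1
  have htpos : 0 < t := htpos
  have h2 : 0 < ((ν i).1 : ℝ) ^ 2 + ((ν i).2 : ℝ) ^ 2 := by
    by_contra hc
    have e1 : ((ν i).1 : ℝ) = 0 := by nlinarith [sq_nonneg ((ν i).1 : ℝ), sq_nonneg ((ν i).2 : ℝ)]
    have e2 : ((ν i).2 : ℝ) = 0 := by nlinarith [sq_nonneg ((ν i).1 : ℝ), sq_nonneg ((ν i).2 : ℝ)]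
    exact hi (Prod.ext (by exact_mod_cast e1) (by exact_mod_cast e2))
  nlinarith

theorem isEdgeVector_halfPlanes {N : ℕ} {ν : Fin N → ℤ × ℤ} {β : Fin N → ℝ} {v : ℝ × ℝ}
    {u : ℤ × ℤ} (hu : IsCoprime u.1 u.2) (t : ℝ) (ht : 0 < t) (i : Fin N)
    (hv : v ∈ halfPlanes ν β) (hw : v + t • toPlane u ∈ halfPlanes ν β)
    (h : ((ν i).1 : ℝ) * v.1 + ((ν i).2 : ℝ) * v.2 = β i) (hi : ν i ≠ 0)
    (hiu : (ν i).1 * u.1 + (ν i).2 * u.2 = 0) : IsEdgeVector (halfPlanes ν β) v u := by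
  refine ⟨hu, t, ht, fun q hq => ?_⟩
  refine mem_frontier_halfPlanes ((convex_halfPlanes ν β).segment_subset hv hw hq) i hi ?_
  have h0 : ((ν i).1 : ℝ) * u.1 + ((ν i).2 : ℝ) * u.2 = 0 := by exact_mod_cast hiu
  obtain ⟨x, y, -, -, hxy, rfl⟩ := hq
  simp only [toPlane, Prod.fst_add, Prod.snd_add, Prod.smul_fst, Prod.smul_snd, smul_eq_mul]
  linear_combination h + (((ν i).1 : ℝ) * v.1 + ((ν i).2 : ℝ) * v.2) * hxy + y * t * h0

theorem isVertex_halfPlanes {N : ℕ} {ν : Fin N → ℤ × ℤ} {β : Fin N → ℝ} {v : ℝ × ℝ}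
    (hv : v ∈ halfPlanes ν β) (i j : Fin N) (hij : det (ν i) (ν j) ≠ 0)
    (hi : ((ν i).1 : ℝ) * v.1 + ((ν i).2 : ℝ) * v.2 = β i)
    (hj : ((ν j).1 : ℝ) * v.1 + ((ν j).2 : ℝ) * v.2 = β j) : IsVertex (halfPlanes ν β) v := by
  refine ⟨hv, fun p hp q hq hpq => ?_⟩
  obtain ⟨x, y, hx, hy, hxy, rfl⟩ := hpq
  have hd : ((ν i).1 : ℝ) * (ν j).2 - (ν j).1 * (ν i).2 ≠ 0 := by exact_mod_cast hij
  have key : ∀ k, ((ν k).1 : ℝ) * (x • p + y • q).1 + ((ν k).2 : ℝ) * (x • p + y • q).2 = β k →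
      ((ν k).1 : ℝ) * p.1 + ((ν k).2 : ℝ) * p.2 = β k := by
    intro k hk
    simp only [Prod.fst_add, Prod.snd_add, Prod.smul_fst, Prod.smul_snd, smul_eq_mul] at hk
    have h1 := hp k
    have h2 := mul_le_mul_of_nonneg_left (hq k) hy.le
    have h3 : x * β k + y * β k = β k := by rw [← add_mul, hxy, one_mul]
    refine le_antisymm h1 (le_of_mul_le_mul_left ?_ hx)
    nlinarith
  have ki := key i hi
  have kj := key j hj
  have e1 : p.1 = (x • p + y • q).1 := by
    refine mul_left_cancel₀ hd ?_
    linear_combination ((ν j).2 : ℝ) * (ki - hi) - ((ν i).2 : ℝ) * (kj - hj)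
  have e2 : p.2 = (x • p + y • q).2 := by
    refine mul_left_cancel₀ hd ?_
    linear_combination ((ν i).1 : ℝ) * (kj - hj) - ((ν j).1 : ℝ) * (ki - hi)
  exact Prod.ext e1 e2

theorem mem_convexHull_of_between {s : Set (ℝ × ℝ)} {x₁ x₂ x y : ℝ}
    (h₁ : (x₁, y) ∈ convexHull ℝ s) (h₂ : (x₂, y) ∈ convexHull ℝ s) (hx₁ : x₁ ≤ x) (hx₂ : x ≤ x₂) :
    (x, y) ∈ convexHull ℝ s := by
  rcases hx₁.eq_or_lt with rfl | hlt
  · exact h₁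
  have hpos : 0 < x₂ - x₁ := by linarith
  have := (convex_convexHull ℝ s) h₁ h₂ (a := (x₂ - x) / (x₂ - x₁)) (b := (x - x₁) / (x₂ - x₁))
    (by apply div_nonneg <;> linarith) (by apply div_nonneg <;> linarith) (by field_simp; ring)
  convert this using 1
  ext
  · simp; field_simp; ring
  · simp; field_simp; ring

theorem mem_convexHull_combo {s : Set (ℝ × ℝ)} {p q : ℝ × ℝ} (hp : p ∈ s) (hq : q ∈ s) (t : ℝ)
    (ht : 0 ≤ t) (ht' : t ≤ 1) :
    (p.1 + t * (q.1 - p.1), p.2 + t * (q.2 - p.2)) ∈ convexHull ℝ s := by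
  have := (convex_convexHull ℝ s) (subset_convexHull ℝ s hp) (subset_convexHull ℝ s hq)
    (a := 1 - t) (b := t) (by linarith) ht (by ring)
  convert this using 1
  ext
  · simp; ring
  · simp; ring

/-! ### The minimal semitoric polygons -/

/-- The triple `(Δ, ((a, h)), (+1))` for minimal type (1). -/
def tripleOne (a h : ℝ) : Triple 1 where
  Δ := convexHull ℝ {(0, 0), (a, a / 2), (2 * a, 0)}
  c := ![(a, h)]
  ε := ![1]

/-- The triple `(Δ, ((a, h₁), (a + b, h₂)), (+1, +1))` for minimal type (2). -/
def tripleTwo (a b h₁ h₂ : ℝ) : Triple 2 where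
  Δ := convexHull ℝ {(0, 0), (a, a), (a + b, a), (2 * a + b, 0)}
  c := ![(a, h₁), (a + b, h₂)]
  ε := ![1, 1]

/-- The triple `(Δ, ((a, h)), (+1))` for minimal type (3a). -/
def tripleThreeA (a b h : ℝ) (n : ℤ) : Triple 1 where
  Δ := convexHull ℝ {(0, 0), (a, a), (a + b, a), (a * n + b, 0)}
  c := ![(a, h)]
  ε := ![1]

/-- The triple `(Δ, ((a, h)), (+1))` for minimal type (3b). -/
def tripleThreeB (a h : ℝ) (n : ℤ) : Triple 1 where
  Δ := convexHull ℝ {(0, 0), (a, a), (a * n, 0)}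
  c := ![(a, h)]
  ε := ![1]

/-- The triple `(Δ, ((a, h)), (+1))` for minimal type (3c). -/
def tripleThreeC (a b h : ℝ) (n : ℤ) : Triple 1 where
  Δ := convexHull ℝ {(0, 0), (a + b, a + b), (a, a + b / (n - 1)), (a * n + b, 0)}
  c := ![(a, h)]
  ε := ![1]

theorem hullOne {a : ℝ} (ha : 0 < a) :
    convexHull ℝ {((0 : ℝ), (0 : ℝ)), (a, a / 2), (2 * a, 0)} =
      halfPlanes ![(0, -1), (-1, 2), (1, 2)] ![0, 0, 2 * a] := by
  apply Subset.antisymm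
  · refine convexHull_min ?_ (convex_halfPlanes _ _)
    rintro p (rfl | rfl | rfl) i <;> fin_cases i <;> simp <;> linarith
  · rintro ⟨x, y⟩ hp
    have h0 := hp 0
    have h1 := hp 1
    have h2 := hp 2
    simp at h0 h1 h2
    have t0 : 0 ≤ y / (a / 2) := by positivity
    have t1 : y / (a / 2) ≤ 1 := by rw [div_le_one (by positivity)]; linarith
    have L := mem_convexHull_combo (s := {((0 : ℝ), (0 : ℝ)), (a, a / 2), (2 * a, 0)})
      (p := (0, 0)) (q := (a, a / 2)) (by simp) (by simp) _ t0 t1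
    have R := mem_convexHull_combo (s := {((0 : ℝ), (0 : ℝ)), (a, a / 2), (2 * a, 0)})
      (p := (2 * a, 0)) (q := (a, a / 2)) (by simp) (by simp) _ t0 t1
    have e1 : y / (a / 2) * a = 2 * y := by field_simp
    have e2 : y / (a / 2) * (a / 2) = y := by field_simp
    simp only [sub_zero, zero_add, e1, e2] at L R
    have e3 : 2 * a + y / (a / 2) * (a - 2 * a) = 2 * a - 2 * y := by linear_combination -e1
    rw [e3] at R
    exact mem_convexHull_of_between L R (by linarith) (by linarith)

theorem hullTrapezoid {a b : ℝ} {n : ℤ} (ha : 0 < a) (hb : 0 ≤ b) (hn : 1 ≤ n) :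
    convexHull ℝ {((0 : ℝ), (0 : ℝ)), (a, a), (a + b, a), (a * n + b, 0)} =
      halfPlanes ![(0, -1), (-1, 1), (0, 1), (1, n - 1)] ![0, 0, a, a * n + b] := by
  have hn' : (1 : ℝ) ≤ n := by exact_mod_cast hn
  have han : 0 ≤ a * (n - 1) := mul_nonneg ha.le (by linarith)
  apply Subset.antisymm
  · refine convexHull_min ?_ (convex_halfPlanes _ _)
    rintro p (rfl | rfl | rfl | rfl) i <;> fin_cases i <;> simp <;> nlinarith
  · rintro ⟨x, y⟩ hp
    have h0 := hp 0
    have h1 := hp 1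
    have h2 := hp 2
    have h3 := hp 3
    simp at h0 h1 h2 h3
    have t0 : 0 ≤ y / a := by positivity
    have t1 : y / a ≤ 1 := by rw [div_le_one (by positivity)]; linarith
    have L := mem_convexHull_combo
      (s := {((0 : ℝ), (0 : ℝ)), (a, a), (a + b, a), (a * n + b, 0)})
      (p := (0, 0)) (q := (a, a)) (by simp) (by simp) _ t0 t1
    have R := mem_convexHull_combo
      (s := {((0 : ℝ), (0 : ℝ)), (a, a), (a + b, a), (a * n + b, 0)})
      (p := (a * n + b, 0)) (q := (a + b, a)) (by simp) (by simp) _ t0 t1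
    have e1 : y / a * a = y := by field_simp
    simp only [sub_zero, zero_add, e1] at L R
    have e3 : a * n + b + y / a * (a + b - (a * n + b)) = a * n + b - (n - 1) * y := by
      linear_combination (1 - n : ℝ) * e1
    rw [e3] at R
    exact mem_convexHull_of_between L R (by linarith) (by linarith)

theorem hullTriangle {a : ℝ} {n : ℤ} (ha : 0 < a) (hn : 1 ≤ n) :
    convexHull ℝ {((0 : ℝ), (0 : ℝ)), (a, a), (a * n, 0)} =
      halfPlanes ![(0, -1), (-1, 1), (0, 1), (1, n - 1)] ![0, 0, a, a * n] := by
  have := hullTrapezoid ha le_rfl hn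
  simpa using this

theorem hullThreeC {a b : ℝ} {n : ℤ} (ha : 0 < a) (hb : b < 0) (hab : -a < b) (hn : 2 ≤ n) :
    convexHull ℝ {((0 : ℝ), (0 : ℝ)), (a + b, a + b), (a, a + b / (n - 1)), (a * n + b, 0)} =
      halfPlanes ![(0, -1), (-1, 1), (2 - n, n - 1), (1, n - 1)] ![0, 0, a + b, a * n + b] := by
  have hn' : (2 : ℝ) ≤ n := by exact_mod_cast hn
  obtain ⟨m, hm⟩ : ∃ m : ℝ, m = n - 1 := ⟨_, rfl⟩
  have hm1 : 1 ≤ m := by linarith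
  obtain ⟨d, hd⟩ : ∃ d : ℝ, d = b / m := ⟨_, rfl⟩
  have hdm : d * m = b := by rw [hd]; field_simp
  have hd0 : d < 0 := by rw [hd]; exact div_neg_of_neg_of_pos hb (by linarith)
  have hbd : b ≤ d := by nlinarith
  have hnm : (n : ℝ) = m + 1 := by linarith
  have hpos : 0 ≤ (m - 1) * (a * (m + 1) + b) :=
    mul_nonneg (by linarith) (by nlinarith [mul_nonneg ha.le (by linarith : (0 : ℝ) ≤ m)])
  rw [← hm, ← hd]
  apply Subset.antisymm
  · refine convexHull_min ?_ (convex_halfPlanes _ _)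
    rintro p (rfl | rfl | rfl | rfl) i <;> fin_cases i <;> simp [hnm] <;> nlinarith
  · rintro ⟨x, y⟩ hp
    have h0 := hp 0
    have h1 := hp 1
    have h2 := hp 2
    have h3 := hp 3
    simp [hnm] at h0 h1 h2 h3
    have hy : y ≤ a + d := by
      have : m ^ 2 * y ≤ m ^ 2 * (a + d) := by nlinarith
      exact le_of_mul_le_mul_left this (by positivity)
    have had : 0 < a + d := by linarith
    have R := mem_convexHull_combo
      (s := {((0 : ℝ), (0 : ℝ)), (a + b, a + b), (a, a + d), (a * n + b, 0)})
      (p := (a * n + b, 0)) (q := (a, a + d)) (by simp) (by simp) (y / (a + d)) (by positivity)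
      (by rw [div_le_one had]; exact hy)
    have e1 : y / (a + d) * (a + d) = y := by field_simp
    simp only [sub_zero, zero_add, e1] at R
    have e2 : a * n + b + y / (a + d) * (a - (a * n + b)) = a * n + b - m * y := by
      rw [hnm, ← hdm]; linear_combination (-m) * e1
    rw [e2] at R
    rcases le_or_gt y (a + b) with hyab | hyab
    · have hab' : 0 < a + b := by linarith
      have L := mem_convexHull_combo
        (s := {((0 : ℝ), (0 : ℝ)), (a + b, a + b), (a, a + d), (a * n + b, 0)})
        (p := (0, 0)) (q := (a + b, a + b)) (by simp) (by simp) (y / (a + b)) (by positivity)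
        (by rw [div_le_one hab']; exact hyab)
      have e3 : y / (a + b) * (a + b) = y := by field_simp
      simp only [sub_zero, zero_add, e3] at L
      exact mem_convexHull_of_between L R (by linarith) (by rw [hnm]; linarith)
    · have hbd' : 0 < d - b := by linarith
      have L := mem_convexHull_combo
        (s := {((0 : ℝ), (0 : ℝ)), (a + b, a + b), (a, a + d), (a * n + b, 0)})
        (p := (a + b, a + b)) (q := (a, a + d)) (by simp) (by simp) ((y - (a + b)) / (d - b))
        (div_nonneg (by linarith) hbd'.le) (by rw [div_le_one hbd']; linarith)
      have e3 : (y - (a + b)) / (d - b) * (a + d - (a + b)) = y - (a + b) := by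
        rw [show a + d - (a + b) = d - b by ring]; field_simp
      have e4 : a + b + (y - (a + b)) = y := by ring
      simp only [e3, e4] at L
      refine mem_convexHull_of_between L R ?_ (by rw [hnm]; linarith)
      have hm2 : 1 < m := by nlinarith
      have e5 : (y - (a + b)) / (d - b) * (a - (a + b)) = (y - (a + b)) * m / (m - 1) := by
        have : m - 1 ≠ 0 := by linarith
        have : d ≠ 0 := hd0.ne
        have : d - b ≠ 0 := hbd'.ne'
        rw [div_mul_eq_mul_div, div_eq_div_iff (by assumption) (by assumption), ← hdm]
        ring
      rw [e5, ← le_sub_iff_add_le', div_le_iff₀ (by linarith)]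
      nlinarith

theorem isRationalPolygon_of {V : Set (ℝ × ℝ)} (hV : V.Finite) {N : ℕ} {ν : Fin N → ℤ × ℤ}
    {β : Fin N → ℝ} (h : convexHull ℝ V = halfPlanes ν β) {p : ℝ × ℝ}
    (hp : p ∈ interior (convexHull ℝ V)) : IsRationalPolygon (convexHull ℝ V) :=
  ⟨isBounded_convexHull.2 hV.isBounded, ⟨p, hp⟩, N, ν, β, h⟩

theorem numCuts_eq_one {R : Triple 1} {q : ℝ × ℝ} (h : ∃ i, q ∈ R.cut i) : R.numCuts q = 1 := by
  obtain ⟨i, hi⟩ := h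
  have : {i | q ∈ R.cut i} = {i} := by
    ext j; simp [Subsingleton.elim j i, hi]
  rw [Triple.numCuts, this, ncard_singleton]

theorem isRepresentative_tripleOne {a h : ℝ} (ha : 0 < a) (hh : 0 < h) (hh' : h < a / 2) :
    (tripleOne a h).IsRepresentative := by
  have hH := hullOne ha
  have hint : (a, h) ∈ interior (convexHull ℝ {((0 : ℝ), (0 : ℝ)), (a, a / 2), (2 * a, 0)}) := by
    rw [hH]; apply mem_interior_halfPlanes
    intro i; fin_cases i <;> simp <;> linarith
  refine ⟨isRationalPolygon_of (by simp) hH hint, ?_, ?_, ?_⟩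
  · intro i; fin_cases i; exact hint
  · intro q hq hc
    rw [numCuts_eq_one hc]
    obtain ⟨i, -, hx, hy⟩ := hc
    fin_cases i
    simp [tripleOne, sign] at hx hy
    simp only [tripleOne, hH] at hq ⊢
    obtain ⟨hm, hex⟩ := exists_eq_of_mem_frontier hq
    have h0 := hm 0
    have h1 := hm 1
    have h2 := hm 2
    simp at h0 h1 h2
    simp [Fin.exists_fin_succ] at hex
    have hqe : q = (a, a / 2) := by
      ext
      · exact hx
      · simp only []
        rcases hex with e | e | e <;> linarith
    subst hqe
    refine ⟨isVertex_halfPlanes hm 1 2 (by simp [det]) (by simp; ring) (by simp; ring), Or.inl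
      ⟨(-2, -1), (2, -1), ?_, ?_, by simp [det], by simp [det, powT]⟩⟩
    · refine isEdgeVector_halfPlanes (by norm_num) (a / 2) (by linarith) 1 hm ?_ (by simp; ring)
        (by simp) (by simp)
      intro i; fin_cases i <;> (simp [toPlane]; try linarith)
    · refine isEdgeVector_halfPlanes (by norm_num) (a / 2) (by linarith) 2 hm ?_ (by simp; ring)
        (by simp) (by simp)
      intro i; fin_cases i <;> (simp [toPlane]; try linarith)
  · intro v hv hc
    refine ⟨hv, hc, ?_⟩
    have hv' := extremePoints_convexHull_subset hv
    have hm := hv.1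
    simp only [tripleOne, hH] at hm ⊢
    rcases hv' with rfl | rfl | rfl
    · refine ⟨(1, 0), (2, 1), ?_, ?_, by simp [det]⟩
      · refine isEdgeVector_halfPlanes (by norm_num) (2 * a) (by linarith) 0 hm ?_ (by simp)
          (by simp) (by simp)
        intro i; fin_cases i <;> (simp [toPlane]; try linarith)
      · refine isEdgeVector_halfPlanes (by norm_num) (a / 2) (by linarith) 1 hm ?_ (by simp)
          (by simp) (by simp)
        intro i; fin_cases i <;> (simp [toPlane]; try linarith)
    · exact absurd ⟨hv.1, rfl, by simp [tripleOne, sign]; linarith⟩ (hc 0)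
    · refine ⟨(-2, 1), (-1, 0), ?_, ?_, by simp [det]⟩
      · refine isEdgeVector_halfPlanes (by norm_num) (a / 2) (by linarith) 2 hm ?_ (by simp)
          (by simp) (by simp)
        intro i; fin_cases i <;> (simp [toPlane]; try linarith)
      · refine isEdgeVector_halfPlanes (by norm_num) (2 * a) (by linarith) 0 hm ?_ (by simp)
          (by simp) (by simp)
        intro i; fin_cases i <;> (simp [toPlane]; try linarith)

theorem isRepresentative_tripleThreeB {a h : ℝ} {n : ℤ} (ha : 0 < a) (hh : 0 < h) (hh' : h < a)
    (hn : 2 ≤ n) : (tripleThreeB a h n).IsRepresentative := by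
  have hH := hullTriangle ha (by linarith : 1 ≤ n)
  have hn' : (2 : ℝ) ≤ n := by exact_mod_cast hn
  have hint : (a, h) ∈ interior (convexHull ℝ {((0 : ℝ), (0 : ℝ)), (a, a), (a * n, 0)}) := by
    rw [hH]; apply mem_interior_halfPlanes
    intro i; fin_cases i <;> simp <;> nlinarith
  have h1n : (1 : ℤ) - n ≠ 0 := by omega
  refine ⟨isRationalPolygon_of (by simp) hH hint, ?_, ?_, ?_⟩
  · intro i; fin_cases i; exact hint
  · intro q hq hc
    rw [numCuts_eq_one hc]
    obtain ⟨i, -, hx, hy⟩ := hc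
    fin_cases i
    simp [tripleThreeB, sign] at hx hy
    simp only [tripleThreeB, hH] at hq ⊢
    obtain ⟨hm, hex⟩ := exists_eq_of_mem_frontier hq
    have h0 := hm 0
    have h1 := hm 1
    have h2 := hm 2
    have h3 := hm 3
    simp at h0 h1 h2 h3
    simp [Fin.exists_fin_succ] at hex
    have hqe : q = (a, a) := by
      ext
      · exact hx
      · simp only []
        rcases hex with e | e | e | e <;> nlinarith
    subst hqe
    refine ⟨isVertex_halfPlanes hm 1 2 (by simp [det]) (by simp) (by simp), Or.inr
      ⟨(-1, -1), (n - 1, -1), ?_, ?_, by simp [det]; omega, by simp [det, powT]⟩⟩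
    · refine isEdgeVector_halfPlanes (by norm_num) a (by linarith) 1 hm ?_ (by simp)
        (by simp) (by simp)
      intro i; fin_cases i <;> simp [toPlane] <;> nlinarith
    · refine isEdgeVector_halfPlanes ⟨0, -1, by ring⟩ a (by linarith) 3 hm ?_ (by simp; ring)
        (by simp) (by simp)
      intro i; fin_cases i <;> simp [toPlane] <;> nlinarith
  · intro v hv hc
    refine ⟨hv, hc, ?_⟩
    have hv' := extremePoints_convexHull_subset hv
    have hm := hv.1
    simp only [tripleThreeB, hH] at hm ⊢
    rcases hv' with rfl | rfl | rfl
    · refine ⟨(1, 0), (1, 1), ?_, ?_, by simp [det]⟩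
      · refine isEdgeVector_halfPlanes (by norm_num) a (by linarith) 0 hm ?_ (by simp)
          (by simp) (by simp)
        intro i; fin_cases i <;> simp [toPlane] <;> nlinarith
      · refine isEdgeVector_halfPlanes (by norm_num) a (by linarith) 1 hm ?_ (by simp)
          (by simp) (by simp)
        intro i; fin_cases i <;> simp [toPlane] <;> nlinarith
    · exact absurd ⟨hv.1, rfl, by simp [tripleThreeB, sign]; linarith⟩ (hc 0)
    · refine ⟨(1 - n, 1), (-1, 0), ?_, ?_, by simp [det]⟩
      · refine isEdgeVector_halfPlanes ⟨0, 1, by ring⟩ a (by linarith) 3 hm ?_ (by simp)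
          (by simp) (by simp)
        intro i; fin_cases i <;> simp [toPlane] <;> nlinarith
      · refine isEdgeVector_halfPlanes (by norm_num) a (by linarith) 0 hm ?_ (by simp)
          (by simp) (by simp)
        intro i; fin_cases i <;> simp [toPlane] <;> nlinarith

theorem isRepresentative_tripleThreeA {a b h : ℝ} {n : ℤ} (ha : 0 < a) (hb : 0 < b) (hh : 0 < h)
    (hh' : h < a) (hn : 1 ≤ n) : (tripleThreeA a b h n).IsRepresentative := by
  have hH := hullTrapezoid ha hb.le hn
  have hn' : (1 : ℝ) ≤ n := by exact_mod_cast hn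
  have hint : (a, h) ∈ interior
      (convexHull ℝ {((0 : ℝ), (0 : ℝ)), (a, a), (a + b, a), (a * n + b, 0)}) := by
    rw [hH]; apply mem_interior_halfPlanes
    intro i; fin_cases i <;> simp <;> nlinarith
  refine ⟨isRationalPolygon_of (by simp) hH hint, ?_, ?_, ?_⟩
  · intro i; fin_cases i; exact hint
  · intro q hq hc
    rw [numCuts_eq_one hc]
    obtain ⟨i, -, hx, hy⟩ := hc
    fin_cases i
    simp [tripleThreeA, sign] at hx hy
    simp only [tripleThreeA, hH] at hq ⊢
    obtain ⟨hm, hex⟩ := exists_eq_of_mem_frontier hq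
    have h0 := hm 0
    have h1 := hm 1
    have h2 := hm 2
    have h3 := hm 3
    simp at h0 h1 h2 h3
    simp [Fin.exists_fin_succ] at hex
    have hqe : q = (a, a) := by
      ext
      · exact hx
      · simp only []
        rcases hex with e | e | e | e <;> nlinarith
    subst hqe
    refine ⟨isVertex_halfPlanes hm 1 2 (by simp [det]) (by simp) (by simp), Or.inl
      ⟨(-1, -1), (1, 0), ?_, ?_, by simp [det], by simp [det, powT]⟩⟩
    · refine isEdgeVector_halfPlanes (by norm_num) a (by linarith) 1 hm ?_ (by simp)
        (by simp) (by simp)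
      intro i; fin_cases i <;> simp [toPlane] <;> nlinarith
    · refine isEdgeVector_halfPlanes (by norm_num) b (by linarith) 2 hm ?_ (by simp)
        (by simp) (by simp)
      intro i; fin_cases i <;> simp [toPlane] <;> nlinarith
  · intro v hv hc
    refine ⟨hv, hc, ?_⟩
    have hv' := extremePoints_convexHull_subset hv
    have hm := hv.1
    simp only [tripleThreeA, hH] at hm ⊢
    rcases hv' with rfl | rfl | rfl | rfl
    · refine ⟨(1, 0), (1, 1), ?_, ?_, by simp [det]⟩
      · refine isEdgeVector_halfPlanes (by norm_num) a (by linarith) 0 hm ?_ (by simp)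
          (by simp) (by simp)
        intro i; fin_cases i <;> simp [toPlane] <;> nlinarith
      · refine isEdgeVector_halfPlanes (by norm_num) a (by linarith) 1 hm ?_ (by simp)
          (by simp) (by simp)
        intro i; fin_cases i <;> simp [toPlane] <;> nlinarith
    · exact absurd ⟨hv.1, rfl, by simp [tripleThreeA, sign]; linarith⟩ (hc 0)
    · refine ⟨(-1, 0), (n - 1, -1), ?_, ?_, by simp [det]⟩
      · refine isEdgeVector_halfPlanes (by norm_num) b (by linarith) 2 hm ?_ (by simp)
          (by simp) (by simp)
        intro i; fin_cases i <;> simp [toPlane] <;> nlinarith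
      · refine isEdgeVector_halfPlanes ⟨0, -1, by ring⟩ a (by linarith) 3 hm ?_ (by simp; ring)
          (by simp) (by simp)
        intro i; fin_cases i <;> simp [toPlane] <;> nlinarith
    · refine ⟨(1 - n, 1), (-1, 0), ?_, ?_, by simp [det]⟩
      · refine isEdgeVector_halfPlanes ⟨0, 1, by ring⟩ a (by linarith) 3 hm ?_ (by simp)
          (by simp) (by simp)
        intro i; fin_cases i <;> simp [toPlane] <;> nlinarith
      · refine isEdgeVector_halfPlanes (by norm_num) a (by linarith) 0 hm ?_ (by simp)
          (by simp) (by simp)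
        intro i; fin_cases i <;> simp [toPlane] <;> nlinarith

theorem isRepresentative_tripleThreeC {a b h : ℝ} {n : ℤ} (ha : 0 < a) (hb : b < 0) (hab : -a < b)
    (hn : 2 ≤ n) (hh : 0 < h) (hh' : h < a + b / (n - 1)) :
    (tripleThreeC a b h n).IsRepresentative := by
  have hH := hullThreeC ha hb hab hn
  have hn' : (2 : ℝ) ≤ n := by exact_mod_cast hn
  obtain ⟨d, hd⟩ : ∃ d : ℝ, d = b / (n - 1) := ⟨_, rfl⟩
  have hn0 : (n : ℝ) - 1 ≠ 0 := by linarith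
  have hdm : b = d * (n - 1) := by rw [hd]; field_simp
  have hd0 : d < 0 := by rw [hd]; exact div_neg_of_neg_of_pos hb (by linarith)
  have hint : (a, h) ∈ interior (convexHull ℝ
      {((0 : ℝ), (0 : ℝ)), (a + b, a + b), (a, a + b / (n - 1)), (a * n + b, 0)}) := by
    rw [hH]; apply mem_interior_halfPlanes
    rw [← hd] at hh'
    have := mul_lt_mul_of_pos_right hh' (by linarith : (0 : ℝ) < n - 1)
    intro i; fin_cases i <;> simp <;> nlinarith
  refine ⟨isRationalPolygon_of (by simp) hH hint, ?_, ?_, ?_⟩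
  · intro i; fin_cases i; exact hint
  · intro q hq hc
    rw [numCuts_eq_one hc]
    obtain ⟨i, -, hx, hy⟩ := hc
    fin_cases i
    simp [tripleThreeC, sign] at hx hy
    simp only [tripleThreeC, hH] at hq ⊢
    obtain ⟨hm, hex⟩ := exists_eq_of_mem_frontier hq
    have h0 := hm 0
    have h1 := hm 1
    have h2 := hm 2
    have h3 := hm 3
    simp [hx, hdm] at h0 h1 h2 h3
    simp [Fin.exists_fin_succ, hx, hdm] at hex
    rw [← hd] at hh'
    have hle : q.2 ≤ a + d :=
      le_of_mul_le_mul_left (by linarith) (by linarith : (0 : ℝ) < n - 1)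
    have hqe : q = (a, a + d) := by
      ext
      · exact hx
      · refine mul_left_cancel₀ hn0 ?_
        rcases hex with e | e | e | e
        · linarith
        · linarith
        · linear_combination e
        · linear_combination e
    subst hqe
    refine ⟨isVertex_halfPlanes hm 2 3 (ne_of_lt (by simp [det]; nlinarith))
      (by simp [hdm]; ring) (by simp [hdm]; ring), Or.inl
      ⟨(1 - n, 2 - n), (n - 1, -1), ?_, ?_, by simp [det]; nlinarith, by simp [det, powT]; ring⟩⟩
    · refine isEdgeVector_halfPlanes ⟨-1, 1, by ring⟩ (-d) (by linarith) 2 hm ?_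
        (by simp [hdm]; ring) (by simp; omega) (by simp; ring)
      intro i; fin_cases i <;> simp [toPlane, hdm] <;> nlinarith
    · refine isEdgeVector_halfPlanes ⟨0, -1, by ring⟩ (a + d) (by linarith) 3 hm ?_
        (by simp [hdm]; ring) (by simp) (by simp)
      have := mul_nonneg (by linarith : (0 : ℝ) ≤ n - 2)
        (add_nonneg ha.le (mul_nonneg (by linarith : 0 ≤ a + d) (by linarith : (0 : ℝ) ≤ n - 1)))
      intro i; fin_cases i <;> simp [toPlane, hdm] <;> nlinarith
  · intro v hv hc
    refine ⟨hv, hc, ?_⟩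
    have hv' := extremePoints_convexHull_subset hv
    have hm := hv.1
    simp only [tripleThreeC, hH] at hm ⊢
    rcases hv' with rfl | rfl | rfl | rfl
    · refine ⟨(1, 0), (1, 1), ?_, ?_, by simp [det]⟩
      · refine isEdgeVector_halfPlanes (by norm_num) (a + b) (by linarith) 0 hm ?_ (by simp)
          (by simp) (by simp)
        intro i; fin_cases i <;> simp [toPlane] <;> nlinarith
      · refine isEdgeVector_halfPlanes (by norm_num) (a + b) (by linarith) 1 hm ?_ (by simp)
          (by simp) (by simp)
        intro i; fin_cases i <;> simp [toPlane] <;> nlinarith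
    · refine ⟨(-1, -1), (n - 1, n - 2), ?_, ?_, by simp [det]⟩
      · refine isEdgeVector_halfPlanes (by norm_num) (a + b) (by linarith) 1 hm ?_ (by simp)
          (by simp) (by simp)
        intro i; fin_cases i <;> simp [toPlane] <;> nlinarith
      · refine isEdgeVector_halfPlanes ⟨1, -1, by ring⟩ (-d) (by linarith) 2 hm ?_
          (by simp; ring) (by simp; omega) (by simp; ring)
        intro i; fin_cases i <;> simp [toPlane, hdm] <;> nlinarith
    · exact absurd ⟨hv.1, rfl, by simp [tripleThreeC, sign]; linarith⟩ (hc 0)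
    · rw [← hd] at hh'
      refine ⟨(1 - n, 1), (-1, 0), ?_, ?_, by simp [det]⟩
      · refine isEdgeVector_halfPlanes ⟨0, 1, by ring⟩ (a + d) (by linarith) 3 hm ?_ (by simp)
          (by simp) (by simp)
        intro i; fin_cases i <;> simp [toPlane, hdm] <;> nlinarith
      · refine isEdgeVector_halfPlanes (by norm_num) a (by linarith) 0 hm ?_ (by simp)
          (by simp) (by simp)
        have h2 : (0 : ℝ) ≤ n - 2 := by linarith
        have := mul_nonneg h2 (by nlinarith [mul_nonneg ha.le h2] : 0 ≤ a * n + b + -a)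
        intro i; fin_cases i <;> simp [toPlane] <;> nlinarith

theorem isRepresentative_tripleTwo {a b h₁ h₂ : ℝ} (ha : 0 < a) (hb : 0 ≤ b) (hh₁ : 0 < h₁)
    (hh₁' : h₁ < a) (hh₂ : 0 < h₂) (hh₂' : h₂ < a) : (tripleTwo a b h₁ h₂).IsRepresentative := by
  have hH : convexHull ℝ {((0 : ℝ), (0 : ℝ)), (a, a), (a + b, a), (2 * a + b, 0)} =
      halfPlanes ![(0, -1), (-1, 1), (0, 1), (1, 1)] ![0, 0, a, 2 * a + b] := by
    have := hullTrapezoid (n := 2) ha hb (by norm_num)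
    norm_num at this
    rwa [mul_comm] at this
  have hΔ : (tripleTwo a b h₁ h₂).Δ = halfPlanes ![(0, -1), (-1, 1), (0, 1), (1, 1)]
    ![0, 0, a, 2 * a + b] := hH
  have hint : ∀ i, (tripleTwo a b h₁ h₂).c i ∈ interior (convexHull ℝ
      {((0 : ℝ), (0 : ℝ)), (a, a), (a + b, a), (2 * a + b, 0)}) := by
    rw [hH]; intro j; apply mem_interior_halfPlanes
    intro i; fin_cases j <;> fin_cases i <;> simp [tripleTwo] <;> linarith
  refine ⟨isRationalPolygon_of (by simp) hH (hint 0), hint, ?_, ?_⟩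
  · intro q hq hc
    obtain ⟨i, hc⟩ := hc
    have hcut : ∀ j, q.1 = ((tripleTwo a b h₁ h₂).c j).1 → q.2 = a ∧
        q ∈ (tripleTwo a b h₁ h₂).cut j := by
      have hy : 0 < q.2 := by
        obtain ⟨-, -, hy⟩ := hc
        fin_cases i <;> simp [tripleTwo, sign] at hy <;> linarith
      have hqm := hq
      simp only [tripleTwo, hH] at hqm
      obtain ⟨hm, hex⟩ := exists_eq_of_mem_frontier hqm
      have h1 := hm 1
      have h2 := hm 2
      have h3 := hm 3
      simp at h1 h2 h3
      simp [Fin.exists_fin_succ] at hex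
      intro j hj
      have hqa : q.2 = a := by
        fin_cases j <;> simp [tripleTwo] at hj <;> rcases hex with e | e | e | e <;> linarith
      refine ⟨hqa, by simpa only [Triple.cut, tripleTwo, hH] using hm, hj, ?_⟩
      fin_cases j <;> simp [tripleTwo, sign, hqa] <;> linarith
    have hqi := hcut i hc.2.1
    have hx := hc.2.1
    rw [hΔ] at hq ⊢
    have hm := (exists_eq_of_mem_frontier hq).1
    rcases hb.eq_or_lt with rfl | hb
    · have hqe : q = (a, a) := by
        refine Prod.ext ?_ hqi.1
        fin_cases i <;> simpa [tripleTwo] using hx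
      have hnum : (tripleTwo a 0 h₁ h₂).numCuts q = 2 := by
        have : {j | q ∈ (tripleTwo a 0 h₁ h₂).cut j} = univ := by
          refine eq_univ_of_forall fun j => (hcut j ?_).2
          rw [hqe]; fin_cases j <;> simp [tripleTwo]
        rw [Triple.numCuts, this, ncard_univ, Nat.card_fin]
      rw [hnum]
      subst hqe
      refine ⟨isVertex_halfPlanes hm 1 2 (by simp [det]) (by simp) (by simp), Or.inl
        ⟨(-1, -1), (1, -1), ?_, ?_, by simp [det], by simp [det, powT]⟩⟩
      · refine isEdgeVector_halfPlanes (by norm_num) a (by linarith) 1 hm ?_ (by simp)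
          (by simp) (by simp)
        intro i; fin_cases i <;> simp [toPlane] <;> linarith
      · refine isEdgeVector_halfPlanes (by norm_num) a (by linarith) 3 hm ?_ (by simp; ring)
          (by simp) (by simp)
        intro i; fin_cases i <;> simp [toPlane] <;> linarith
    · have hnum : (tripleTwo a b h₁ h₂).numCuts q = 1 := by
        have : {j | q ∈ (tripleTwo a b h₁ h₂).cut j} = {i} := by
          ext j
          refine ⟨fun hj => ?_, fun hj => hj ▸ hqi.2⟩
          have h := hj.2.1.symm.trans hx
          fin_cases i <;> fin_cases j <;> simp [tripleTwo] at h ⊢ <;> exact hb.ne' h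
        rw [Triple.numCuts, this, ncard_singleton]
      rw [hnum]
      have hy := hqi.1
      clear hqi hcut hnum hc
      fin_cases i
      · obtain rfl : q = (a, a) := Prod.ext (by simpa [tripleTwo] using hx) hy
        refine ⟨isVertex_halfPlanes hm 1 2 (by simp [det]) (by simp) (by simp), Or.inl
          ⟨(-1, -1), (1, 0), ?_, ?_, by simp [det], by simp [det, powT]⟩⟩
        · refine isEdgeVector_halfPlanes (by norm_num) a (by linarith) 1 hm ?_ (by simp)
            (by simp) (by simp)
          intro i; fin_cases i <;> simp [toPlane] <;> linarith
        · refine isEdgeVector_halfPlanes (by norm_num) b (by linarith) 2 hm ?_ (by simp)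
            (by simp) (by simp)
          intro i; fin_cases i <;> simp [toPlane] <;> linarith
      · obtain rfl : q = (a + b, a) := Prod.ext (by simpa [tripleTwo] using hx) hy
        refine ⟨isVertex_halfPlanes hm 2 3 (by simp [det]) (by simp) (by simp; ring), Or.inl
          ⟨(-1, 0), (1, -1), ?_, ?_, by simp [det], by simp [det, powT]⟩⟩
        · refine isEdgeVector_halfPlanes (by norm_num) b (by linarith) 2 hm ?_ (by simp)
            (by simp) (by simp)
          intro i; fin_cases i <;> simp [toPlane] <;> linarith
        · refine isEdgeVector_halfPlanes (by norm_num) a (by linarith) 3 hm ?_ (by simp; ring)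
            (by simp) (by simp)
          intro i; fin_cases i <;> simp [toPlane] <;> linarith
  · intro v hv hc
    refine ⟨hv, hc, ?_⟩
    have hv' := extremePoints_convexHull_subset hv
    have hm := hv.1
    simp only [tripleTwo, hH] at hm ⊢
    rcases hv' with rfl | rfl | rfl | rfl
    · refine ⟨(1, 0), (1, 1), ?_, ?_, by simp [det]⟩
      · refine isEdgeVector_halfPlanes (by norm_num) a (by linarith) 0 hm ?_ (by simp)
          (by simp) (by simp)
        intro i; fin_cases i <;> simp [toPlane] <;> linarith
      · refine isEdgeVector_halfPlanes (by norm_num) a (by linarith) 1 hm ?_ (by simp)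
          (by simp) (by simp)
        intro i; fin_cases i <;> simp [toPlane] <;> linarith
    · exact absurd ⟨hv.1, rfl, by simp [tripleTwo, sign]; linarith⟩ (hc 0)
    · exact absurd ⟨hv.1, rfl, by simp [tripleTwo, sign]; linarith⟩ (hc 1)
    · refine ⟨(-1, 1), (-1, 0), ?_, ?_, by simp [det]⟩
      · refine isEdgeVector_halfPlanes (by norm_num) a (by linarith) 3 hm ?_ (by simp)
          (by simp) (by simp)
        intro i; fin_cases i <;> simp [toPlane] <;> linarith
      · refine isEdgeVector_halfPlanes (by norm_num) a (by linarith) 0 hm ?_ (by simp)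
          (by simp) (by simp)
        intro i; fin_cases i <;> simp [toPlane] <;> linarith

/-- A representative of the minimal semitoric polygon of type (1). -/
def minimalOne (a h : ℝ) (ha : 0 < a) (hh : 0 < h) (hh' : h < a / 2) : Representative 1 :=
  ⟨tripleOne a h, isRepresentative_tripleOne ha hh hh'⟩

/-- A representative of the minimal semitoric polygon of type (2). -/
def minimalTwo (a b h₁ h₂ : ℝ) (ha : 0 < a) (hb : 0 ≤ b) (hh₁ : 0 < h₁) (hh₁' : h₁ < a)
    (hh₂ : 0 < h₂) (hh₂' : h₂ < a) : Representative 2 :=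
  ⟨tripleTwo a b h₁ h₂, isRepresentative_tripleTwo ha hb hh₁ hh₁' hh₂ hh₂'⟩

/-- A representative of the minimal semitoric polygon of type (3a). -/
def minimalThreeA (a b h : ℝ) (n : ℤ) (ha : 0 < a) (hb : 0 < b) (hh : 0 < h) (hh' : h < a)
    (hn : 1 ≤ n) : Representative 1 :=
  ⟨tripleThreeA a b h n, isRepresentative_tripleThreeA ha hb hh hh' hn⟩

/-- A representative of the minimal semitoric polygon of type (3b). -/
def minimalThreeB (a h : ℝ) (n : ℤ) (ha : 0 < a) (hh : 0 < h) (hh' : h < a) (hn : 2 ≤ n) :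
    Representative 1 :=
  ⟨tripleThreeB a h n, isRepresentative_tripleThreeB ha hh hh' hn⟩

/-- A representative of the minimal semitoric polygon of type (3c). -/
def minimalThreeC (a b h : ℝ) (n : ℤ) (ha : 0 < a) (hb : b < 0) (hab : -a < b) (hn : 2 ≤ n)
    (hh : 0 < h) (hh' : h < a + b / (n - 1)) : Representative 1 :=
  ⟨tripleThreeC a b h n, isRepresentative_tripleThreeC ha hb hab hn hh hh'⟩

end Semitoric

end

noncomputable section

namespace Semitoric

open Set Topology MeasureTheory

/-! ### Shears of the plane -/

/-! Every change of representative is a vertical shear `(x, y) ↦ (x, y + φ x)`, where `φ` is an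
integral multiple of `x`, plus a constant, plus or minus a kink `max (x - x_i) 0` for each reversed
cut. Such maps preserve area, and composing them adds the slopes and multiplies the signs
(`Transf.map_map`). So a packing of any representative can be pulled back to the one in the
statement, where the packed triangles become lattice triangles bent along the vertical lines through
marked points (`Triple.IsCornerTriangle`).

A packed triangle contains its apex, so disjoint triangles have distinct apices, and each apex is a
vertex of the polygon (`Triple.IsCornerTriangle.isVertex`). Near its apex the triangle agrees with
the polygon, and an oriented lattice basis is determined by the cone it spans
(`basis_eq_of_corner`); hence a triangle is determined by its apex, its size `l` and the set of
reversed cuts, and its area is `l ^ 2 / 2`. By `packingDensity_eq`, what remains is to maximise a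
sum of squares of two or three sizes.

A fake corner is never an apex: if its cuts are not all reversed, it lies on a cut, and if they are,
its two edges become collinear. For the other vertices three things bound the sizes: the triangle
stays in the polygon, it avoids the marked point, and two disjoint triangles at the ends of one edge
have sizes adding up to at most its lattice length (`add_le_of_disjoint_edge`). The last bound also
holds for an edge broken at a fake corner, which reversing the cut straightens.

In type (1) the two sizes are at most `a - h` and add up to at most `a`; the convex maximum is at
`(a - h, h)`. In type (2) both sizes reach their bound `a`. In types (3a) and (3b), the latter being
the former with `b = 0`, the sizes `u` at the origin, `q` at `(a + b, a)` and `w` at `(a * n + b,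
0)` satisfy `u ≤ a`, `q + w ≤ a`, `u + q ≤ a + b` and `u + w ≤ a * n + b`
(`tripleThreeA_constraints`). The last two matter only for `n = 1` and `b < a`, whence the case
distinction. In type (3c) the two left vertices share an edge of length `a + b`, and the right one
is bounded by the marked point and by `a`. In all cases explicit triangles attain the maximum. -/

/-- The vertical shear `(x, y) ↦ (x, y + φ x)`. -/
def vShear (φ : ℝ → ℝ) (q : ℝ × ℝ) : ℝ × ℝ := (q.1, q.2 + φ q.1)

theorem vShear_neg_vShear (φ : ℝ → ℝ) (q : ℝ × ℝ) : vShear (fun x => -φ x) (vShear φ q) = q := by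
  simp [vShear]

theorem vShear_vShear_neg (φ : ℝ → ℝ) (q : ℝ × ℝ) : vShear φ (vShear (fun x => -φ x) q) = q := by
  simp [vShear]

theorem vShear_injective (φ : ℝ → ℝ) : Function.Injective (vShear φ) :=
  Function.LeftInverse.injective (vShear_neg_vShear φ)

theorem vShear_surjective (φ : ℝ → ℝ) : Function.Surjective (vShear φ) :=
  Function.RightInverse.surjective (vShear_vShear_neg φ)

theorem continuous_vShear {φ : ℝ → ℝ} (hφ : Continuous φ) : Continuous (vShear φ) := by
  unfold vShear; fun_prop

/-- A vertical shear as a homeomorphism. -/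
def vShearHomeo {φ : ℝ → ℝ} (hφ : Continuous φ) : (ℝ × ℝ) ≃ₜ (ℝ × ℝ) where
  toFun := vShear φ
  invFun := vShear fun x => -φ x
  left_inv := vShear_neg_vShear φ
  right_inv := vShear_vShear_neg φ
  continuous_toFun := continuous_vShear hφ
  continuous_invFun := continuous_vShear hφ.neg

/-- Each vertical line is translated, so this is Fubini together with the translation invariance of
length. -/
theorem measurePreserving_vShear {φ : ℝ → ℝ} (hφ : Continuous φ) :
    MeasurePreserving (vShear φ) volume volume := by
  have := (MeasurePreserving.id (volume : Measure ℝ)).skew_product (μb := (volume : Measure ℝ))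
    (μd := (volume : Measure ℝ)) (g := fun x y => y + φ x) (by fun_prop)
    (Filter.Eventually.of_forall fun x => (measurePreserving_add_right volume (φ x)).map_eq)
  exact this

theorem area_preimage_vShear {φ : ℝ → ℝ} (hφ : Continuous φ) (A : Set (ℝ × ℝ)) :
    area (vShear φ ⁻¹' A) = area A := by
  have h := (measurePreserving_vShear hφ).measure_preimage_emb
    (vShearHomeo hφ).measurableEmbedding A
  rw [area, h, area]

theorem area_image_vShear {φ : ℝ → ℝ} (hφ : Continuous φ) (A : Set (ℝ × ℝ)) :
    area (vShear φ '' A) = area A := by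
  rw [← area_preimage_vShear hφ, preimage_image_eq _ (vShear_injective φ)]

/-! ### Corners and triangles spanned by a basis of the lattice -/

/-- The first coordinate of `v` in the basis `e₁`, `e₂`. -/
def coordA (_e₁ e₂ : ℤ × ℤ) (v : ℝ × ℝ) : ℝ := (e₂.2 : ℝ) * v.1 - (e₂.1 : ℝ) * v.2

/-- The second coordinate of `v` in the basis `e₁`, `e₂`. -/
def coordB (e₁ _e₂ : ℤ × ℤ) (v : ℝ × ℝ) : ℝ := (e₁.1 : ℝ) * v.2 - (e₁.2 : ℝ) * v.1

/-- The convex cone with apex `p` spanned by `e₁` and `e₂`. -/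
def corner (e₁ e₂ : ℤ × ℤ) (p : ℝ × ℝ) : Set (ℝ × ℝ) :=
  {q | 0 ≤ coordA e₁ e₂ (q - p) ∧ 0 ≤ coordB e₁ e₂ (q - p)}

/-- The half-open triangle with apex `p` and sides `l • e₁` and `l • e₂`. -/
def cornerTriangle (e₁ e₂ : ℤ × ℤ) (p : ℝ × ℝ) (l : ℝ) : Set (ℝ × ℝ) :=
  {q | 0 ≤ coordA e₁ e₂ (q - p) ∧ 0 ≤ coordB e₁ e₂ (q - p) ∧
    coordA e₁ e₂ (q - p) + coordB e₁ e₂ (q - p) < l}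

theorem continuous_coordA (e₁ e₂ : ℤ × ℤ) : Continuous (coordA e₁ e₂) := by
  unfold coordA; fun_prop

theorem continuous_coordB (e₁ e₂ : ℤ × ℤ) : Continuous (coordB e₁ e₂) := by
  unfold coordB; fun_prop

theorem measurableSet_cornerTriangle (e₁ e₂ : ℤ × ℤ) (p : ℝ × ℝ) (l : ℝ) :
    MeasurableSet (cornerTriangle e₁ e₂ p l) := by
  have hA : Continuous fun q => coordA e₁ e₂ (q - p) :=
    (continuous_coordA e₁ e₂).comp (continuous_id.sub continuous_const)
  have hB : Continuous fun q => coordB e₁ e₂ (q - p) :=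
    (continuous_coordB e₁ e₂).comp (continuous_id.sub continuous_const)
  exact (measurableSet_le measurable_const hA.measurable).inter
    ((measurableSet_le measurable_const hB.measurable).inter
      (measurableSet_lt (hA.add hB).measurable measurable_const))

theorem coord_injective {e₁ e₂ : ℤ × ℤ} (he : det e₁ e₂ = 1) {v : ℝ × ℝ} {s t : ℝ}
    (hs : coordA e₁ e₂ v = s) (ht : coordB e₁ e₂ v = t) :
    v = ((e₁.1 : ℝ) * s + e₂.1 * t, (e₁.2 : ℝ) * s + e₂.2 * t) := by
  have hd : (e₁.1 : ℝ) * e₂.2 - e₂.1 * e₁.2 = 1 := by exact_mod_cast he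
  subst hs ht
  ext <;> simp only [coordA, coordB]
  · linear_combination (-v.1) * hd
  · linear_combination (-v.2) * hd

theorem coordA_combo {e₁ e₂ : ℤ × ℤ} (he : det e₁ e₂ = 1) (s t : ℝ) :
    coordA e₁ e₂ ((e₁.1 : ℝ) * s + e₂.1 * t, (e₁.2 : ℝ) * s + e₂.2 * t) = s := by
  have hd : (e₁.1 : ℝ) * e₂.2 - e₂.1 * e₁.2 = 1 := by exact_mod_cast he
  simp only [coordA]; linear_combination s * hd

theorem coordB_combo {e₁ e₂ : ℤ × ℤ} (he : det e₁ e₂ = 1) (s t : ℝ) :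
    coordB e₁ e₂ ((e₁.1 : ℝ) * s + e₂.1 * t, (e₁.2 : ℝ) * s + e₂.2 * t) = t := by
  have hd : (e₁.1 : ℝ) * e₂.2 - e₂.1 * e₁.2 = 1 := by exact_mod_cast he
  simp only [coordB]; linear_combination t * hd

/-- The element of `SL₂(ℤ)` with columns `e₁` and `e₂`. -/
def slOfColumns (e₁ e₂ : ℤ × ℤ) (he : det e₁ e₂ = 1) : Matrix.SpecialLinearGroup (Fin 2) ℤ :=
  ⟨!![e₁.1, e₂.1; e₁.2, e₂.2], by simpa [Matrix.det_fin_two, det] using he⟩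

theorem det_columns (M : Matrix.SpecialLinearGroup (Fin 2) ℤ) :
    det (M.1 0 0, M.1 1 0) (M.1 0 1, M.1 1 1) = 1 := by
  have := M.2
  rw [Matrix.det_fin_two] at this
  simpa [det] using this

theorem slMap_image_modelTriangle (M : Matrix.SpecialLinearGroup (Fin 2) ℤ) (p : ℝ × ℝ) (l : ℝ) :
    (fun q => slMap M q + p) '' modelTriangle l =
      cornerTriangle (M.1 0 0, M.1 1 0) (M.1 0 1, M.1 1 1) p l := by
  have he := det_columns M
  ext q
  constructor
  · rintro ⟨v, ⟨h1, h2, h3⟩, rfl⟩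
    have hA := coordA_combo he v.1 v.2
    have hB := coordB_combo he v.1 v.2
    simp only [cornerTriangle, mem_ofPred_eq, add_sub_cancel_right, slMap]
    simp only at hA hB
    rw [hA, hB]
    exact ⟨h1, h2, h3⟩
  · rintro ⟨h1, h2, h3⟩
    have h := coord_injective he (v := q - p) rfl rfl
    refine ⟨(_, _), ⟨h1, h2, h3⟩, ?_⟩
    exact (congrArg (· + p) h.symm).trans (sub_add_cancel q p)

theorem cornerTriangle_eq_image {e₁ e₂ : ℤ × ℤ} (he : det e₁ e₂ = 1) (p : ℝ × ℝ) (l : ℝ) :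
    cornerTriangle e₁ e₂ p l = (fun q => slMap (slOfColumns e₁ e₂ he) q + p) '' modelTriangle l := by
  rw [slMap_image_modelTriangle]; simp [slOfColumns]

/-- Close to the apex the hypotenuse inequality holds automatically, so only the cone is visible. -/
theorem eventually_cornerTriangle_iff (e₁ e₂ : ℤ × ℤ) (p : ℝ × ℝ) {l : ℝ} (hl : 0 < l) :
    ∀ᶠ q in 𝓝 p, (q ∈ cornerTriangle e₁ e₂ p l ↔ q ∈ corner e₁ e₂ p) := by
  have hA := continuous_coordA e₁ e₂
  have hB := continuous_coordB e₁ e₂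
  have hc : Continuous fun q => coordA e₁ e₂ (q - p) + coordB e₁ e₂ (q - p) := by fun_prop
  have : ∀ᶠ q in 𝓝 p, coordA e₁ e₂ (q - p) + coordB e₁ e₂ (q - p) < l :=
    hc.continuousAt.eventually_lt_const (by simpa [coordA, coordB] using hl)
  filter_upwards [this] with q hq
  simp [cornerTriangle, corner, hq]

/-- The cone is determined by any neighbourhood of its apex. -/
theorem corner_subset_of_eventually {e₁ e₂ e₁' e₂' : ℤ × ℤ} {p : ℝ × ℝ}
    (h : ∀ᶠ q in 𝓝 p, (q ∈ corner e₁ e₂ p ↔ q ∈ corner e₁' e₂' p)) {v : ℝ × ℝ}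
    (hv : 0 ≤ coordA e₁ e₂ v ∧ 0 ≤ coordB e₁ e₂ v) :
    0 ≤ coordA e₁' e₂' v ∧ 0 ≤ coordB e₁' e₂' v := by
  have hcont : Continuous fun t : ℝ => p + t • v := by fun_prop
  have hev := (hcont.tendsto' 0 p (by simp)).eventually h
  -- A small positive multiple of `v` falls into the neighbourhood, and cones are invariant under
  -- positive scaling.
  obtain ⟨t, ht, h'⟩ := ((eventually_mem_nhdsWithin (a := (0 : ℝ)) (s := Ioi 0)).and
    (hev.filter_mono nhdsWithin_le_nhds)).exists
  have ht : 0 < t := ht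
  have hA : ∀ e₁ e₂, coordA e₁ e₂ (p + t • v - p) = t * coordA e₁ e₂ v := by
    intro e₁ e₂; simp [coordA]; ring
  have hB : ∀ e₁ e₂, coordB e₁ e₂ (p + t • v - p) = t * coordB e₁ e₂ v := by
    intro e₁ e₂; simp [coordB]; ring
  simp only [corner, mem_ofPred_eq, hA, hB, mul_nonneg_iff_of_pos_left ht] at h'
  exact h'.1 hv

/-- A change of basis between two bases of the same cone has nonnegative entries, and so has its
inverse, whose off-diagonal entries are `-q` and `-r`. With determinant 1 only the identity is left.
-/
theorem columns_eq_of_nonneg {p q r s : ℤ} (hp : 0 ≤ p) (hq : 0 ≤ q) (hr : 0 ≤ r) (_ : 0 ≤ s)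
    (hq' : 0 ≤ -q) (hr' : 0 ≤ -r) (h : p * s - q * r = 1) : p = 1 ∧ q = 0 ∧ r = 0 ∧ s = 1 := by
  obtain rfl : q = 0 := by omega
  obtain rfl : r = 0 := by omega
  have : p * s = 1 := by simpa using h
  have h1 := Int.eq_one_or_neg_one_of_mul_eq_one this
  have hp1 : p = 1 := by omega
  subst hp1
  simp at this
  simp [this]

/-- A lattice basis is determined by the orientation and by the cone which it spans. -/
theorem basis_eq_of_corner {e₁ e₂ e₁' e₂' : ℤ × ℤ} (he : det e₁ e₂ = 1) (he' : det e₁' e₂' = 1)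
    {p : ℝ × ℝ} (h : ∀ᶠ q in 𝓝 p, (q ∈ corner e₁ e₂ p ↔ q ∈ corner e₁' e₂' p)) :
    e₁ = e₁' ∧ e₂ = e₂' := by
  have hd : e₁.1 * e₂.2 - e₂.1 * e₁.2 = 1 := he
  have hd' : e₁'.1 * e₂'.2 - e₂'.1 * e₁'.2 = 1 := he'
  have hdr : (e₁.1 : ℝ) * e₂.2 - e₂.1 * e₁.2 = 1 := by exact_mod_cast hd
  have hdr' : (e₁'.1 : ℝ) * e₂'.2 - e₂'.1 * e₁'.2 = 1 := by exact_mod_cast hd'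
  have h1 := corner_subset_of_eventually h (v := toPlane e₁)
    ⟨by simp only [coordA, toPlane]; linarith, by simp only [coordB, toPlane]; linarith⟩
  have h2 := corner_subset_of_eventually h (v := toPlane e₂)
    ⟨by simp only [coordA, toPlane]; linarith, by simp only [coordB, toPlane]; linarith⟩
  have hs : ∀ᶠ q in 𝓝 p, (q ∈ corner e₁' e₂' p ↔ q ∈ corner e₁ e₂ p) := h.mono fun q hq => hq.symm
  have h3 := corner_subset_of_eventually hs (v := toPlane e₁')
    ⟨by simp only [coordA, toPlane]; linarith, by simp only [coordB, toPlane]; linarith⟩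
  have h4 := corner_subset_of_eventually hs (v := toPlane e₂')
    ⟨by simp only [coordA, toPlane]; linarith, by simp only [coordB, toPlane]; linarith⟩
  simp only [coordA, coordB, toPlane] at h1 h2 h3 h4
  norm_cast at h1 h2 h3 h4
  -- The matrix consists of the coordinates of `e₁`, `e₂` in the primed basis. `h3` and `h4` give
  -- the signs of the off-diagonal entries of its inverse, and the determinant is the product of two
  -- determinants equal to 1.
  obtain ⟨e1, e2, e3, e4⟩ := columns_eq_of_nonneg h1.1 h2.1 h1.2 h2.2
    (by linarith [h4.1]) (by linarith [h3.2]) (by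
      linear_combination (e₁'.1 * e₂'.2 - e₂'.1 * e₁'.2) * hd + hd')
  obtain ⟨x1, y1⟩ := e₁; obtain ⟨x2, y2⟩ := e₂
  obtain ⟨x1', y1'⟩ := e₁'; obtain ⟨x2', y2'⟩ := e₂'
  simp only at *
  refine ⟨Prod.ext ?_ ?_, Prod.ext ?_ ?_⟩ <;> simp only
  · linear_combination (-x1) * hd' + x1' * e1 + x2' * e3
  · linear_combination (-y1) * hd' + y1' * e1 + y2' * e3
  · linear_combination (-x2) * hd' + x1' * e2 + x2' * e4
  · linear_combination (-y2) * hd' + y1' * e2 + y2' * e4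

/-! ### Areas -/

/-- Cavalieri's principle. -/
theorem area_of_xSlices {A : Set (ℝ × ℝ)} (hA : MeasurableSet A) {x₀ x₁ : ℝ} (hx : x₀ ≤ x₁)
    {w : ℝ → ℝ} (hw : Continuous w) (hw0 : ∀ x ∈ Icc x₀ x₁, 0 ≤ w x)
    (hin : ∀ x ∈ Icc x₀ x₁, volume (Prod.mk x ⁻¹' A) = ENNReal.ofReal (w x))
    (hout : ∀ x ∉ Icc x₀ x₁, volume (Prod.mk x ⁻¹' A) = 0) :
    area A = ∫ x in x₀..x₁, w x := by
  have h1 : volume A = ∫⁻ x in Icc x₀ x₁, ENNReal.ofReal (w x) := by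
    rw [Measure.volume_eq_prod, Measure.prod_apply hA, ← lintegral_indicator measurableSet_Icc]
    refine lintegral_congr fun x => ?_
    by_cases h : x ∈ Icc x₀ x₁
    · rw [hin x h, indicator_of_mem h]
    · rw [hout x h, indicator_of_notMem h]
  have hint : IntegrableOn w (Icc x₀ x₁) := hw.continuousOn.integrableOn_compact isCompact_Icc
  rw [area, h1, ← ofReal_integral_eq_lintegral_ofReal hint
    ((ae_restrict_iff' measurableSet_Icc).2 (Filter.Eventually.of_forall hw0)),
    ENNReal.toReal_ofReal (setIntegral_nonneg measurableSet_Icc hw0), integral_Icc_eq_integral_Ioc,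
    intervalIntegral.integral_of_le hx]

theorem area_image_swap (A : Set (ℝ × ℝ)) : area (Prod.swap ⁻¹' A) = area A := by
  rw [area, area, Measure.volume_eq_prod,
    Measure.measurePreserving_swap.measure_preimage_emb MeasurableEquiv.prodComm.measurableEmbedding]

theorem integral_affine (α β x₀ x₁ : ℝ) :
    ∫ x in x₀..x₁, (α * x + β) = α * (x₁ ^ 2 - x₀ ^ 2) / 2 + β * (x₁ - x₀) := by
  rw [intervalIntegral.integral_add ((by fun_prop : Continuous fun x : ℝ => α * x).intervalIntegrable
    _ _) (by simp), intervalIntegral.integral_const_mul, integral_id,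
    intervalIntegral.integral_const, smul_eq_mul]
  ring

theorem area_modelTriangle {l : ℝ} (hl : 0 ≤ l) : area (modelTriangle l) = l ^ 2 / 2 := by
  have hm : MeasurableSet (modelTriangle l) := by
    exact (measurableSet_le measurable_const measurable_fst).inter
      ((measurableSet_le measurable_const measurable_snd).inter
        (measurableSet_lt (measurable_fst.add measurable_snd) measurable_const))
  have hs : ∀ x, 0 ≤ x → Prod.mk x ⁻¹' modelTriangle l = Ico 0 (l - x) := by
    intro x hx; ext y; simp [modelTriangle, hx, lt_sub_iff_add_lt']
  rw [area_of_xSlices hm hl (w := fun x => (-1) * x + l) (by fun_prop), integral_affine]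
  · ring
  · intro x hx; linarith [hx.2]
  · intro x hx; rw [hs x hx.1, Real.volume_Ico]; congr 1; ring
  · intro x hx
    have : Prod.mk x ⁻¹' modelTriangle l = ∅ := by
      ext y
      simp only [modelTriangle, mem_preimage, mem_ofPred_eq, mem_empty_iff_false, iff_false]
      rintro ⟨h1, h2, h3⟩
      exact hx ⟨h1, by linarith⟩
    simp [this]

theorem area_cornerTriangle {e₁ e₂ : ℤ × ℤ} (he : det e₁ e₂ = 1) (p : ℝ × ℝ) {l : ℝ} (hl : 0 ≤ l) :
    area (cornerTriangle e₁ e₂ p l) = l ^ 2 / 2 := by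
  let L : (ℝ × ℝ) →ₗ[ℝ] (ℝ × ℝ) := Matrix.toLin (Module.Basis.finTwoProd ℝ)
    (Module.Basis.finTwoProd ℝ) !![(e₁.1 : ℝ), e₂.1; e₁.2, e₂.2]
  have hL : (fun q => slMap (slOfColumns e₁ e₂ he) q + p) = (fun q => q + p) ∘ L := by
    ext q <;> simp [L, slMap, slOfColumns, Matrix.toLin_finTwoProd_apply]
  have hdet : LinearMap.det L = 1 := by
    rw [LinearMap.det_toLin, Matrix.det_fin_two]
    have hd : (e₁.1 : ℝ) * e₂.2 - e₂.1 * e₁.2 = 1 := by exact_mod_cast he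
    simpa using hd
  rw [cornerTriangle_eq_image he, hL, image_comp, area, image_add_right, measure_preimage_add_right,
    Measure.addHaar_image_linearMap, hdet, ← area_modelTriangle hl]
  simp [area]

/-! ### Unfolding a triple along a choice of cut directions -/

variable {m : ℕ}

/-- The part of the shear `Transf.map` which depends on the cut directions. -/
def Triple.fold (R : Triple m) (f : Fin m → ℤˣ) (x : ℝ) : ℝ :=
  ∑ i, sign (R.ε i) * (1 - sign (f i)) / 2 * max (x - (R.c i).1) 0

/-- The map of the plane which changes the cut directions by `f`. -/
def Triple.unfold (R : Triple m) (f : Fin m → ℤˣ) : ℝ × ℝ → ℝ × ℝ := vShear (R.fold f)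

theorem Triple.continuous_fold (R : Triple m) (f : Fin m → ℤˣ) : Continuous (R.fold f) := by
  unfold Triple.fold; fun_prop

theorem Triple.continuous_unfold (R : Triple m) (f : Fin m → ℤˣ) : Continuous (R.unfold f) :=
  continuous_vShear (R.continuous_fold f)

theorem Triple.unfold_injective (R : Triple m) (f : Fin m → ℤˣ) :
    Function.Injective (R.unfold f) := vShear_injective _

theorem Transf.map_eq_vShear (g : Transf m) (R : Triple m) :
    g.map R = vShear fun x => g.k * x + R.fold g.flip x + g.s := by
  ext q <;> simp only [Transf.map, vShear, Triple.fold]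
  ring

theorem Transf.continuous_shear (g : Transf m) (R : Triple m) :
    Continuous fun x => g.k * x + R.fold g.flip x + g.s := by
  have := R.continuous_fold g.flip; fun_prop

theorem sign_mul (e e' : ℤˣ) : sign (e * e') = sign e * sign e' := by simp [sign]

/-- Reversals compose: kink by kink this is `ε' * ε * (1 - f) / 2 + ε * (1 - ε') / 2 = ε * (1 - f *
ε') / 2`. The kinks stay in place because vertical shears do not change the abscissae of the marked
points. -/
theorem Transf.fold_act (g : Transf m) (R : Triple m) (f : Fin m → ℤˣ) (x : ℝ) :
    (g.act R).fold f x + R.fold g.flip x = R.fold (f * g.flip) x := by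
  simp only [Triple.fold, ← Finset.sum_add_distrib]
  refine Finset.sum_congr rfl fun i _ => ?_
  simp only [Transf.act, Transf.map, Pi.mul_apply, sign_mul]
  ring

/-- This allows a triangle packed in any representative, by means of any further change, to be
described in the fixed `R` by one choice of reversed cuts; the affine part is a lattice automorphism
followed by a translation. -/
theorem Transf.map_map (g' g : Transf m) (R : Triple m) (q : ℝ × ℝ) :
    g'.map (g.act R) (g.map R q) =
      vShear (fun x => ((g'.k + g.k : ℤ) : ℝ) * x + R.fold (g'.flip * g.flip) x + (g.s + g'.s)) q := by
  simp only [Transf.map_eq_vShear, vShear, ← Transf.fold_act]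
  ext <;> simp only []
  push_cast; ring

/-- The affine part `k * x + s` acts on the lattice by `T ^ k` and a translation, so it is absorbed
into the basis; only the genuinely nonlinear part `φ` bends the triangle. -/
theorem mem_cornerTriangle_vShear (e₁ e₂ : ℤ × ℤ) (φ : ℝ → ℝ) (k : ℤ) (s : ℝ) (p q : ℝ × ℝ)
    (l : ℝ) :
    vShear (fun x => k * x + φ x + s) q ∈
        cornerTriangle e₁ e₂ (vShear (fun x => k * x + φ x + s) p) l ↔
      vShear φ q ∈ cornerTriangle (e₁.1, e₁.2 - k * e₁.1) (e₂.1, e₂.2 - k * e₂.1) (vShear φ p) l := by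
  have hA : coordA e₁ e₂
      (vShear (fun x => k * x + φ x + s) q - vShear (fun x => k * x + φ x + s) p) =
      coordA (e₁.1, e₁.2 - k * e₁.1) (e₂.1, e₂.2 - k * e₂.1) (vShear φ q - vShear φ p) := by
    simp [coordA, vShear]; ring
  have hB : coordB e₁ e₂
      (vShear (fun x => k * x + φ x + s) q - vShear (fun x => k * x + φ x + s) p) =
      coordB (e₁.1, e₁.2 - k * e₁.1) (e₂.1, e₂.2 - k * e₂.1) (vShear φ q - vShear φ p) := by
    simp [coordB, vShear]; ring
  simp only [cornerTriangle, mem_ofPred_eq, hA, hB]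

/-- `B` is an admissibly packed triangle of size `l` at the vertex `p` of `R`, as witnessed by the
change `f` of the cut directions. -/
structure Triple.IsCornerTriangle (R : Triple m) (f : Fin m → ℤˣ) (p : ℝ × ℝ) (B : Set (ℝ × ℝ))
    (l : ℝ) : Prop where
  pos : 0 < l
  mem : p ∈ R.Δ
  subset : B ⊆ R.Δ
  not_marked : ∀ i, R.c i ∉ B
  not_cut : ∀ i, p.1 = (R.c i).1 → sign (f i * R.ε i) * (p.2 - (R.c i).2) < 0
  -- Extremality of the unfolded apex in the unfolded polygon, tested on midpoints only. This form
  -- is unaffected by the affine part of a change of representative, and it is all that is used.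
  extreme : ∀ q₁ ∈ R.Δ, ∀ q₂ ∈ R.Δ,
    R.unfold f q₁ + R.unfold f q₂ = R.unfold f p + R.unfold f p → q₁ = q₂
  shape : ∃ e₁ e₂, det e₁ e₂ = 1 ∧
    (∀ q, q ∈ B ↔ R.unfold f q ∈ cornerTriangle e₁ e₂ (R.unfold f p) l) ∧
    ∀ᶠ q in 𝓝 p, (q ∈ B ↔ q ∈ R.Δ)

theorem Triple.IsCornerTriangle.apex_mem {R : Triple m} {f : Fin m → ℤˣ} {p : ℝ × ℝ}
    {B : Set (ℝ × ℝ)} {l : ℝ} (h : R.IsCornerTriangle f p B l) : p ∈ B := by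
  obtain ⟨e₁, e₂, -, hB, -⟩ := h.shape
  rw [hB]
  simp [cornerTriangle, coordA, coordB, h.pos]

theorem Triple.IsCornerTriangle.measurableSet {R : Triple m} {f : Fin m → ℤˣ} {p : ℝ × ℝ}
    {B : Set (ℝ × ℝ)} {l : ℝ} (h : R.IsCornerTriangle f p B l) : MeasurableSet B := by
  obtain ⟨e₁, e₂, -, hB, -⟩ := h.shape
  have : B = R.unfold f ⁻¹' cornerTriangle e₁ e₂ (R.unfold f p) l := by ext q; exact hB q
  rw [this]
  exact (R.continuous_unfold f).measurable (measurableSet_cornerTriangle ..)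

theorem Triple.IsCornerTriangle.area_eq {R : Triple m} {f : Fin m → ℤˣ} {p : ℝ × ℝ}
    {B : Set (ℝ × ℝ)} {l : ℝ} (h : R.IsCornerTriangle f p B l) : area B = l ^ 2 / 2 := by
  obtain ⟨e₁, e₂, he, hB, -⟩ := h.shape
  have : B = R.unfold f ⁻¹' cornerTriangle e₁ e₂ (R.unfold f p) l := by ext q; exact hB q
  rw [this, Triple.unfold, area_preimage_vShear (R.continuous_fold f),
    area_cornerTriangle he _ h.pos.le]

/-- The shape of a packed triangle is determined by the polygon near its apex. -/
theorem Triple.IsCornerTriangle.mem_iff {R : Triple m} {f : Fin m → ℤˣ} {p : ℝ × ℝ}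
    {B : Set (ℝ × ℝ)} {l : ℝ} (h : R.IsCornerTriangle f p B l) {e₁ e₂ : ℤ × ℤ}
    (he : det e₁ e₂ = 1)
    (hΔ : ∀ᶠ q in 𝓝 p, (q ∈ R.Δ ↔ R.unfold f q ∈ corner e₁ e₂ (R.unfold f p))) (q : ℝ × ℝ) :
    q ∈ B ↔ R.unfold f q ∈ cornerTriangle e₁ e₂ (R.unfold f p) l := by
  obtain ⟨e₁', e₂', he', hB, hev⟩ := h.shape
  have h1 := (R.continuous_unfold f).continuousAt.eventually
    (eventually_cornerTriangle_iff e₁' e₂' (R.unfold f p) h.pos)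
  have h2 : ∀ᶠ q in 𝓝 p, (R.unfold f q ∈ corner e₁' e₂' (R.unfold f p) ↔
      R.unfold f q ∈ corner e₁ e₂ (R.unfold f p)) := by
    filter_upwards [h1, hΔ, hev] with q h1 h2 h3
    rw [← h1, ← hB, h3, h2]
  have h3 : ∀ᶠ z in 𝓝 (R.unfold f p), (z ∈ corner e₁' e₂' (R.unfold f p) ↔
      z ∈ corner e₁ e₂ (R.unfold f p)) := by
    have := (vShearHomeo (R.continuous_fold f)).map_nhds_eq p
    change Filter.map (R.unfold f) (𝓝 p) = 𝓝 (R.unfold f p) at this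
    rw [← this]
    exact h2
  obtain ⟨rfl, rfl⟩ := basis_eq_of_corner he' he h3
  exact hB q

theorem IsRationalPolygon.convex {Δ : Set (ℝ × ℝ)} (h : IsRationalPolygon Δ) : Convex ℝ Δ := by
  obtain ⟨-, -, N, ν, β, rfl⟩ := h
  exact convex_halfPlanes ν β

/-- Away from its kink the function is affine, so small symmetric displacements average out. -/
theorem eventually_max_sub_add (x c v : ℝ) (h : x ≠ c) :
    ∀ᶠ t : ℝ in 𝓝 0, max (x + t * v - c) 0 + max (x - t * v - c) 0 = 2 * max (x - c) 0 := by
  have h1 : Continuous fun t : ℝ => x + t * v - c := by fun_prop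
  have h2 : Continuous fun t : ℝ => x - t * v - c := by fun_prop
  rcases h.lt_or_gt with h | h
  · filter_upwards [h1.continuousAt.eventually_lt_const (u := 0) (by simpa using h),
      h2.continuousAt.eventually_lt_const (u := 0) (by simpa using h)] with t h1 h2
    rw [max_eq_right h1.le, max_eq_right h2.le, max_eq_right (by linarith)]; simp
  · filter_upwards [h1.continuousAt.eventually_const_lt (u := 0) (by simpa using h),
      h2.continuousAt.eventually_const_lt (u := 0) (by simpa using h)] with t h1 h2
    rw [max_eq_left h1.le, max_eq_left h2.le, max_eq_left (by linarith)]; ring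

/-- The apex of a packed triangle is a vertex whatever the cut directions. -/
theorem Triple.IsCornerTriangle.isVertex {R : Triple m} (hR : R.IsRepresentative)
    {f : Fin m → ℤˣ} {p : ℝ × ℝ} {B : Set (ℝ × ℝ)} {l : ℝ} (h : R.IsCornerTriangle f p B l) :
    IsVertex R.Δ p := by
  -- If a reversed cut lies on the vertical line through `p`, then `p`, being off the reversed cut,
  -- is on the original one, and the defining conditions make it a vertex once it is known to be on
  -- the boundary. Otherwise unfolding is affine near `p`, and extremality carries over.
  by_cases hf : ∃ i, f i = -1 ∧ p.1 = (R.c i).1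
  · obtain ⟨i, hfi, hpi⟩ := hf
    have hcut : p ∈ R.cut i := by
      refine ⟨h.mem, hpi, ?_⟩
      have := h.not_cut i hpi
      rw [hfi, sign_mul] at this
      simp only [sign, Units.val_neg, Units.val_one, Int.cast_neg, Int.cast_one] at this ⊢
      linarith
    refine (hR.corner_of_mem_cut p ⟨subset_closure h.mem, fun hint => ?_⟩ ⟨i, hcut⟩).1
    -- Shears translate the vertical line through `p`, so an interior point would be the midpoint of
    -- a vertical segment both before and after unfolding.
    have hc1 : Continuous fun t : ℝ => p + (0, t) := by fun_prop
    have hc2 : Continuous fun t : ℝ => p - (0, t) := by fun_prop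
    have hn := isOpen_interior.mem_nhds hint
    have e1 := (hc1.tendsto' 0 p (by simp)).eventually_mem hn
    have e2 := (hc2.tendsto' 0 p (by simp)).eventually_mem hn
    obtain ⟨t, ht, h1, h2⟩ := ((eventually_mem_nhdsWithin (a := (0 : ℝ)) (s := Ioi 0)).and
      ((e1.and e2).filter_mono nhdsWithin_le_nhds)).exists
    have ht : 0 < t := ht
    have := h.extreme _ (interior_subset h1) _ (interior_subset h2) (by
      simp only [Triple.unfold, vShear]
      ext <;> simp
      ring)
    have := congrArg Prod.snd this
    simp at this
    linarith
  · push Not at hf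
    refine ⟨h.mem, fun q₁ hq₁ q₂ hq₂ hp => ?_⟩
    obtain ⟨x, y, hx, hy, hxy, hp⟩ := hp
    have hev : ∀ᶠ t : ℝ in 𝓝 0, ∀ i, f i = -1 → max (p.1 + t * (q₁ - q₂).1 - (R.c i).1) 0 +
        max (p.1 - t * (q₁ - q₂).1 - (R.c i).1) 0 = 2 * max (p.1 - (R.c i).1) 0 := by
      rw [Filter.eventually_all]
      intro i
      by_cases hfi : f i = -1
      · simpa [hfi] using eventually_max_sub_add p.1 (R.c i).1 (q₁ - q₂).1 (hf i hfi)
      · simp [hfi]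
    have hsmall : ∀ᶠ t : ℝ in 𝓝 0, t < min x y := Iio_mem_nhds (lt_min hx hy)
    obtain ⟨t, ht, h1, h2⟩ := ((eventually_mem_nhdsWithin (a := (0 : ℝ)) (s := Ioi 0)).and
      ((hev.and hsmall).filter_mono nhdsWithin_le_nhds)).exists
    have ht : 0 < t := ht
    obtain ⟨htx, hty⟩ := lt_min_iff.1 h2
    -- The segment is shrunk to one centred at `p`, short enough that none of the active kinks is
    -- met.
    have m1 : p + t • (q₁ - q₂) ∈ R.Δ := by
      have := hR.polygon.convex hq₁ hq₂ (a := x + t) (b := y - t) (by linarith) (by linarith)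
        (by linarith)
      convert this using 1
      rw [← hp]; module
    have m2 : p - t • (q₁ - q₂) ∈ R.Δ := by
      have := hR.polygon.convex hq₁ hq₂ (a := x - t) (b := y + t) (by linarith) (by linarith)
        (by linarith)
      convert this using 1
      rw [← hp]; module
    have hfold : R.fold f (p.1 + t * (q₁ - q₂).1) + R.fold f (p.1 - t * (q₁ - q₂).1) =
        2 * R.fold f p.1 := by
      simp only [Triple.fold, ← Finset.sum_add_distrib, Finset.mul_sum]
      refine Finset.sum_congr rfl fun i _ => ?_
      rcases Int.units_eq_one_or (f i) with hfi | hfi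
      · simp [hfi, sign]
      · rw [← mul_add, h1 i hfi]; ring
    have hq := h.extreme _ m1 _ m2 (by
      simp only [Triple.unfold, vShear]
      ext
      · simp
      · simp only [Prod.fst_add, Prod.snd_add, Prod.fst_sub, Prod.snd_sub, Prod.smul_fst,
          Prod.smul_snd, smul_eq_mul] at hfold ⊢
        linarith)
    have h0 : q₁ = q₂ := by
      have h4 : (2 * t) • (q₁ - q₂) = 0 := by
        have := sub_eq_zero.2 hq
        rw [← this]; module
      rcases smul_eq_zero.1 h4 with h5 | h5
      · linarith
      · exact sub_eq_zero.1 h5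
    subst h0
    rw [← hp, ← add_smul, hxy, one_smul]

/-- Packed triangles of any representative, seen in a fixed one. -/
theorem Triple.IsPackedTriangle.exists_isCornerTriangle {R : Triple m} {g : Transf m} {p : ℝ × ℝ}
    {B : Set (ℝ × ℝ)} (h : (g.act R).IsPackedTriangle p B) :
    ∃ f p₀ l, R.IsCornerTriangle f p₀ (g.map R ⁻¹' B) l := by
  obtain ⟨hv, hsub, g', hD, hmk, ⟨M, l, hl, hM⟩, hev⟩ := h
  obtain ⟨p₀, hp₀, rfl⟩ := hv.1
  have hinj : Function.Injective (g.map R) := by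
    rw [Transf.map_eq_vShear]; exact vShear_injective _
  have hinj' : Function.Injective (g'.map (g.act R)) := by
    rw [Transf.map_eq_vShear]; exact vShear_injective _
  obtain ⟨ψ, hψ⟩ : ∃ ψ : ℝ → ℝ, ψ = fun x => ((g'.k + g.k : ℤ) : ℝ) * x +
    R.fold (g'.flip * g.flip) x + (g.s + g'.s) := ⟨_, rfl⟩
  have hσ : ∀ q, g'.map (g.act R) (g.map R q) = vShear ψ q := fun q => by
    rw [hψ]; exact Transf.map_map g' g R q
  have hΔ : ∀ q, g.map R q ∈ (g.act R).Δ ↔ q ∈ R.Δ := fun q => hinj.mem_set_image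
  refine ⟨g'.flip * g.flip, p₀, l, hl, hp₀, fun q hq => (hΔ q).1 (hsub hq), fun i hi =>
    hmk i (mem_image_of_mem _ hi), fun i hi => ?_, fun q₁ hq₁ q₂ hq₂ hq => ?_, ?_⟩
  · by_contra hc
    refine hD.2.1 i ⟨mem_image_of_mem _ ((hΔ p₀).2 hp₀), ?_, ?_⟩
    · exact hi
    · change 0 ≤ sign (g'.flip i * (g.flip i * R.ε i)) * ((g'.map (g.act R) (g.map R p₀)).2 -
        (g'.map (g.act R) (g.map R (R.c i))).2)
      rw [hσ, hσ]
      simp only [vShear, hi, add_sub_add_right_eq_sub]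
      rw [← mul_assoc]
      simpa using hc
  · have h1 := hD.1.2 (mem_image_of_mem _ ((hΔ q₁).2 hq₁)) (mem_image_of_mem _ ((hΔ q₂).2 hq₂))
    have hf := congrArg Prod.fst hq
    have hs := congrArg Prod.snd hq
    simp only [Triple.unfold, vShear, Prod.fst_add, Prod.snd_add] at hf hs
    have hmid : g'.map (g.act R) (g.map R p₀) ∈ openSegment ℝ (g'.map (g.act R) (g.map R q₁))
        (g'.map (g.act R) (g.map R q₂)) := by
      refine ⟨1 / 2, 1 / 2, by norm_num, by norm_num, by norm_num, ?_⟩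
      rw [hσ, hσ, hσ, hψ]
      ext <;> simp [vShear]
      · linarith
      · have := congrArg (fun z => ((g'.k : ℝ) + g.k) * z) hf
        linarith
    have h2 := h1 hmid
    have h3 : q₁ = p₀ := hinj (hinj' h2)
    subst h3
    refine R.unfold_injective (g'.flip * g.flip) ?_
    have := add_left_cancel hq
    exact this.symm
  · have he := det_columns M
    obtain ⟨e₁, he₁⟩ : ∃ e : ℤ × ℤ, e = (M.1 0 0, M.1 1 0) := ⟨_, rfl⟩
    obtain ⟨e₂, he₂⟩ : ∃ e : ℤ × ℤ, e = (M.1 0 1, M.1 1 1) := ⟨_, rfl⟩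
    rw [slMap_image_modelTriangle] at hM
    rw [← he₁, ← he₂] at hM he
    -- The inverse of the total power of `T` is applied to the columns of `M`.
    refine ⟨(e₁.1, e₁.2 - (g'.k + g.k) * e₁.1), (e₂.1, e₂.2 - (g'.k + g.k) * e₂.1), ?_,
      fun q => ?_, ?_⟩
    · rw [← he]; simp only [det]; ring
    · rw [Triple.unfold, ← mem_cornerTriangle_vShear _ _ _ _ (g.s + g'.s), ← hψ, ← hσ, ← hσ, ← hM,
        hinj'.mem_set_image]
      rfl
    · have hc : Continuous fun q => g'.map (g.act R) (g.map R q) := by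
        simp only [Transf.map_eq_vShear]
        exact (continuous_vShear (g'.continuous_shear _)).comp
          (continuous_vShear (g.continuous_shear _))
      filter_upwards [hc.continuousAt.eventually hev] with q hq
      rwa [hinj'.mem_set_image, hinj'.mem_set_image, hΔ] at hq

/-! ### Packings seen in a fixed representative -/

/-- A family of pairwise disjoint packed triangles indexed by all points of the plane: `𝓑 v` is a
packed triangle of size `Λ v` at `v`, or there is none at `v`. -/
def Triple.IsCornerFamily (R : Triple m) (𝓑 : ℝ × ℝ → Set (ℝ × ℝ)) (Λ : ℝ × ℝ → ℝ) : Prop :=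
  (∀ v, (Λ v = 0 ∧ 𝓑 v = ∅) ∨ ∃ f, R.IsCornerTriangle f v (𝓑 v) (Λ v)) ∧
    ∀ v w, v ≠ w → Disjoint (𝓑 v) (𝓑 w)

theorem area_iUnion {d : ℕ} {B : Fin d → Set (ℝ × ℝ)} {l : Fin d → ℝ}
    (hB : ∀ i, MeasurableSet (B i)) (hd : ∀ i j, i ≠ j → Disjoint (B i) (B j))
    (hl : ∀ i, 0 < l i) (ha : ∀ i, area (B i) = l i ^ 2 / 2) :
    area (⋃ i, B i) = ∑ i, l i ^ 2 / 2 := by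
  rw [area, measure_iUnion (fun i j h => hd i j h) hB, tsum_fintype, ENNReal.toReal_sum]
  · exact Finset.sum_congr rfl fun i _ => ha i
  -- An infinite measure would have `toReal` equal to 0, whereas the area is positive.
  · intro i _ h
    have := ha i
    rw [area, h] at this
    have := hl i
    simp at *
    nlinarith

/-- Disjoint triangles contain their respective apices, so these are distinct and can serve as
indices. Points of the list at which there is no triangle contribute size 0. -/
theorem Triple.IsPacking.exists_isCornerFamily {R : Triple m} {g : Transf m} {P : Set (ℝ × ℝ)}
    (hP : (g.act R).IsPacking P) {k : ℕ} {w : Fin k → ℝ × ℝ} (hw : Function.Injective w)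
    (hR : ∀ f p B l, R.IsCornerTriangle f p B l → p ∈ range w) :
    ∃ 𝓑 Λ, R.IsCornerFamily 𝓑 Λ ∧ area P = ∑ j, Λ (w j) ^ 2 / 2 := by
  classical
  obtain ⟨d, p, B, hB, hdisj, rfl⟩ := hP
  choose f p₀ l h using fun i => (hB i).exists_isCornerTriangle
  have hdisj' : ∀ i j, i ≠ j → Disjoint (g.map R ⁻¹' B i) (g.map R ⁻¹' B j) := fun i j hij =>
    (hdisj i j hij).preimage _
  have hp₀ : Function.Injective p₀ := by
    intro i j hij
    by_contra hne
    exact disjoint_left.1 (hdisj' i j hne) (h i).apex_mem (hij ▸ (h j).apex_mem)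
  refine ⟨fun v => if hv : ∃ i, p₀ i = v then g.map R ⁻¹' B hv.choose else ∅,
    fun v => if hv : ∃ i, p₀ i = v then l hv.choose else 0, ⟨fun v => ?_, fun v w hvw => ?_⟩, ?_⟩
  · by_cases hv : ∃ i, p₀ i = v
    · right
      refine ⟨f hv.choose, ?_⟩
      have := h hv.choose
      rw [hv.choose_spec] at this
      simpa only [dif_pos hv] using this
    · left; simp only [dif_neg hv, and_self]
  · by_cases hv : ∃ i, p₀ i = v
    · by_cases hw : ∃ i, p₀ i = w
      · simp only [dif_pos hv, dif_pos hw]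
        refine hdisj' _ _ fun hc => hvw ?_
        rw [← hv.choose_spec, ← hw.choose_spec, hc]
      · simp only [dif_neg hw, disjoint_empty]
    · simp only [dif_neg hv, empty_disjoint]
  · have hval : ∀ i, (if hv : ∃ j, p₀ j = p₀ i then l hv.choose else 0) = l i := by
      intro i
      have hv : ∃ j, p₀ j = p₀ i := ⟨i, rfl⟩
      rw [dif_pos hv, hp₀ hv.choose_spec]
    have harea : area (⋃ i, B i) = ∑ i, l i ^ 2 / 2 := by
      rw [← area_preimage_vShear (g.continuous_shear R), ← Transf.map_eq_vShear, preimage_iUnion]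
      exact area_iUnion (fun i => (h i).measurableSet) hdisj' (fun i => (h i).pos)
        fun i => (h i).area_eq
    rw [harea]
    choose σ hσ using fun i => hR _ _ _ _ (h i)
    have hσi : Function.Injective σ := by
      intro i j hij; apply hp₀; rw [← hσ, ← hσ, hij]
    rw [← Finset.sum_subset (Finset.subset_univ (Finset.univ.image σ)), Finset.sum_image
      (fun i _ j _ hij => hσi hij)]
    · refine Finset.sum_congr rfl fun i _ => ?_
      rw [hσ]; exact congrArg (· ^ 2 / 2) (hval i).symm
    · intro j _ hj
      have : ¬ ∃ i, p₀ i = w j := by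
        rintro ⟨i, hi⟩
        refine hj (Finset.mem_image.2 ⟨i, Finset.mem_univ _, hw ?_⟩)
        rw [hσ, hi]
      simp [dif_neg this]

/-- The change of representative which does nothing. -/
def Transf.one : Transf m := ⟨0, 0, fun _ => 1⟩

theorem Transf.one_map (R : Triple m) (q : ℝ × ℝ) : Transf.one.map R q = q := by
  ext <;> simp [Transf.one, Transf.map, sign]

theorem Transf.one_act (R : Triple m) : Transf.one.act R = R := by
  have h : Transf.one.map R = id := funext (Transf.one_map R)
  ext1
  · simp [Transf.act, h]
  · simp [Transf.act, h]
  · simp [Transf.act, Transf.one]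

/-- The packing density is computed in a fixed representative. -/
theorem packingDensity_eq (R : Representative m) {k : ℕ} {w : Fin k → ℝ × ℝ}
    (hw : Function.Injective w)
    (hR : ∀ f p B l, R.IsCornerTriangle f p B l → p ∈ range w) {K : ℝ}
    (hle : ∀ 𝓑 Λ, R.IsCornerFamily 𝓑 Λ → ∑ j, Λ (w j) ^ 2 ≤ K)
    (hex : ∃ P, R.IsPacking P ∧ area P = K / 2) :
    packingDensity R.semitoricPolygon = K / 2 / area R.Δ := by
  refine IsGreatest.csSup_eq ⟨?_, ?_⟩
  · obtain ⟨P, hP, hK⟩ := hex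
    exact ⟨R.toTriple, ⟨Transf.one, (Transf.one_act _).symm⟩, P, hP, by rw [hK]⟩
  · rintro r ⟨R', ⟨g, rfl⟩, P, hP, rfl⟩
    obtain ⟨𝓑, Λ, hfam, hP⟩ := hP.exists_isCornerFamily hw hR
    have h1 : area (g.act R.toTriple).Δ = area R.Δ := by
      change area (g.map R.toTriple '' R.Δ) = _
      rw [Transf.map_eq_vShear, area_image_vShear (g.continuous_shear _)]
    rw [h1, hP, ← Finset.sum_div]
    have := hle 𝓑 Λ hfam
    exact div_le_div_of_nonneg_right (by linarith) ENNReal.toReal_nonneg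

/-! ### Constructing packings -/

theorem Triple.unfold_eq_map (R : Triple m) (f : Fin m → ℤˣ) :
    (⟨0, 0, f⟩ : Transf m).map R = R.unfold f := by
  rw [Transf.map_eq_vShear, Triple.unfold]; simp

theorem Triple.isPackedTriangle_of {R : Triple m} (f : Fin m → ℤˣ) {p : ℝ × ℝ} {e₁ e₂ : ℤ × ℤ}
    {l : ℝ} (hv : IsVertex R.Δ p)
    (hD : ((⟨0, 0, f⟩ : Transf m).act R).IsDelzantCorner (R.unfold f p)) (he : det e₁ e₂ = 1)
    (hl : 0 < l) (hsub : R.unfold f ⁻¹' cornerTriangle e₁ e₂ (R.unfold f p) l ⊆ R.Δ)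
    (hmk : ∀ i, R.unfold f (R.c i) ∉ cornerTriangle e₁ e₂ (R.unfold f p) l)
    (hΔ : ∀ᶠ q in 𝓝 p, (q ∈ R.Δ ↔ R.unfold f q ∈ corner e₁ e₂ (R.unfold f p))) :
    R.IsPackedTriangle p (R.unfold f ⁻¹' cornerTriangle e₁ e₂ (R.unfold f p) l) := by
  refine ⟨hv, hsub, ⟨0, 0, f⟩, ?_⟩
  have hsurj : Function.Surjective (R.unfold f) := vShear_surjective _
  rw [R.unfold_eq_map f, image_preimage_eq _ hsurj]
  refine ⟨hD, hmk, ⟨slOfColumns e₁ e₂ he, l, hl, cornerTriangle_eq_image he _ _⟩, ?_⟩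
  have := (vShearHomeo (R.continuous_fold f)).map_nhds_eq p
  change Filter.map (R.unfold f) (𝓝 p) = 𝓝 (R.unfold f p) at this
  rw [← this, Filter.eventually_map]
  filter_upwards [hΔ, (R.continuous_unfold f).continuousAt.eventually
    (eventually_cornerTriangle_iff e₁ e₂ (R.unfold f p) hl)] with q h1 h2
  rw [h2, (R.unfold_injective f).mem_set_image, h1]

/-- A packing by triangles of prescribed sizes. -/
theorem Triple.exists_isPacking {R : Triple m} {d : ℕ} {p : Fin d → ℝ × ℝ}
    {B : Fin d → Set (ℝ × ℝ)} {l : Fin d → ℝ} {K : ℝ} (hB : ∀ i, R.IsPackedTriangle (p i) (B i))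
    (hd : ∀ i j, i < j → Disjoint (B i) (B j)) (hm : ∀ i, MeasurableSet (B i)) (hl : ∀ i, 0 < l i)
    (ha : ∀ i, area (B i) = l i ^ 2 / 2) (hK : ∑ i, l i ^ 2 = K) :
    ∃ P, R.IsPacking P ∧ area P = K / 2 := by
  have hd' : ∀ i j, i ≠ j → Disjoint (B i) (B j) := fun i j hij => by
    rcases hij.lt_or_gt with h | h
    · exact hd i j h
    · exact (hd j i h).symm
  refine ⟨_, ⟨d, p, B, hB, hd', rfl⟩, ?_⟩
  rw [area_iUnion hm hd' hl ha, ← Finset.sum_div, hK]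

/-! ### Two triangles at the ends of an edge -/

/-- Disjoint triangles which cover initial segments of an edge from both ends do not overlap on
it. -/
theorem add_le_of_disjoint_edge {B₁ B₂ : Set (ℝ × ℝ)} (hd : Disjoint B₁ B₂) {l₁ l₂ L : ℝ}
    (h₁ : l₁ ≤ L) (h₂ : l₂ ≤ L) (γ : ℝ → ℝ × ℝ) (hγ₁ : ∀ t, 0 ≤ t → t < l₁ → γ t ∈ B₁)
    (hγ₂ : ∀ t, 0 ≤ t → t < l₂ → γ (L - t) ∈ B₂) : l₁ + l₂ ≤ L := by
  by_contra! hc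
  -- The midpoint of the overlap between `L - l₂` and `l₁`.
  refine disjoint_left.1 hd (hγ₁ ((L + l₁ - l₂) / 2) (by linarith) (by linarith)) ?_
  have := hγ₂ ((L + l₂ - l₁) / 2) (by linarith) (by linarith)
  convert this using 2
  ring

/-! ### Triples all of whose cuts go upwards -/

/-- The shear by which the triangles at vertices to the left of all marked points are bent. -/
def Triple.bendLeft (R : Triple m) (f : Fin m → ℤˣ) (x : ℝ) : ℝ :=
  ∑ i, if f i = -1 then max (x - (R.c i).1) 0 else 0

/-- The shear by which the triangles at vertices to the right of all marked points are bent. -/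
def Triple.bendRight (R : Triple m) (f : Fin m → ℤˣ) (x : ℝ) : ℝ :=
  ∑ i, if f i = -1 then max ((R.c i).1 - x) 0 else 0

theorem Triple.fold_eq_bendLeft {R : Triple m} (hε : ∀ i, R.ε i = 1) (f : Fin m → ℤˣ) (x : ℝ) :
    R.fold f x = R.bendLeft f x := by
  refine Finset.sum_congr rfl fun i _ => ?_
  rcases Int.units_eq_one_or (f i) with h | h <;> simp [h, hε, sign]

/-- Since `max (x - c) 0 = (x - c) + max (c - x) 0`, reversing a cut may equally be seen as fixing
the right side and bending the left one, up to a lattice shear. Here `k` is the number of reversed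
cuts. -/
theorem Triple.fold_eq_bendRight {R : Triple m} (hε : ∀ i, R.ε i = 1) (f : Fin m → ℤˣ) :
    ∃ (k : ℤ) (s : ℝ), ∀ x, R.fold f x = k * x + R.bendRight f x + s := by
  refine ⟨∑ i, if f i = -1 then 1 else 0, -∑ i, if f i = -1 then (R.c i).1 else 0, fun x => ?_⟩
  rw [R.fold_eq_bendLeft hε, ← sub_eq_add_neg, eq_sub_iff_add_eq, Triple.bendLeft,
    Triple.bendRight]
  push_cast
  rw [Finset.sum_mul, ← Finset.sum_add_distrib, ← Finset.sum_add_distrib]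
  refine Finset.sum_congr rfl fun i _ => ?_
  split_ifs
  · rcases le_total x (R.c i).1 with h | h
    · rw [max_eq_right (by linarith), max_eq_left (by linarith)]; ring
    · rw [max_eq_left (by linarith), max_eq_right (by linarith)]; ring
  · simp

theorem Triple.bendLeft_eq_zero {R : Triple m} (f : Fin m → ℤˣ) {x : ℝ}
    (hx : ∀ i, x ≤ (R.c i).1) : R.bendLeft f x = 0 :=
  Finset.sum_eq_zero fun i _ => by
    rw [max_eq_right (by linarith [hx i])]; simp

theorem Triple.bendRight_eq_zero {R : Triple m} (f : Fin m → ℤˣ) {x : ℝ}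
    (hx : ∀ i, (R.c i).1 ≤ x) : R.bendRight f x = 0 :=
  Finset.sum_eq_zero fun i _ => by
    rw [max_eq_right (by linarith [hx i])]; simp

theorem mem_corner_vShear (e₁ e₂ : ℤ × ℤ) (φ : ℝ → ℝ) (k : ℤ) (s : ℝ) (p q : ℝ × ℝ) :
    vShear (fun x => k * x + φ x + s) q ∈ corner e₁ e₂ (vShear (fun x => k * x + φ x + s) p) ↔
      vShear φ q ∈ corner (e₁.1, e₁.2 - k * e₁.1) (e₂.1, e₂.2 - k * e₂.1) (vShear φ p) := by
  have hA : coordA e₁ e₂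
      (vShear (fun x => k * x + φ x + s) q - vShear (fun x => k * x + φ x + s) p) =
      coordA (e₁.1, e₁.2 - k * e₁.1) (e₂.1, e₂.2 - k * e₂.1) (vShear φ q - vShear φ p) := by
    simp [coordA, vShear]; ring
  have hB : coordB e₁ e₂
      (vShear (fun x => k * x + φ x + s) q - vShear (fun x => k * x + φ x + s) p) =
      coordB (e₁.1, e₁.2 - k * e₁.1) (e₂.1, e₂.2 - k * e₂.1) (vShear φ q - vShear φ p) := by
    simp [coordB, vShear]; ring
  simp only [corner, mem_ofPred_eq, hA, hB]

/-- If the change of representative is, up to a shear of the lattice, the identity near `p`, then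
the packed triangles at `p` are bent standard triangles. -/
theorem Triple.IsCornerTriangle.mem_iff_of_bend {R : Triple m} {f : Fin m → ℤˣ} {p : ℝ × ℝ}
    {B : Set (ℝ × ℝ)} {l : ℝ} (H : R.IsCornerTriangle f p B l) {e₁ e₂ : ℤ × ℤ}
    (he : det e₁ e₂ = 1) (hΔ : ∀ᶠ q in 𝓝 p, (q ∈ R.Δ ↔ q ∈ corner e₁ e₂ p)) {φ : ℝ → ℝ} {k : ℤ}
    {s : ℝ} (hφ : ∀ x, R.fold f x = k * x + φ x + s) (hφ0 : ∀ᶠ x in 𝓝 p.1, φ x = 0)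
    (q : ℝ × ℝ) : q ∈ B ↔ (q.1, q.2 + φ q.1) ∈ cornerTriangle e₁ e₂ p l := by
  have hu : R.unfold f = vShear fun x => k * x + φ x + s := by
    rw [Triple.unfold, ← funext hφ]
  have hp : vShear φ p = p := by simp [vShear, hφ0.self_of_nhds]
  have he' : ∀ e : ℤ × ℤ, ((e.1, e.2 + k * e.1).1, (e.1, e.2 + k * e.1).2 -
      k * (e.1, e.2 + k * e.1).1) = e := fun e => by simp
  -- The unfolded polygon has at the apex the cone spanned by the images of `e₁` and `e₂` under `T ^
  -- k`.
  rw [H.mem_iff (e₁ := (e₁.1, e₁.2 + k * e₁.1)) (e₂ := (e₂.1, e₂.2 + k * e₂.1)) (by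
    rw [← he]; simp only [det]; ring) ?_ q, hu, mem_cornerTriangle_vShear, he', he', hp]
  · rfl
  · filter_upwards [hΔ, continuous_fst.continuousAt.eventually hφ0] with q h1 h2
    rw [hu, mem_corner_vShear, he', he', hp, h1]
    simp [vShear, h2]

theorem Triple.IsCornerTriangle.mem_iff_left {R : Triple m} (hε : ∀ i, R.ε i = 1)
    {f : Fin m → ℤˣ} {p : ℝ × ℝ} {B : Set (ℝ × ℝ)} {l : ℝ} (H : R.IsCornerTriangle f p B l)
    (hp : ∀ i, p.1 < (R.c i).1) {e₁ e₂ : ℤ × ℤ} (he : det e₁ e₂ = 1)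
    (hΔ : ∀ᶠ q in 𝓝 p, (q ∈ R.Δ ↔ q ∈ corner e₁ e₂ p)) (q : ℝ × ℝ) :
    q ∈ B ↔ (q.1, q.2 + R.bendLeft f q.1) ∈ cornerTriangle e₁ e₂ p l := by
  refine H.mem_iff_of_bend he hΔ (k := 0) (s := 0) (fun x => by
    simp [R.fold_eq_bendLeft hε]) ?_ q
  have : ∀ᶠ x in 𝓝 p.1, ∀ i, x < (R.c i).1 := Filter.eventually_all.2 fun i => Iio_mem_nhds (hp i)
  filter_upwards [this] with x hx
  exact Triple.bendLeft_eq_zero f fun i => (hx i).le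

theorem Triple.IsCornerTriangle.mem_iff_right {R : Triple m} (hε : ∀ i, R.ε i = 1)
    {f : Fin m → ℤˣ} {p : ℝ × ℝ} {B : Set (ℝ × ℝ)} {l : ℝ} (H : R.IsCornerTriangle f p B l)
    (hp : ∀ i, (R.c i).1 < p.1) {e₁ e₂ : ℤ × ℤ} (he : det e₁ e₂ = 1)
    (hΔ : ∀ᶠ q in 𝓝 p, (q ∈ R.Δ ↔ q ∈ corner e₁ e₂ p)) (q : ℝ × ℝ) :
    q ∈ B ↔ (q.1, q.2 + R.bendRight f q.1) ∈ cornerTriangle e₁ e₂ p l := by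
  obtain ⟨k, s, h⟩ := R.fold_eq_bendRight hε f
  refine H.mem_iff_of_bend he hΔ h ?_ q
  have : ∀ᶠ x in 𝓝 p.1, ∀ i, (R.c i).1 < x := Filter.eventually_all.2 fun i => Ioi_mem_nhds (hp i)
  filter_upwards [this] with x hx
  exact Triple.bendRight_eq_zero f fun i => (hx i).le

/-! ### Delzant corners from local cones -/

/-- From a point where one coordinate vanishes, an arbitrarily small step against the corresponding
basis vector leaves the cone. -/
theorem mem_frontier_of_eventually_corner {Δ : Set (ℝ × ℝ)} {e₁ e₂ : ℤ × ℤ}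
    (he : det e₁ e₂ = 1) {p q : ℝ × ℝ} (hΔ : ∀ᶠ z in 𝓝 q, (z ∈ Δ ↔ z ∈ corner e₁ e₂ p))
    (hq : q ∈ corner e₁ e₂ p) (h0 : coordA e₁ e₂ (q - p) = 0 ∨ coordB e₁ e₂ (q - p) = 0) :
    q ∈ frontier Δ := by
  have hd : (e₁.1 : ℝ) * e₂.2 - e₂.1 * e₁.2 = 1 := by exact_mod_cast he
  refine ⟨subset_closure (hΔ.self_of_nhds.2 hq), fun hint => ?_⟩
  have hev : ∀ᶠ z in 𝓝 q, z ∈ corner e₁ e₂ p := by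
    filter_upwards [hΔ, isOpen_interior.mem_nhds hint] with z h1 h2
    exact h1.1 (interior_subset h2)
  have key : ∀ v : ℝ × ℝ, ∃ t : ℝ, 0 < t ∧ q - t • v ∈ corner e₁ e₂ p := by
    intro v
    have hc : Continuous fun t : ℝ => q - t • v := by fun_prop
    obtain ⟨t, ht, h⟩ := ((eventually_mem_nhdsWithin (a := (0 : ℝ)) (s := Ioi 0)).and
      (((hc.tendsto' 0 q (by simp)).eventually hev).filter_mono nhdsWithin_le_nhds)).exists
    exact ⟨t, ht, h⟩
  rcases h0 with h0 | h0
  · obtain ⟨t, ht, h⟩ := key (toPlane e₁)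
    have h1 : coordA e₁ e₂ (q - t • toPlane e₁ - p) = coordA e₁ e₂ (q - p) - t := by
      simp [coordA, toPlane]; linear_combination (-t) * hd
    have := h.1
    linarith
  · obtain ⟨t, ht, h⟩ := key (toPlane e₂)
    have h1 : coordB e₁ e₂ (q - t • toPlane e₂ - p) = coordB e₁ e₂ (q - p) - t := by
      simp [coordB, toPlane]; linear_combination (-t) * hd
    have := h.2
    linarith

theorem isEdgeVector_of_eventually_corner {Δ : Set (ℝ × ℝ)} {e₁ e₂ : ℤ × ℤ}
    (he : det e₁ e₂ = 1) {p : ℝ × ℝ} (hΔ : ∀ᶠ z in 𝓝 p, (z ∈ Δ ↔ z ∈ corner e₁ e₂ p)) {e : ℤ × ℤ}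
    (hcop : IsCoprime e.1 e.2) (he0 : 0 ≤ coordA e₁ e₂ (toPlane e))
    (he1 : 0 ≤ coordB e₁ e₂ (toPlane e))
    (h0 : coordA e₁ e₂ (toPlane e) = 0 ∨ coordB e₁ e₂ (toPlane e) = 0) : IsEdgeVector Δ p e := by
  refine ⟨hcop, ?_⟩
  have hc : Continuous fun t : ℝ => p + t • toPlane e := by fun_prop
  have hev := (hc.tendsto' 0 p (by simp)).eventually hΔ.eventually_nhds
  obtain ⟨r, hr, hball⟩ := Metric.eventually_nhds_iff.1 hev
  refine ⟨r / 2, by linarith, ?_⟩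
  rintro q ⟨x, y, hx, hy, hxy, rfl⟩
  obtain rfl : x = 1 - y := by linarith
  have hq : (1 - y) • p + y • (p + (r / 2) • toPlane e) = p + (y * (r / 2)) • toPlane e := by
    module
  have hA : ∀ t : ℝ, coordA e₁ e₂ (p + t • toPlane e - p) = t * coordA e₁ e₂ (toPlane e) := by
    intro t; simp [coordA]; ring
  have hB : ∀ t : ℝ, coordB e₁ e₂ (p + t • toPlane e - p) = t * coordB e₁ e₂ (toPlane e) := by
    intro t; simp [coordB]; ring
  have ht : 0 ≤ y * (r / 2) := by positivity
  have htr : y * (r / 2) ≤ r / 2 := mul_le_of_le_one_left (by linarith) (by linarith)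
  rw [hq]
  refine mem_frontier_of_eventually_corner he (p := p) (hball ?_) ?_ ?_
  · rw [Real.dist_eq, sub_zero, abs_of_nonneg ht]; linarith
  · refine ⟨?_, ?_⟩
    · rw [hA]; positivity
    · rw [hB]; positivity
  · rw [hA, hB]
    rcases h0 with h0 | h0 <;> simp [h0]

theorem delzantCondition_of_eventually_corner {Δ : Set (ℝ × ℝ)} {e₁ e₂ : ℤ × ℤ}
    (he : det e₁ e₂ = 1) {p : ℝ × ℝ} (hΔ : ∀ᶠ z in 𝓝 p, (z ∈ Δ ↔ z ∈ corner e₁ e₂ p)) :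
    DelzantCondition Δ p := by
  have hd : e₁.1 * e₂.2 - e₂.1 * e₁.2 = 1 := he
  have hd' : (e₁.1 : ℝ) * e₂.2 - e₂.1 * e₁.2 = 1 := by exact_mod_cast he
  have hA₁ : coordA e₁ e₂ (toPlane e₁) = 1 := by simp only [coordA, toPlane]; linarith
  have hB₁ : coordB e₁ e₂ (toPlane e₁) = 0 := by simp only [coordB, toPlane]; linarith
  have hA₂ : coordA e₁ e₂ (toPlane e₂) = 0 := by simp only [coordA, toPlane]; linarith
  have hB₂ : coordB e₁ e₂ (toPlane e₂) = 1 := by simp only [coordB, toPlane]; linarith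
  refine ⟨e₁, e₂, ?_, ?_, he⟩
  · exact isEdgeVector_of_eventually_corner he hΔ ⟨e₂.2, -e₂.1, by linarith⟩ (by simp [hA₁])
      hB₁.ge (Or.inr hB₁)
  · exact isEdgeVector_of_eventually_corner he hΔ ⟨-e₁.2, e₁.1, by linarith⟩ hA₂.ge (by simp [hB₂])
      (Or.inl hA₂)

/-- Both coordinates relative to `p` are nonnegative on the polygon; if a convex combination with
positive weights makes them vanish, they vanish at both ends. -/
theorem isVertex_of_subset_corner {Δ : Set (ℝ × ℝ)} {e₁ e₂ : ℤ × ℤ} (he : det e₁ e₂ = 1)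
    {p : ℝ × ℝ} (hp : p ∈ Δ) (hΔ : Δ ⊆ corner e₁ e₂ p) : IsVertex Δ p := by
  refine ⟨hp, fun q₁ hq₁ q₂ hq₂ h => ?_⟩
  obtain ⟨x, y, hx, hy, hxy, h⟩ := h
  obtain ⟨a1, b1⟩ := hΔ hq₁
  obtain ⟨a2, b2⟩ := hΔ hq₂
  obtain rfl : y = 1 - x := by linarith
  have hA : x * coordA e₁ e₂ (q₁ - p) + (1 - x) * coordA e₁ e₂ (q₂ - p) = 0 := by
    rw [← h]; simp [coordA]; ring
  have hB : x * coordB e₁ e₂ (q₁ - p) + (1 - x) * coordB e₁ e₂ (q₂ - p) = 0 := by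
    rw [← h]; simp [coordB]; ring
  have hA0 : coordA e₁ e₂ (q₁ - p) = 0 :=
    (mul_eq_zero.1 (by nlinarith [mul_nonneg hx.le a1, mul_nonneg hy.le a2] :
      x * coordA e₁ e₂ (q₁ - p) = 0)).resolve_left hx.ne'
  have hB0 : coordB e₁ e₂ (q₁ - p) = 0 :=
    (mul_eq_zero.1 (by nlinarith [mul_nonneg hx.le b1, mul_nonneg hy.le b2] :
      x * coordB e₁ e₂ (q₁ - p) = 0)).resolve_left hx.ne'
  have := coord_injective he hA0 hB0
  exact sub_eq_zero.1 (this.trans (by simp))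

/-- Bent standard triangles at vertices off the cuts are admissibly packed. -/
theorem Triple.isPackedTriangle_of_bend {R : Triple m} (f : Fin m → ℤˣ) {p : ℝ × ℝ}
    {e₁ e₂ : ℤ × ℤ} {l : ℝ} {φ : ℝ → ℝ} {k : ℤ} {s : ℝ} (hφ : ∀ x, R.fold f x = k * x + φ x + s)
    (hφ0 : ∀ᶠ x in 𝓝 p.1, φ x = 0) (he : det e₁ e₂ = 1) (hl : 0 < l)
    (hcut : ∀ i, p.1 ≠ (R.c i).1) (hloc : ∀ᶠ q in 𝓝 p, (q ∈ R.Δ ↔ q ∈ corner e₁ e₂ p))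
    (hΔ : ∀ q ∈ R.Δ, q ∈ corner e₁ e₂ p)
    (hΔ' : ∀ q ∈ R.Δ, (q.1, q.2 + φ q.1) ∈ corner e₁ e₂ p)
    (hB : ∀ q : ℝ × ℝ, (q.1, q.2 + φ q.1) ∈ cornerTriangle e₁ e₂ p l → q ∈ R.Δ)
    (hmk : ∀ i, ((R.c i).1, (R.c i).2 + φ (R.c i).1) ∉ cornerTriangle e₁ e₂ p l) :
    R.IsPackedTriangle p (vShear φ ⁻¹' cornerTriangle e₁ e₂ p l) := by
  have hu : R.unfold f = vShear fun x => k * x + φ x + s := by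
    rw [Triple.unfold, ← funext hφ]
  have hp : vShear φ p = p := by simp [vShear, hφ0.self_of_nhds]
  have hpΔ : p ∈ R.Δ := hloc.self_of_nhds.2 (by simp [corner, coordA, coordB])
  have he' : ∀ e : ℤ × ℤ, ((e.1, e.2 + k * e.1).1, (e.1, e.2 + k * e.1).2 -
      k * (e.1, e.2 + k * e.1).1) = e := fun e => by simp
  have hdet : det (e₁.1, e₁.2 + k * e₁.1) (e₂.1, e₂.2 + k * e₂.1) = 1 := by
    rw [← he]; simp only [det]; ring
  have hmem : ∀ q, R.unfold f q ∈ cornerTriangle (e₁.1, e₁.2 + k * e₁.1) (e₂.1, e₂.2 + k * e₂.1)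
      (R.unfold f p) l ↔ vShear φ q ∈ cornerTriangle e₁ e₂ p l := fun q => by
    rw [hu, mem_cornerTriangle_vShear, he', he', hp]
  have hcor : ∀ q, R.unfold f q ∈ corner (e₁.1, e₁.2 + k * e₁.1) (e₂.1, e₂.2 + k * e₂.1)
      (R.unfold f p) ↔ vShear φ q ∈ corner e₁ e₂ p := fun q => by
    rw [hu, mem_corner_vShear, he', he', hp]
  have hloc' : ∀ᶠ q in 𝓝 p, (q ∈ R.Δ ↔ R.unfold f q ∈ corner (e₁.1, e₁.2 + k * e₁.1)
      (e₂.1, e₂.2 + k * e₂.1) (R.unfold f p)) := by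
    filter_upwards [hloc, continuous_fst.continuousAt.eventually hφ0] with q h1 h2
    rw [hcor, h1]
    simp [vShear, h2]
  have hset : vShear φ ⁻¹' cornerTriangle e₁ e₂ p l = R.unfold f ⁻¹' cornerTriangle
      (e₁.1, e₁.2 + k * e₁.1) (e₂.1, e₂.2 + k * e₂.1) (R.unfold f p) l := by
    ext q; exact (hmem q).symm
  rw [hset]
  refine Triple.isPackedTriangle_of f (isVertex_of_subset_corner he hpΔ hΔ) ?_ hdet hl
    (fun q hq => hB q ((hmem q).1 hq)) (fun i hi => hmk i ((hmem _).1 hi)) hloc'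
  have hact : ((⟨0, 0, f⟩ : Transf m).act R).Δ = R.unfold f '' R.Δ := by
    rw [← R.unfold_eq_map]; rfl
  refine ⟨?_, fun i hi => hcut i hi.2.1, ?_⟩
  · rw [hact]
    refine isVertex_of_subset_corner hdet (mem_image_of_mem _ hpΔ) ?_
    rintro _ ⟨q, hq, rfl⟩
    exact (hcor q).2 (hΔ' q hq)
  · rw [hact]
    refine delzantCondition_of_eventually_corner hdet ?_
    have := (vShearHomeo (R.continuous_fold f)).map_nhds_eq p
    change Filter.map (R.unfold f) (𝓝 p) = 𝓝 (R.unfold f p) at this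
    rw [← this, Filter.eventually_map]
    filter_upwards [hloc'] with q h1
    rw [(R.unfold_injective f).mem_set_image, h1]

theorem measurableSet_vShear_preimage {φ : ℝ → ℝ} (hφ : Continuous φ) (e₁ e₂ : ℤ × ℤ) (p : ℝ × ℝ)
    (l : ℝ) : MeasurableSet (vShear φ ⁻¹' cornerTriangle e₁ e₂ p l) :=
  (continuous_vShear hφ).measurable (measurableSet_cornerTriangle ..)

theorem area_vShear_preimage {φ : ℝ → ℝ} (hφ : Continuous φ) {e₁ e₂ : ℤ × ℤ}
    (he : det e₁ e₂ = 1) (p : ℝ × ℝ) {l : ℝ} (hl : 0 < l) :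
    area (vShear φ ⁻¹' cornerTriangle e₁ e₂ p l) = l ^ 2 / 2 := by
  rw [area_preimage_vShear hφ, area_cornerTriangle he _ hl.le]

/-- Unbent standard triangles at vertices off the cuts are admissibly packed. -/
theorem Triple.isPackedTriangle_of_one {R : Triple m} {p : ℝ × ℝ} {e₁ e₂ : ℤ × ℤ} {l : ℝ}
    (he : det e₁ e₂ = 1) (hl : 0 < l) (hcut : ∀ i, p.1 ≠ (R.c i).1)
    (hloc : ∀ᶠ q in 𝓝 p, (q ∈ R.Δ ↔ q ∈ corner e₁ e₂ p))
    (hΔ : ∀ q ∈ R.Δ, q ∈ corner e₁ e₂ p) (hB : ∀ q ∈ cornerTriangle e₁ e₂ p l, q ∈ R.Δ)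
    (hmk : ∀ i, R.c i ∉ cornerTriangle e₁ e₂ p l) :
    R.IsPackedTriangle p (cornerTriangle e₁ e₂ p l) := by
  have h0 : vShear (fun _ => (0 : ℝ)) = id := by ext q <;> simp [vShear]
  have := Triple.isPackedTriangle_of_bend (R := R) 1 (φ := fun _ => 0) (k := 0) (s := 0)
    (fun x => by simp [Triple.fold, sign]) (by simp) he hl hcut hloc hΔ (by simpa using hΔ)
    (by simpa using hB) (by simpa using hmk)
  simpa [h0] using this

/-! ### Areas of the minimal polygons -/

/-- The horizontal slices are intervals of length `L - (α + β) * y`; the coordinates are swapped in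
order to integrate over them. -/
theorem area_trapezoid {A : Set (ℝ × ℝ)} {c α β L : ℝ} (hc : 0 ≤ c) (hL : (α + β) * c ≤ L)
    (hL0 : 0 ≤ L)
    (hA : ∀ x y, (x, y) ∈ A ↔ 0 ≤ y ∧ y ≤ c ∧ α * y ≤ x ∧ x ≤ L - β * y) :
    area A = c * L - (α + β) * c ^ 2 / 2 := by
  have hA' : A = {q : ℝ × ℝ | 0 ≤ q.2 ∧ q.2 ≤ c ∧ α * q.2 ≤ q.1 ∧ q.1 ≤ L - β * q.2} := by
    ext q; exact hA q.1 q.2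
  have hm : MeasurableSet (Prod.swap ⁻¹' A) := by
    rw [hA']
    refine measurable_swap (IsClosed.measurableSet ?_)
    exact (isClosed_le continuous_const continuous_snd).inter
      ((isClosed_le continuous_snd continuous_const).inter
        ((isClosed_le (continuous_const.mul continuous_snd) continuous_fst).inter
          (isClosed_le continuous_fst (continuous_const.sub (continuous_const.mul continuous_snd)))))
  have hs : ∀ y ∈ Icc 0 c, Prod.mk y ⁻¹' (Prod.swap ⁻¹' A) = Icc (α * y) (L - β * y) := by
    intro y hy; ext x
    simp only [mem_preimage, Prod.swap_prod_mk, hA, mem_Icc]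
    exact ⟨fun h => h.2.2, fun h => ⟨hy.1, hy.2, h⟩⟩
  rw [← area_image_swap, area_of_xSlices hm hc (w := fun y => (-(α + β)) * y + L) (by fun_prop),
    integral_affine]
  · ring
  · intro y hy
    rcases le_or_gt 0 (α + β) with h | h
    · nlinarith [mul_le_mul_of_nonneg_left hy.2 h]
    · nlinarith [mul_nonneg (neg_nonneg.2 h.le) hy.1]
  · intro y hy
    rw [hs y hy, Real.volume_Icc]; congr 1; ring
  · intro y hy
    have : Prod.mk y ⁻¹' (Prod.swap ⁻¹' A) = ∅ := by
      ext x
      simp only [mem_preimage, Prod.swap_prod_mk, hA, mem_empty_iff_false, iff_false]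
      exact fun h => hy ⟨h.1, h.2.1⟩
    simp [this]

/-! ### Type (1) -/

theorem mem_tripleOne {a : ℝ} (ha : 0 < a) (h x y : ℝ) :
    (x, y) ∈ (tripleOne a h).Δ ↔ 0 ≤ y ∧ 2 * y ≤ x ∧ x + 2 * y ≤ 2 * a := by
  simp only [tripleOne, hullOne ha, halfPlanes, mem_ofPred_eq, Fin.forall_fin_succ]
  simp

theorem area_tripleOne {a : ℝ} (ha : 0 < a) (h : ℝ) : area (tripleOne a h).Δ = a ^ 2 / 2 := by
  rw [area_trapezoid (c := a / 2) (α := 2) (β := 2) (L := 2 * a) (by linarith) (by linarith)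
    (by linarith)]
  · ring
  · intro x y
    rw [mem_tripleOne ha]
    constructor
    · rintro ⟨h1, h2, h3⟩; refine ⟨h1, ?_, h2, ?_⟩ <;> linarith
    · rintro ⟨h1, -, h2, h3⟩; refine ⟨h1, h2, ?_⟩; linarith

section TypeOne

variable {a h : ℝ} {f : Fin 1 → ℤˣ} {p : ℝ × ℝ} {B : Set (ℝ × ℝ)} {l : ℝ}

theorem tripleOne_bendLeft (x : ℝ) :
    (tripleOne a h).bendLeft f x = if f 0 = -1 then max (x - a) 0 else 0 := by
  simp [Triple.bendLeft, tripleOne]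

theorem tripleOne_bendRight (x : ℝ) :
    (tripleOne a h).bendRight f x = if f 0 = -1 then max (a - x) 0 else 0 := by
  simp [Triple.bendRight, tripleOne]

theorem tripleOne_ε (i : Fin 1) : (tripleOne a h).ε i = 1 := by simp [tripleOne]

theorem tripleOne_unfold (hf : f 0 = -1) (x y : ℝ) :
    (tripleOne a h).unfold f (x, y) = (x, y + max (x - a) 0) := by
  rw [Triple.unfold, vShear, Triple.fold_eq_bendLeft tripleOne_ε, tripleOne_bendLeft, if_pos hf]

/-- The top vertex is a fake corner. If the cut is not reversed, it lies on the cut; if it is, the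
vertex becomes the midpoint of the images of the other two. -/
theorem tripleOne_apex (ha : 0 < a) (hh : 0 < h) (hh' : h < a / 2)
    (H : (tripleOne a h).IsCornerTriangle f p B l) : p = (0, 0) ∨ p = (2 * a, 0) := by
  have hv := extremePoints_convexHull_subset (H.isVertex (isRepresentative_tripleOne ha hh hh'))
  rcases hv with rfl | rfl | rfl
  · exact Or.inl rfl
  · exfalso
    rcases Int.units_eq_one_or (f 0) with hf | hf
    · have := H.not_cut 0 rfl
      simp [hf, tripleOne, sign] at this
      linarith
    · have := H.extreme (0, 0) (by rw [mem_tripleOne ha]; simp; linarith) (2 * a, 0)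
        (by rw [mem_tripleOne ha]; simp; linarith) (by
          simp only [tripleOne_unfold hf]
          rw [max_eq_right (by linarith : 0 - a ≤ 0), max_eq_right (by linarith : a - a ≤ 0),
            max_eq_left (by linarith : 0 ≤ 2 * a - a)]
          ext <;> simp <;> ring)
      simp at this
      linarith
  · exact Or.inr rfl

theorem eventually_tripleOne_left (ha : 0 < a) (h : ℝ) :
    ∀ᶠ q in 𝓝 ((0 : ℝ), (0 : ℝ)), (q ∈ (tripleOne a h).Δ ↔ q ∈ corner (1, 0) (2, 1) (0, 0)) := by
  have hc : Continuous fun q : ℝ × ℝ => q.1 + 2 * q.2 := by fun_prop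
  filter_upwards [hc.continuousAt.eventually_lt_const (u := 2 * a) (by simpa using ha)] with q h1
  rw [← Prod.mk.eta (p := q), mem_tripleOne ha]
  simp [corner, coordA, coordB]
  constructor
  · rintro ⟨h1, h2, h3⟩; exact ⟨h2, h1⟩
  · rintro ⟨h1, h2⟩; refine ⟨h2, h1, ?_⟩; linarith

theorem eventually_tripleOne_right (ha : 0 < a) (h : ℝ) :
    ∀ᶠ q in 𝓝 (2 * a, (0 : ℝ)), (q ∈ (tripleOne a h).Δ ↔
      q ∈ corner (-2, 1) (-1, 0) (2 * a, 0)) := by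
  have hc : Continuous fun q : ℝ × ℝ => q.1 - 2 * q.2 := by fun_prop
  filter_upwards [hc.continuousAt.eventually_const_lt (u := 0) (by simpa using ha)] with q h1
  rw [← Prod.mk.eta (p := q), mem_tripleOne ha]
  simp [corner, coordA, coordB]
  intro h0
  constructor
  · rintro ⟨h1, h2⟩; linarith
  · intro h; constructor <;> linarith

theorem tripleOne_left_mem (ha : 0 < a) (H : (tripleOne a h).IsCornerTriangle f (0, 0) B l)
    (x y : ℝ) : (x, y) ∈ B ↔ 2 * (y + (tripleOne a h).bendLeft f x) ≤ x ∧
      0 ≤ y + (tripleOne a h).bendLeft f x ∧ x - (y + (tripleOne a h).bendLeft f x) < l := by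
  rw [H.mem_iff_left tripleOne_ε (by simpa [tripleOne] using ha) (by simp [det])
    (eventually_tripleOne_left ha h)]
  simp [cornerTriangle, coordA, coordB]
  refine fun _ _ => ?_
  constructor <;> intro <;> linarith

theorem tripleOne_right_mem (ha : 0 < a) (H : (tripleOne a h).IsCornerTriangle f (2 * a, 0) B l)
    (x y : ℝ) : (x, y) ∈ B ↔ 0 ≤ y + (tripleOne a h).bendRight f x ∧
      2 * (y + (tripleOne a h).bendRight f x) ≤ 2 * a - x ∧
      2 * a - x - (y + (tripleOne a h).bendRight f x) < l := by
  rw [H.mem_iff_right tripleOne_ε (by simp [tripleOne]; linarith) (by simp [det])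
    (eventually_tripleOne_right ha h)]
  simp [cornerTriangle, coordA, coordB]
  refine fun _ => ⟨fun h => ⟨?_, ?_⟩, fun h => ⟨?_, ?_⟩⟩ <;> linarith [h.1, h.2]

/-- Without reversal the triangle is stopped by the top vertex, at lattice distance `a / 2` along
the upper edge. With reversal it may continue, but a size above `a - h` would engulf the marked
point. As `h < a / 2`, the second bound is the weaker one. -/
theorem tripleOne_left_le (ha : 0 < a) (hh : 0 < h) (hh' : h < a / 2)
    (H : (tripleOne a h).IsCornerTriangle f (0, 0) B l) : l ≤ a - h ∧ (f 0 = 1 → l ≤ a / 2) := by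
  have key : f 0 = 1 → l ≤ a / 2 := by
    intro hf
    by_contra! hc
    -- A point on the line of the upper left edge, beyond the top vertex but within the supposed
    -- triangle.
    have h1 : ((2 * ((a / 2 + l) / 2), (a / 2 + l) / 2) : ℝ × ℝ) ∈ B := by
      rw [tripleOne_left_mem ha H, tripleOne_bendLeft, if_neg (by simp [hf])]
      refine ⟨?_, ?_, ?_⟩ <;> linarith
    have := H.subset h1
    rw [mem_tripleOne ha] at this
    linarith [this.2.2]
  refine ⟨?_, key⟩
  rcases Int.units_eq_one_or (f 0) with hf | hf
  · linarith [key hf]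
  · by_contra! hc
    refine H.not_marked 0 ?_
    change (a, h) ∈ B
    rw [tripleOne_left_mem ha H, tripleOne_bendLeft, if_pos hf, max_eq_right (by linarith)]
    refine ⟨?_, ?_, ?_⟩ <;> linarith

theorem tripleOne_right_le (ha : 0 < a) (hh : 0 < h) (hh' : h < a / 2)
    (H : (tripleOne a h).IsCornerTriangle f (2 * a, 0) B l) :
    l ≤ a - h ∧ (f 0 = 1 → l ≤ a / 2) := by
  have key : f 0 = 1 → l ≤ a / 2 := by
    intro hf
    by_contra! hc
    have h1 : ((2 * a - 2 * ((a / 2 + l) / 2), (a / 2 + l) / 2) : ℝ × ℝ) ∈ B := by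
      rw [tripleOne_right_mem ha H, tripleOne_bendRight, if_neg (by simp [hf])]
      refine ⟨?_, ?_, ?_⟩ <;> linarith
    have := H.subset h1
    rw [mem_tripleOne ha] at this
    linarith [this.2.1]
  refine ⟨?_, key⟩
  rcases Int.units_eq_one_or (f 0) with hf | hf
  · linarith [key hf]
  · by_contra! hc
    refine H.not_marked 0 ?_
    change (a, h) ∈ B
    rw [tripleOne_right_mem ha H, tripleOne_bendRight, if_pos hf, max_eq_right (by linarith)]
    refine ⟨?_, ?_, ?_⟩ <;> linarith

/-- The upper edge of the polygon, which a change of the cut direction makes straight. -/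
theorem tripleOne_left_edge (ha : 0 < a) (hh : 0 < h) (hh' : h < a / 2)
    (H : (tripleOne a h).IsCornerTriangle f (0, 0) B l) (t : ℝ) (ht : 0 ≤ t) (htl : t < l) :
    (2 * t, min t (a - t)) ∈ B := by
  have hl := tripleOne_left_le ha hh hh' H
  rw [tripleOne_left_mem ha H, tripleOne_bendLeft]
  rcases Int.units_eq_one_or (f 0) with hf | hf
  · rw [if_neg (by simp [hf]), min_eq_left (by linarith [hl.2 hf])]
    refine ⟨?_, ?_, ?_⟩ <;> linarith
  · rw [if_pos hf]
    -- The bend turns the broken upper boundary into the straight segment `t ↦ (2 * t, t)`, of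
    -- lattice length `a`.
    have : min t (a - t) + max (2 * t - a) 0 = t := by
      rcases le_total t (a - t) with h | h
      · rw [min_eq_left h, max_eq_right (by linarith)]; simp
      · rw [min_eq_right h, max_eq_left (by linarith)]; ring
    rw [this]
    refine ⟨?_, ?_, ?_⟩ <;> linarith

theorem tripleOne_right_edge (ha : 0 < a) (hh : 0 < h) (hh' : h < a / 2)
    (H : (tripleOne a h).IsCornerTriangle f (2 * a, 0) B l) (t : ℝ) (ht : 0 ≤ t) (htl : t < l) :
    (2 * (a - t), min (a - t) (a - (a - t))) ∈ B := by
  have hl := tripleOne_right_le ha hh hh' H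
  rw [tripleOne_right_mem ha H, tripleOne_bendRight]
  rcases Int.units_eq_one_or (f 0) with hf | hf
  · rw [if_neg (by simp [hf]), min_eq_right (by linarith [hl.2 hf])]
    refine ⟨?_, ?_, ?_⟩ <;> linarith
  · rw [if_pos hf]
    have : min (a - t) (a - (a - t)) + max (a - 2 * (a - t)) 0 = t := by
      rcases le_total (a - t) (a - (a - t)) with h | h
      · rw [min_eq_left h, max_eq_left (by linarith)]; ring
      · rw [min_eq_right h, max_eq_right (by linarith)]; ring
    rw [this]
    refine ⟨?_, ?_, ?_⟩ <;> linarith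

theorem tripleOne_sum_sq_le (ha : 0 < a) (hh : 0 < h) (hh' : h < a / 2)
    {𝓑 : ℝ × ℝ → Set (ℝ × ℝ)} {Λ : ℝ × ℝ → ℝ} (H : (tripleOne a h).IsCornerFamily 𝓑 Λ) :
    Λ (0, 0) ^ 2 + Λ (2 * a, 0) ^ 2 ≤ (a - h) ^ 2 + h ^ 2 := by
  obtain ⟨H, hd⟩ := H
  have hd := hd (0, 0) (2 * a, 0) (by simp; linarith)
  have h1 : 0 ≤ Λ (0, 0) ∧ Λ (0, 0) ≤ a - h ∧
      ∀ t, 0 ≤ t → t < Λ (0, 0) → (2 * t, min t (a - t)) ∈ 𝓑 (0, 0) := by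
    rcases H (0, 0) with ⟨h0, -⟩ | ⟨f, H⟩
    · rw [h0]; exact ⟨le_rfl, by linarith, fun t h1 h2 => absurd h1 (not_le.2 h2)⟩
    · exact ⟨H.pos.le, (tripleOne_left_le ha hh hh' H).1, tripleOne_left_edge ha hh hh' H⟩
  have h2 : 0 ≤ Λ (2 * a, 0) ∧ Λ (2 * a, 0) ≤ a - h ∧ ∀ t, 0 ≤ t → t < Λ (2 * a, 0) →
      (2 * (a - t), min (a - t) (a - (a - t))) ∈ 𝓑 (2 * a, 0) := by
    rcases H (2 * a, 0) with ⟨h0, -⟩ | ⟨f, H⟩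
    · rw [h0]; exact ⟨le_rfl, by linarith, fun t h1 h2 => absurd h1 (not_le.2 h2)⟩
    · exact ⟨H.pos.le, (tripleOne_right_le ha hh hh' H).1, tripleOne_right_edge ha hh hh' H⟩
  have h3 := add_le_of_disjoint_edge hd (by linarith) (by linarith)
    (fun t => (2 * t, min t (a - t))) h1.2.2 h2.2.2
  obtain ⟨u0, u1, -⟩ := h1
  obtain ⟨v0, v1, -⟩ := h2
  generalize Λ (0, 0) = u at *
  generalize Λ (2 * a, 0) = v at *
  -- With `S = u + v`, the bounds `u, v ≤ a - h` give `u * v ≥ (a - h) * (S - (a - h))`, and then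
  -- `(a - S) * (S - (a - 2 * h)) ≥ 0` finishes. For smaller `S` the estimate `u ^ 2 + v ^ 2 ≤ S ^
  -- 2` is enough.
  rcases le_total (u + v) (a - h - h) with h4 | h4
  · nlinarith [mul_nonneg u0 v0]
  · nlinarith [mul_nonneg (sub_nonneg.2 u1) (sub_nonneg.2 v1),
      mul_nonneg (sub_nonneg.2 h3) (sub_nonneg.2 h4)]

theorem tripleOne_exists_isPacking (ha : 0 < a) (hh : 0 < h) (hh' : h < a / 2) :
    ∃ P, (tripleOne a h).IsPacking P ∧ area P = ((a - h) ^ 2 + h ^ 2) / 2 := by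
  have hφ : Continuous fun x : ℝ => max (x - a) 0 := by fun_prop
  have hφ0 : ∀ x : ℝ, 0 ≤ max (x - a) 0 ∧ x - a ≤ max (x - a) 0 ∧
      (max (x - a) 0 = 0 ∨ max (x - a) 0 = x - a) := fun x =>
    ⟨le_max_right _ _, le_max_left _ _, (max_choice _ _).symm⟩
  -- The larger triangle uses the reversed cut: it follows the straightened upper boundary and
  -- passes above the marked point. The smaller one fills what is left of that boundary and needs no
  -- reversal.
  refine Triple.exists_isPacking (d := 2) (p := ![(0, 0), (2 * a, 0)])
    (B := ![vShear (fun x => max (x - a) 0) ⁻¹' cornerTriangle (1, 0) (2, 1) (0, 0) (a - h),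
      cornerTriangle (-2, 1) (-1, 0) (2 * a, 0) h]) (l := ![a - h, h]) ?_ ?_ ?_ ?_ ?_ (by simp)
  · intro i; fin_cases i
    · refine Triple.isPackedTriangle_of_bend (fun _ => -1) (k := 0) (s := 0) (fun x => ?_) ?_
        (by simp [det]) (by linarith) (by simp [tripleOne]; linarith)
        (eventually_tripleOne_left ha h) ?_ ?_ ?_ ?_
      · rw [Triple.fold_eq_bendLeft tripleOne_ε, tripleOne_bendLeft]; simp
      · filter_upwards [Iio_mem_nhds ha] with x hx
        exact max_eq_right (by linarith [mem_Iio.1 hx])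
      · rintro ⟨x, y⟩ hq
        rw [mem_tripleOne ha] at hq
        simpa [corner, coordA, coordB] using ⟨hq.2.1, hq.1⟩
      · rintro ⟨x, y⟩ hq
        rw [mem_tripleOne ha] at hq
        simp [corner, coordA, coordB]
        obtain ⟨h1, h2, h3 | h3⟩ := hφ0 x <;> constructor <;> linarith
      · rintro ⟨x, y⟩ hq
        simp [cornerTriangle, coordA, coordB] at hq
        rw [mem_tripleOne ha]
        obtain ⟨h1, h2, h3 | h3⟩ := hφ0 x <;> refine ⟨?_, ?_, ?_⟩ <;> linarith
      · intro i hq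
        simp [tripleOne, cornerTriangle, coordA, coordB] at hq
        linarith
    · refine Triple.isPackedTriangle_of_one (by simp [det]) hh (by simp [tripleOne]; linarith)
        (eventually_tripleOne_right ha h) ?_ ?_ ?_
      · rintro ⟨x, y⟩ hq
        rw [mem_tripleOne ha] at hq
        simp [corner, coordA, coordB]
        constructor <;> linarith
      · rintro ⟨x, y⟩ hq
        simp [cornerTriangle, coordA, coordB] at hq
        rw [mem_tripleOne ha]
        refine ⟨?_, ?_, ?_⟩ <;> linarith
      · intro i hq
        simp [tripleOne, cornerTriangle, coordA, coordB] at hq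
        linarith
  · intro i j hij
    fin_cases i <;> fin_cases j <;> simp at hij
    -- With `Y` the height after bending, the cones give `2 * Y ≤ x` and `2 * y ≤ 2 * a - x`, hence
    -- `Y + y ≤ a`, while the two sizes add up to `a` and force `Y + y > a`.
    refine disjoint_left.2 ?_
    rintro ⟨x, y⟩ h1 h2
    simp [vShear, cornerTriangle, coordA, coordB] at h1 h2
    obtain ⟨h4, h5, h3 | h3⟩ := hφ0 x <;> linarith
  · intro i; fin_cases i
    · exact measurableSet_vShear_preimage hφ _ _ _ _
    · exact measurableSet_cornerTriangle _ _ _ _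
  · intro i; fin_cases i <;> simp <;> linarith
  · intro i; fin_cases i
    · exact area_vShear_preimage hφ (by simp [det]) _ (show 0 < a - h by linarith)
    · exact area_cornerTriangle (by simp [det]) _ hh.le

end TypeOne

theorem packingDensity_minimalOne (a h : ℝ) (ha : 0 < a) (hh : 0 < h) (hh' : h < a / 2) :
    packingDensity (minimalOne a h ha hh hh').semitoricPolygon =
      (a ^ 2 + 2 * h ^ 2 - 2 * a * h) / a ^ 2 := by
  rw [packingDensity_eq (minimalOne a h ha hh hh') (w := ![(0, 0), (2 * a, 0)])
    (K := (a - h) ^ 2 + h ^ 2) ?_ ?_ ?_ (tripleOne_exists_isPacking ha hh hh')]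
  · change _ / area (tripleOne a h).Δ = _
    rw [area_tripleOne ha]
    field_simp
    ring
  · intro i j; fin_cases i <;> fin_cases j <;> simp <;> linarith
  · intro f p B l H
    rcases tripleOne_apex ha hh hh' H with rfl | rfl
    · exact ⟨0, rfl⟩
    · exact ⟨1, rfl⟩
  · intro 𝓑 Λ H
    simpa using tripleOne_sum_sq_le ha hh hh' H

/-! ### Type (2) -/

theorem mem_tripleTwo {a b : ℝ} (ha : 0 < a) (hb : 0 ≤ b) (h₁ h₂ x y : ℝ) :
    (x, y) ∈ (tripleTwo a b h₁ h₂).Δ ↔ 0 ≤ y ∧ y ≤ x ∧ y ≤ a ∧ x + y ≤ 2 * a + b := by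
  have := hullTrapezoid (n := 2) ha hb (by norm_num)
  norm_num at this
  rw [mul_comm] at this
  simp only [tripleTwo, this, halfPlanes, mem_ofPred_eq, Fin.forall_fin_succ]
  simp

theorem area_tripleTwo {a b : ℝ} (ha : 0 < a) (hb : 0 ≤ b) (h₁ h₂ : ℝ) :
    area (tripleTwo a b h₁ h₂).Δ = a * (a + b) := by
  rw [area_trapezoid (c := a) (α := 1) (β := 1) (L := 2 * a + b) (by linarith) (by linarith)
    (by linarith)]
  · ring
  · intro x y
    rw [mem_tripleTwo ha hb]
    constructor
    · rintro ⟨h1, h2, h3, h4⟩; refine ⟨h1, h3, ?_, ?_⟩ <;> linarith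
    · rintro ⟨h1, h2, h3, h4⟩; refine ⟨h1, ?_, h2, ?_⟩ <;> linarith

section TypeTwo

variable {a b h₁ h₂ : ℝ} {f : Fin 2 → ℤˣ} {p : ℝ × ℝ} {B : Set (ℝ × ℝ)} {l : ℝ}

theorem tripleTwo_bendLeft (x : ℝ) : (tripleTwo a b h₁ h₂).bendLeft f x =
    (if f 0 = -1 then max (x - a) 0 else 0) + if f 1 = -1 then max (x - (a + b)) 0 else 0 := by
  simp [Triple.bendLeft, tripleTwo, Fin.sum_univ_two]

theorem tripleTwo_ε (i : Fin 2) : (tripleTwo a b h₁ h₂).ε i = 1 := by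
  fin_cases i <;> simp [tripleTwo]

/-- A fake corner again. For `b = 0` both cuts end here and must both be reversed, which straightens
the two sloping edges into one; for `b > 0` only the first cut matters. -/
theorem tripleTwo_not_apex_left (ha : 0 < a) (hb : 0 ≤ b) (hh₁' : h₁ < a) (hh₂' : h₂ < a) :
    ¬ (tripleTwo a b h₁ h₂).IsCornerTriangle f (a, a) B l := by
  intro H
  have h0 : f 0 = -1 := by
    refine (Int.units_eq_one_or (f 0)).resolve_left fun hf => ?_
    have := H.not_cut 0 rfl
    simp [hf, tripleTwo, sign] at this
    linarith
  rcases hb.eq_or_lt with rfl | hb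
  · have h1 : f 1 = -1 := by
      refine (Int.units_eq_one_or (f 1)).resolve_left fun hf => ?_
      have := H.not_cut 1 (by simp [tripleTwo])
      simp [hf, tripleTwo, sign] at this
      linarith
    have := H.extreme (0, 0) (by rw [mem_tripleTwo ha le_rfl]; refine ⟨?_, ?_, ?_, ?_⟩ <;> linarith)
      (2 * a, 0) (by rw [mem_tripleTwo ha le_rfl]; refine ⟨?_, ?_, ?_, ?_⟩ <;> linarith) (by
        simp only [Triple.unfold, vShear, Triple.fold_eq_bendLeft tripleTwo_ε, tripleTwo_bendLeft,
          if_pos h0, if_pos h1, add_zero]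
        rw [max_eq_right (by linarith : 0 - a ≤ 0), max_eq_right (by linarith : a - a ≤ 0),
          max_eq_left (by linarith : 0 ≤ 2 * a - a)]
        ext <;> simp <;> ring)
    simp at this
    linarith
  -- Small enough for a step of length `t` to stay on each of the two edges at the corner.
  · obtain ⟨t, ht, hta, htb⟩ : ∃ t : ℝ, 0 < t ∧ t ≤ a ∧ t ≤ b :=
      ⟨min a b, lt_min ha hb, min_le_left _ _, min_le_right _ _⟩
    have hz : ∀ x, x ≤ a + b → (if f 1 = -1 then max (x - (a + b)) 0 else 0) = 0 := by
      intro x hx; rw [max_eq_right (by linarith)]; simp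
    have := H.extreme (a - t, a - t)
      (by rw [mem_tripleTwo ha hb.le]; refine ⟨?_, ?_, ?_, ?_⟩ <;> linarith) (a + t, a)
      (by rw [mem_tripleTwo ha hb.le]; refine ⟨?_, ?_, ?_, ?_⟩ <;> linarith) (by
        simp only [Triple.unfold, vShear, Triple.fold_eq_bendLeft tripleTwo_ε, tripleTwo_bendLeft,
          if_pos h0]
        rw [hz _ (by linarith), hz _ (by linarith), hz _ (by linarith),
          max_eq_right (by linarith : a - t - a ≤ 0), max_eq_right (by linarith : a - a ≤ 0),
          max_eq_left (by linarith : 0 ≤ a + t - a)]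
        ext <;> simp)
    simp at this
    linarith

theorem tripleTwo_not_apex_right (ha : 0 < a) (hb : 0 ≤ b) (hh₁' : h₁ < a) (hh₂' : h₂ < a) :
    ¬ (tripleTwo a b h₁ h₂).IsCornerTriangle f (a + b, a) B l := by
  rcases hb.eq_or_lt with rfl | hb
  · rw [add_zero]; exact tripleTwo_not_apex_left ha le_rfl hh₁' hh₂'
  intro H
  have h1 : f 1 = -1 := by
    refine (Int.units_eq_one_or (f 1)).resolve_left fun hf => ?_
    have := H.not_cut 1 rfl
    simp [hf, tripleTwo, sign] at this
    linarith
  obtain ⟨t, ht, hta, htb⟩ : ∃ t : ℝ, 0 < t ∧ t ≤ a ∧ t ≤ b :=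
    ⟨min a b, lt_min ha hb, min_le_left _ _, min_le_right _ _⟩
  -- To the right of `a` the first kink is affine, so it does not disturb the midpoint relation.
  have hz : ∀ x, a ≤ x → (if f 0 = -1 then max (x - a) 0 else 0) =
      (x - a) * if f 0 = -1 then 1 else 0 := by
    intro x hx; rw [max_eq_left (by linarith)]; simp
  have := H.extreme (a + b - t, a)
    (by rw [mem_tripleTwo ha hb.le]; refine ⟨?_, ?_, ?_, ?_⟩ <;> linarith) (a + b + t, a - t)
    (by rw [mem_tripleTwo ha hb.le]; refine ⟨?_, ?_, ?_, ?_⟩ <;> linarith) (by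
      simp only [Triple.unfold, vShear, Triple.fold_eq_bendLeft tripleTwo_ε, tripleTwo_bendLeft,
        if_pos h1]
      rw [hz _ (by linarith), hz _ (by linarith), hz _ (by linarith),
        max_eq_right (by linarith : a + b - t - (a + b) ≤ 0),
        max_eq_right (by linarith : a + b - (a + b) ≤ 0),
        max_eq_left (by linarith : 0 ≤ a + b + t - (a + b))]
      ext <;> simp
      split_ifs <;> ring)
  simp at this
  linarith [this.1]

theorem tripleTwo_apex (ha : 0 < a) (hb : 0 ≤ b) (hh₁ : 0 < h₁) (hh₁' : h₁ < a) (hh₂ : 0 < h₂)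
    (hh₂' : h₂ < a) (H : (tripleTwo a b h₁ h₂).IsCornerTriangle f p B l) :
    p = (0, 0) ∨ p = (2 * a + b, 0) := by
  have hv := extremePoints_convexHull_subset
    (H.isVertex (isRepresentative_tripleTwo ha hb hh₁ hh₁' hh₂ hh₂'))
  rcases hv with rfl | rfl | rfl | rfl
  · exact Or.inl rfl
  · exact absurd H (tripleTwo_not_apex_left ha hb hh₁' hh₂')
  · exact absurd H (tripleTwo_not_apex_right ha hb hh₁' hh₂')
  · exact Or.inr rfl

theorem eventually_tripleTwo_left (ha : 0 < a) (hb : 0 ≤ b) (h₁ h₂ : ℝ) :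
    ∀ᶠ q in 𝓝 ((0 : ℝ), (0 : ℝ)), (q ∈ (tripleTwo a b h₁ h₂).Δ ↔
      q ∈ corner (1, 0) (1, 1) (0, 0)) := by
  have hc : Continuous fun q : ℝ × ℝ => q.1 + q.2 := by fun_prop
  have hc' : Continuous fun q : ℝ × ℝ => q.2 := by fun_prop
  filter_upwards [hc.continuousAt.eventually_lt_const (u := 2 * a + b) (by simp; linarith),
    hc'.continuousAt.eventually_lt_const (u := a) (by simpa using ha)] with q h1 h2
  rw [← Prod.mk.eta (p := q), mem_tripleTwo ha hb]
  simp [corner, coordA, coordB]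
  constructor
  · rintro ⟨h1, h2, -⟩; exact ⟨h2, h1⟩
  · rintro ⟨h3, h4⟩; refine ⟨h4, h3, ?_, ?_⟩ <;> linarith

theorem eventually_tripleTwo_right (ha : 0 < a) (hb : 0 ≤ b) (h₁ h₂ : ℝ) :
    ∀ᶠ q in 𝓝 (2 * a + b, (0 : ℝ)), (q ∈ (tripleTwo a b h₁ h₂).Δ ↔
      q ∈ corner (-1, 1) (-1, 0) (2 * a + b, 0)) := by
  have hc : Continuous fun q : ℝ × ℝ => q.1 - q.2 := by fun_prop
  have hc' : Continuous fun q : ℝ × ℝ => q.2 := by fun_prop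
  filter_upwards [hc.continuousAt.eventually_const_lt (u := 0) (by simp; linarith),
    hc'.continuousAt.eventually_lt_const (u := a) (by simpa using ha)] with q h1 h2
  rw [← Prod.mk.eta (p := q), mem_tripleTwo ha hb]
  simp [corner, coordA, coordB]
  intro h0
  constructor
  · rintro ⟨h1, h2, h3⟩; linarith
  · intro h; refine ⟨?_, ?_, ?_⟩ <;> linarith

theorem tripleTwo_left_mem (ha : 0 < a) (hb : 0 ≤ b)
    (H : (tripleTwo a b h₁ h₂).IsCornerTriangle f (0, 0) B l) (x y : ℝ) :
    (x, y) ∈ B ↔ 0 ≤ y + (tripleTwo a b h₁ h₂).bendLeft f x ∧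
      y + (tripleTwo a b h₁ h₂).bendLeft f x ≤ x ∧ x < l := by
  rw [H.mem_iff_left tripleTwo_ε (by
    intro i; fin_cases i <;> simp [tripleTwo] <;> linarith) (by simp [det])
    (eventually_tripleTwo_left ha hb h₁ h₂)]
  simp [cornerTriangle, coordA, coordB]
  tauto

theorem tripleTwo_right_mem (ha : 0 < a) (hb : 0 ≤ b)
    (H : (tripleTwo a b h₁ h₂).IsCornerTriangle f (2 * a + b, 0) B l) (x y : ℝ) :
    (x, y) ∈ B ↔ 0 ≤ y + (tripleTwo a b h₁ h₂).bendRight f x ∧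
      y + (tripleTwo a b h₁ h₂).bendRight f x ≤ 2 * a + b - x ∧ 2 * a + b - x < l := by
  rw [H.mem_iff_right tripleTwo_ε (by
    intro i; fin_cases i <;> simp [tripleTwo] <;> linarith) (by simp [det])
    (eventually_tripleTwo_right ha hb h₁ h₂)]
  simp [cornerTriangle, coordA, coordB]
  refine fun _ => ⟨fun h => ⟨?_, ?_⟩, fun h => ⟨?_, ?_⟩⟩ <;> linarith [h.1, h.2]

/-- However the triangle is bent, its slice at abscissa `t` has height `t`, whereas the polygon has
height `a`. -/
theorem tripleTwo_left_le (ha : 0 < a) (hb : 0 ≤ b)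
    (H : (tripleTwo a b h₁ h₂).IsCornerTriangle f (0, 0) B l) : l ≤ a := by
  by_contra! hc
  obtain ⟨t, ht, htl⟩ := exists_between hc
  have h1 : (t, 0 - (tripleTwo a b h₁ h₂).bendLeft f t) ∈ B := by
    rw [tripleTwo_left_mem ha hb H]; refine ⟨?_, ?_, ?_⟩ <;> linarith
  have h2 : (t, t - (tripleTwo a b h₁ h₂).bendLeft f t) ∈ B := by
    rw [tripleTwo_left_mem ha hb H]; refine ⟨?_, ?_, ?_⟩ <;> linarith
  have h1 := H.subset h1
  have h2 := H.subset h2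
  rw [mem_tripleTwo ha hb] at h1 h2
  linarith [h1.1, h2.2.2.1]

theorem tripleTwo_right_le (ha : 0 < a) (hb : 0 ≤ b)
    (H : (tripleTwo a b h₁ h₂).IsCornerTriangle f (2 * a + b, 0) B l) : l ≤ a := by
  by_contra! hc
  obtain ⟨t, ht, htl⟩ := exists_between hc
  obtain ⟨x, hx⟩ : ∃ x, x = 2 * a + b - t := ⟨_, rfl⟩
  have h1 : (x, 0 - (tripleTwo a b h₁ h₂).bendRight f x) ∈ B := by
    rw [tripleTwo_right_mem ha hb H]; refine ⟨?_, ?_, ?_⟩ <;> linarith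
  have h2 : (x, t - (tripleTwo a b h₁ h₂).bendRight f x) ∈ B := by
    rw [tripleTwo_right_mem ha hb H]; refine ⟨?_, ?_, ?_⟩ <;> linarith
  have h1 := H.subset h1
  have h2 := H.subset h2
  rw [mem_tripleTwo ha hb] at h1 h2
  linarith [h1.1, h2.2.2.1]

theorem tripleTwo_sum_sq_le (ha : 0 < a) (hb : 0 ≤ b) {𝓑 : ℝ × ℝ → Set (ℝ × ℝ)} {Λ : ℝ × ℝ → ℝ}
    (H : (tripleTwo a b h₁ h₂).IsCornerFamily 𝓑 Λ) :
    Λ (0, 0) ^ 2 + Λ (2 * a + b, 0) ^ 2 ≤ 2 * a ^ 2 := by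
  have h1 : 0 ≤ Λ (0, 0) ∧ Λ (0, 0) ≤ a := by
    rcases H.1 (0, 0) with ⟨h0, -⟩ | ⟨f, H⟩
    · rw [h0]; exact ⟨le_rfl, ha.le⟩
    · exact ⟨H.pos.le, tripleTwo_left_le ha hb H⟩
  have h2 : 0 ≤ Λ (2 * a + b, 0) ∧ Λ (2 * a + b, 0) ≤ a := by
    rcases H.1 (2 * a + b, 0) with ⟨h0, -⟩ | ⟨f, H⟩
    · rw [h0]; exact ⟨le_rfl, ha.le⟩
    · exact ⟨H.pos.le, tripleTwo_right_le ha hb H⟩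
  have := pow_le_pow_left₀ h1.1 h1.2 2
  have := pow_le_pow_left₀ h2.1 h2.2 2
  linarith

theorem tripleTwo_exists_isPacking (ha : 0 < a) (hb : 0 ≤ b) :
    ∃ P, (tripleTwo a b h₁ h₂).IsPacking P ∧ area P = (2 * a ^ 2) / 2 := by
  -- No cut is reversed: the triangles lie in `x < a` and `x > a + b`, so they meet neither each
  -- other nor the marked points.
  refine Triple.exists_isPacking (d := 2) (p := ![(0, 0), (2 * a + b, 0)])
    (B := ![cornerTriangle (1, 0) (1, 1) (0, 0) a,
      cornerTriangle (-1, 1) (-1, 0) (2 * a + b, 0) a]) (l := ![a, a]) ?_ ?_ ?_ ?_ ?_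
      (by simp; ring)
  · intro i; fin_cases i
    · refine Triple.isPackedTriangle_of_one (by simp [det]) ha
        (by intro i; fin_cases i <;> (simp [tripleTwo]; linarith))
        (eventually_tripleTwo_left ha hb h₁ h₂) ?_ ?_ ?_
      · rintro ⟨x, y⟩ hq
        rw [mem_tripleTwo ha hb] at hq
        simp [corner, coordA, coordB]
        constructor <;> linarith
      · rintro ⟨x, y⟩ hq
        simp [cornerTriangle, coordA, coordB] at hq
        rw [mem_tripleTwo ha hb]
        refine ⟨?_, ?_, ?_, ?_⟩ <;> linarith
      · intro i hq
        fin_cases i <;> simp [tripleTwo, cornerTriangle, coordA, coordB] at hq <;> linarith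
    · refine Triple.isPackedTriangle_of_one (by simp [det]) ha
        (by intro i; fin_cases i <;> (simp [tripleTwo]; linarith))
        (eventually_tripleTwo_right ha hb h₁ h₂) ?_ ?_ ?_
      · rintro ⟨x, y⟩ hq
        rw [mem_tripleTwo ha hb] at hq
        simp [corner, coordA, coordB]
        constructor <;> linarith
      · rintro ⟨x, y⟩ hq
        simp [cornerTriangle, coordA, coordB] at hq
        rw [mem_tripleTwo ha hb]
        refine ⟨?_, ?_, ?_, ?_⟩ <;> linarith
      · intro i hq
        fin_cases i <;> simp [tripleTwo, cornerTriangle, coordA, coordB] at hq <;> linarith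
  · intro i j hij
    fin_cases i <;> fin_cases j <;> simp at hij
    refine disjoint_left.2 ?_
    rintro ⟨x, y⟩ h1 h2
    simp [cornerTriangle, coordA, coordB] at h1 h2
    linarith
  · intro i; fin_cases i <;> exact measurableSet_cornerTriangle _ _ _ _
  · intro i; fin_cases i <;> exact ha
  · intro i; fin_cases i <;> exact area_cornerTriangle (by simp [det]) _ ha.le

end TypeTwo

theorem packingDensity_minimalTwo (a b h₁ h₂ : ℝ) (ha : 0 < a) (hb : 0 ≤ b) (hh₁ : 0 < h₁)
    (hh₁' : h₁ < a) (hh₂ : 0 < h₂) (hh₂' : h₂ < a) :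
    packingDensity (minimalTwo a b h₁ h₂ ha hb hh₁ hh₁' hh₂ hh₂').semitoricPolygon =
      a / (a + b) := by
  rw [packingDensity_eq (minimalTwo a b h₁ h₂ ha hb hh₁ hh₁' hh₂ hh₂')
    (w := ![(0, 0), (2 * a + b, 0)]) (K := 2 * a ^ 2) ?_ ?_ ?_ (tripleTwo_exists_isPacking ha hb)]
  · change _ / area (tripleTwo a b h₁ h₂).Δ = _
    rw [area_tripleTwo ha hb]
    have : a + b ≠ 0 := by linarith
    field_simp
  · intro i j; fin_cases i <;> fin_cases j <;> simp <;> linarith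
  · intro f p B l H
    rcases tripleTwo_apex ha hb hh₁ hh₁' hh₂ hh₂' H with rfl | rfl
    · exact ⟨0, rfl⟩
    · exact ⟨1, rfl⟩
  · intro 𝓑 Λ H
    simpa using tripleTwo_sum_sq_le ha hb H

/-! ### Types (3a) and (3b) -/

/-- Because of this most geometric lemmas below allow `b = 0`. In that case the top right vertex
merges with `(a, a)`, a hidden corner, which is a possible apex once the cut is reversed. -/
theorem tripleThreeB_eq (a h : ℝ) (n : ℤ) : tripleThreeB a h n = tripleThreeA a 0 h n := by
  simp [tripleThreeA, tripleThreeB]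

theorem mem_tripleThreeA {a b : ℝ} {n : ℤ} (ha : 0 < a) (hb : 0 ≤ b) (hn : 1 ≤ n) (h x y : ℝ) :
    (x, y) ∈ (tripleThreeA a b h n).Δ ↔
      0 ≤ y ∧ y ≤ x ∧ y ≤ a ∧ x + (n - 1) * y ≤ a * n + b := by
  simp only [tripleThreeA, hullTrapezoid ha hb hn, halfPlanes, mem_ofPred_eq, Fin.forall_fin_succ]
  simp

theorem area_tripleThreeA {a b : ℝ} {n : ℤ} (ha : 0 < a) (hb : 0 ≤ b) (hn : 1 ≤ n) (h : ℝ) :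
    area (tripleThreeA a b h n).Δ = a * (a * n + 2 * b) / 2 := by
  have hn' : (1 : ℝ) ≤ n := by exact_mod_cast hn
  rw [area_trapezoid (c := a) (α := 1) (β := n - 1) (L := a * n + b) ha.le (by linarith)
    (by positivity)]
  · ring
  · intro x y
    rw [mem_tripleThreeA ha hb hn]
    constructor
    · rintro ⟨h1, h2, h3, h4⟩; refine ⟨h1, h3, ?_, ?_⟩ <;> linarith
    · rintro ⟨h1, h2, h3, h4⟩; refine ⟨h1, ?_, h2, ?_⟩ <;> linarith

section TypeThreeA

variable {a b h : ℝ} {n : ℤ} {f : Fin 1 → ℤˣ} {p : ℝ × ℝ} {B : Set (ℝ × ℝ)} {l : ℝ}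

theorem tripleThreeA_bendLeft (x : ℝ) :
    (tripleThreeA a b h n).bendLeft f x = if f 0 = -1 then max (x - a) 0 else 0 := by
  simp [Triple.bendLeft, tripleThreeA]

theorem tripleThreeA_bendRight (x : ℝ) :
    (tripleThreeA a b h n).bendRight f x = if f 0 = -1 then max (a - x) 0 else 0 := by
  simp [Triple.bendRight, tripleThreeA]

theorem tripleThreeA_ε (i : Fin 1) : (tripleThreeA a b h n).ε i = 1 := by simp [tripleThreeA]

theorem tripleThreeA_unfold (hf : f 0 = -1) (x y : ℝ) :
    (tripleThreeA a b h n).unfold f (x, y) = (x, y + max (x - a) 0) := by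
  rw [Triple.unfold, vShear, Triple.fold_eq_bendLeft tripleThreeA_ε, tripleThreeA_bendLeft,
    if_pos hf]

theorem tripleThreeA_flip_of_apex (hh' : h < a)
    (H : (tripleThreeA a b h n).IsCornerTriangle f (a, a) B l) : f 0 = -1 := by
  refine (Int.units_eq_one_or (f 0)).resolve_left fun hf => ?_
  have := H.not_cut 0 rfl
  simp [hf, tripleThreeA, sign] at this
  linarith

theorem tripleThreeA_apex (ha : 0 < a) (hb : 0 < b) (hn : 1 ≤ n) (hh : 0 < h) (hh' : h < a)
    (H : (tripleThreeA a b h n).IsCornerTriangle f p B l) :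
    p = (0, 0) ∨ p = (a + b, a) ∨ p = (a * n + b, 0) := by
  have hn' : (1 : ℝ) ≤ n := by exact_mod_cast hn
  have hv := extremePoints_convexHull_subset
    (H.isVertex (isRepresentative_tripleThreeA ha hb hh hh' hn))
  rcases hv with rfl | rfl | rfl | rfl
  · exact Or.inl rfl
  · exfalso
    have hf := tripleThreeA_flip_of_apex hh' H
    obtain ⟨t, ht, hta, htb⟩ : ∃ t : ℝ, 0 < t ∧ t ≤ a ∧ t ≤ b :=
      ⟨min a b, lt_min ha hb, min_le_left _ _, min_le_right _ _⟩
    have hna := mul_nonneg (sub_nonneg.2 hta) (sub_nonneg.2 hn')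
    have hnt := mul_nonneg ht.le (sub_nonneg.2 hn')
    have := H.extreme (a - t, a - t)
      (by rw [mem_tripleThreeA ha hb.le hn]; refine ⟨?_, ?_, ?_, ?_⟩ <;> linarith) (a + t, a)
      (by rw [mem_tripleThreeA ha hb.le hn]; refine ⟨?_, ?_, ?_, ?_⟩ <;> linarith) (by
        simp only [tripleThreeA_unfold hf]
        rw [max_eq_right (by linarith : a - t - a ≤ 0), max_eq_right (by linarith : a - a ≤ 0),
          max_eq_left (by linarith : 0 ≤ a + t - a)]
        ext <;> simp)
    simp at this
    linarith
  · exact Or.inr (Or.inl rfl)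
  · exact Or.inr (Or.inr rfl)

theorem eventually_tripleThreeA_left (ha : 0 < a) (hb : 0 ≤ b) (hn : 1 ≤ n) (h : ℝ) :
    ∀ᶠ q in 𝓝 ((0 : ℝ), (0 : ℝ)), (q ∈ (tripleThreeA a b h n).Δ ↔
      q ∈ corner (1, 0) (1, 1) (0, 0)) := by
  have hn' : (1 : ℝ) ≤ n := by exact_mod_cast hn
  have hpos : 0 < a * n + b := by positivity
  have hc : Continuous fun q : ℝ × ℝ => q.1 + (n - 1) * q.2 := by fun_prop
  have hc' : Continuous fun q : ℝ × ℝ => q.2 := by fun_prop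
  filter_upwards [hc.continuousAt.eventually_lt_const (u := a * n + b) (by simpa using hpos),
    hc'.continuousAt.eventually_lt_const (u := a) (by simpa using ha)] with q h1 h2
  rw [← Prod.mk.eta (p := q), mem_tripleThreeA ha hb hn]
  simp [corner, coordA, coordB]
  constructor
  · rintro ⟨h1, h2, -⟩; exact ⟨h2, h1⟩
  · rintro ⟨h3, h4⟩; refine ⟨h4, h3, ?_, ?_⟩ <;> linarith

theorem eventually_tripleThreeA_right (ha : 0 < a) (hb : 0 ≤ b) (hn : 1 ≤ n) (h : ℝ) :
    ∀ᶠ q in 𝓝 (a * n + b, (0 : ℝ)), (q ∈ (tripleThreeA a b h n).Δ ↔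
      q ∈ corner (1 - n, 1) (-1, 0) (a * n + b, 0)) := by
  have hn' : (1 : ℝ) ≤ n := by exact_mod_cast hn
  have hpos : 0 < a * n + b := by positivity
  have hc : Continuous fun q : ℝ × ℝ => q.1 - q.2 := by fun_prop
  have hc' : Continuous fun q : ℝ × ℝ => q.2 := by fun_prop
  filter_upwards [hc.continuousAt.eventually_const_lt (u := 0) (by simpa using hpos),
    hc'.continuousAt.eventually_lt_const (u := a) (by simpa using ha)] with q h1 h2
  rw [← Prod.mk.eta (p := q), mem_tripleThreeA ha hb hn]
  simp [corner, coordA, coordB]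
  intro h0
  constructor
  · rintro ⟨h1, h2, h3⟩; linarith
  · intro h; refine ⟨?_, ?_, ?_⟩ <;> linarith

theorem eventually_tripleThreeA_top (ha : 0 < a) (hb : 0 < b) (hn : 1 ≤ n) (h : ℝ) :
    ∀ᶠ q in 𝓝 (a + b, a), (q ∈ (tripleThreeA a b h n).Δ ↔
      q ∈ corner (-1, 0) (n - 1, -1) (a + b, a)) := by
  have hc : Continuous fun q : ℝ × ℝ => q.1 - q.2 := by fun_prop
  have hc' : Continuous fun q : ℝ × ℝ => q.2 := by fun_prop
  filter_upwards [hc.continuousAt.eventually_const_lt (u := 0) (by simpa using hb),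
    hc'.continuousAt.eventually_const_lt (u := 0) (by simpa using ha)] with q h1 h2
  rw [← Prod.mk.eta (p := q), mem_tripleThreeA ha hb.le hn]
  simp [corner, coordA, coordB]
  constructor
  · rintro ⟨h3, h4, h5, h6⟩; constructor <;> linarith
  · rintro ⟨h3, h4⟩; refine ⟨?_, ?_, ?_, ?_⟩ <;> linarith

/-- The top right corner after the change of the cut direction; it also makes sense for `b = 0`. -/
theorem eventually_tripleThreeA_top_flip (ha : 0 < a) (hb : 0 ≤ b) (hn : 1 ≤ n) (h : ℝ)
    (hf : f 0 = -1) :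
    ∀ᶠ q in 𝓝 (a + b, a), (q ∈ (tripleThreeA a b h n).Δ ↔
      (tripleThreeA a b h n).unfold f q ∈
        corner (-1, -1) (n - 1, n - 2) ((tripleThreeA a b h n).unfold f (a + b, a))) := by
  have hn' : (1 : ℝ) ≤ n := by exact_mod_cast hn
  have hc' : Continuous fun q : ℝ × ℝ => q.2 := by fun_prop
  filter_upwards [hc'.continuousAt.eventually_const_lt (u := 0) (by simpa using ha)] with q h2
  obtain ⟨x, y⟩ := q
  simp only at h2
  rw [mem_tripleThreeA ha hb hn, tripleThreeA_unfold hf, tripleThreeA_unfold hf,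
    max_eq_left (by linarith : 0 ≤ a + b - a)]
  simp [corner, coordA, coordB]
  -- Reversing the cut straightens the left and top edges into the side in direction `(-1, -1)`. The
  -- four inequalities reduce to the two of the cone, on each side of the kink.
  rcases le_total x a with hx | hx
  · rw [max_eq_right (by linarith)]
    constructor
    · rintro ⟨h3, h4, h5, h6⟩
      have := mul_nonneg (sub_nonneg.2 hn') (sub_nonneg.2 h4)
      constructor <;> linarith
    · rintro ⟨h3, h4⟩
      have h5 : y ≤ x := by linarith
      have := mul_le_mul_of_nonneg_left (h5.trans hx) (sub_nonneg.2 hn')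
      refine ⟨?_, ?_, ?_, ?_⟩ <;> linarith
  · rw [max_eq_left (by linarith)]
    constructor
    · rintro ⟨h3, h4, h5, h6⟩; constructor <;> linarith
    · rintro ⟨h3, h4⟩; refine ⟨?_, ?_, ?_, ?_⟩ <;> linarith

theorem tripleThreeA_left_mem (ha : 0 < a) (hb : 0 ≤ b) (hn : 1 ≤ n)
    (H : (tripleThreeA a b h n).IsCornerTriangle f (0, 0) B l) (x y : ℝ) :
    (x, y) ∈ B ↔ 0 ≤ y + (tripleThreeA a b h n).bendLeft f x ∧
      y + (tripleThreeA a b h n).bendLeft f x ≤ x ∧ x < l := by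
  rw [H.mem_iff_left tripleThreeA_ε (by simpa [tripleThreeA] using ha) (by simp [det])
    (eventually_tripleThreeA_left ha hb hn h)]
  simp [cornerTriangle, coordA, coordB]
  tauto

theorem tripleThreeA_right_mem (ha : 0 < a) (hb : 0 ≤ b) (hn : 1 ≤ n) (hab : a < a * n + b)
    (H : (tripleThreeA a b h n).IsCornerTriangle f (a * n + b, 0) B l) (x y : ℝ) :
    (x, y) ∈ B ↔ 0 ≤ y + (tripleThreeA a b h n).bendRight f x ∧
      x + (n - 1) * (y + (tripleThreeA a b h n).bendRight f x) ≤ a * n + b ∧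
      a * n + b - x - (n - 2) * (y + (tripleThreeA a b h n).bendRight f x) < l := by
  rw [H.mem_iff_right tripleThreeA_ε (by simpa [tripleThreeA] using hab) (by simp [det])
    (eventually_tripleThreeA_right ha hb hn h)]
  simp [cornerTriangle, coordA, coordB]
  refine fun _ => ⟨fun h => ⟨?_, ?_⟩, fun h => ⟨?_, ?_⟩⟩ <;> linarith [h.1, h.2]

theorem tripleThreeA_top_mem (ha : 0 < a) (hb : 0 < b) (hn : 1 ≤ n) (hf : f 0 = 1)
    (H : (tripleThreeA a b h n).IsCornerTriangle f (a + b, a) B l) (x y : ℝ) :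
    (x, y) ∈ B ↔ y ≤ a ∧ x + (n - 1) * y ≤ a * n + b ∧ a * n + a + b - x - n * y < l := by
  rw [H.mem_iff_right tripleThreeA_ε (by simpa [tripleThreeA] using hb) (by simp [det])
    (eventually_tripleThreeA_top ha hb hn h), tripleThreeA_bendRight, if_neg (by simp [hf])]
  simp [cornerTriangle, coordA, coordB]
  constructor
  · rintro ⟨h1, h2, h3⟩; refine ⟨?_, ?_, ?_⟩ <;> linarith
  · rintro ⟨h1, h2, h3⟩; refine ⟨?_, ?_, ?_⟩ <;> linarith

theorem tripleThreeA_top_mem_flip (ha : 0 < a) (hb : 0 ≤ b) (hn : 1 ≤ n) (hf : f 0 = -1)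
    (H : (tripleThreeA a b h n).IsCornerTriangle f (a + b, a) B l) (x y : ℝ) :
    (x, y) ∈ B ↔ y + max (x - a) 0 ≤ x ∧
      (n - 1) * (y + max (x - a) 0) - a - b ≤ (n - 2) * x ∧
      (n - 1) * x - n * (y + max (x - a) 0) + a + b < l := by
  rw [H.mem_iff (by simp [det]) (eventually_tripleThreeA_top_flip ha hb hn h hf),
    tripleThreeA_unfold hf, tripleThreeA_unfold hf, max_eq_left (by linarith : 0 ≤ a + b - a)]
  simp [cornerTriangle, coordA, coordB]
  constructor
  · rintro ⟨h1, h2, h3⟩; refine ⟨?_, ?_, ?_⟩ <;> linarith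
  · rintro ⟨h1, h2, h3⟩; refine ⟨?_, ?_, ?_⟩ <;> linarith

/-! ### Type (3a): constraints on the sizes -/

theorem tripleThreeA_left_le (ha : 0 < a) (hb : 0 ≤ b) (hn : 1 ≤ n)
    (H : (tripleThreeA a b h n).IsCornerTriangle f (0, 0) B l) : l ≤ a := by
  by_contra! hc
  obtain ⟨t, ht, htl⟩ := exists_between hc
  have h1 : (t, 0 - (tripleThreeA a b h n).bendLeft f t) ∈ B := by
    rw [tripleThreeA_left_mem ha hb hn H]; refine ⟨?_, ?_, ?_⟩ <;> linarith
  have h2 : (t, t - (tripleThreeA a b h n).bendLeft f t) ∈ B := by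
    rw [tripleThreeA_left_mem ha hb hn H]; refine ⟨?_, ?_, ?_⟩ <;> linarith
  have h1 := H.subset h1
  have h2 := H.subset h2
  rw [mem_tripleThreeA ha hb hn] at h1 h2
  linarith [h1.1, h2.2.2.1]

theorem tripleThreeA_left_edges (ha : 0 < a) (hb : 0 ≤ b) (hn : 1 ≤ n)
    (H : (tripleThreeA a b h n).IsCornerTriangle f (0, 0) B l) (t : ℝ) (ht : 0 ≤ t) (htl : t < l) :
    (t, 0) ∈ B ∧ (t, min t a) ∈ B := by
  have hl := tripleThreeA_left_le ha hb hn H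
  rw [tripleThreeA_left_mem ha hb hn H, tripleThreeA_left_mem ha hb hn H,
    Triple.bendLeft_eq_zero f (by simp [tripleThreeA]; linarith), min_eq_left (by linarith)]
  simpa [ht] using htl

/-- The right edge has lattice length `a`, which bounds the size in all cases. Without reversal the
top edge, of length `b`, bounds it too. -/
theorem tripleThreeA_top_le (ha : 0 < a) (hb : 0 ≤ b) (hn : 1 ≤ n) (hh' : h < a)
    (H : (tripleThreeA a b h n).IsCornerTriangle f (a + b, a) B l) :
    l ≤ a ∧ l ≤ a + b ∧ (f 0 = 1 → l ≤ b) := by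
  have hn' : (1 : ℝ) ≤ n := by exact_mod_cast hn
  have key : l ≤ a := by
    by_contra! hc
    obtain ⟨t, ht, htl⟩ := exists_between hc
    have hnt := mul_nonneg (sub_nonneg.2 hn') (ha.trans ht).le
    have h1 : (a + b + (n - 1) * t, a - t) ∈ B := by
      rcases Int.units_eq_one_or (f 0) with hf | hf
      -- For `b = 0` the apex is the end of the cut, which must then be reversed.
      · have hb : 0 < b := by
          refine hb.lt_of_ne' fun h0 => ?_
          subst h0
          rw [add_zero] at H
          simp [tripleThreeA_flip_of_apex hh' H] at hf
        rw [tripleThreeA_top_mem ha hb hn hf H]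
        refine ⟨?_, ?_, ?_⟩ <;> linarith
      · rw [tripleThreeA_top_mem_flip ha hb hn hf H, max_eq_left (by linarith)]
        refine ⟨?_, ?_, ?_⟩ <;> linarith
    have := H.subset h1
    rw [mem_tripleThreeA ha hb hn] at this
    linarith [this.1]
  refine ⟨key, by linarith, fun hf => ?_⟩
  have hb : 0 < b := by
    refine hb.lt_of_ne' fun h0 => ?_
    subst h0
    rw [add_zero] at H
    simp [tripleThreeA_flip_of_apex hh' H] at hf
  by_contra! hc
  obtain ⟨t, ht, htl⟩ := exists_between hc
  have h1 : (a + b - t, a) ∈ B := by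
    rw [tripleThreeA_top_mem ha hb hn hf H]
    refine ⟨?_, ?_, ?_⟩ <;> linarith
  have := H.subset h1
  rw [mem_tripleThreeA ha hb.le hn] at this
  linarith [this.2.1]

theorem tripleThreeA_top_edges (ha : 0 < a) (hb : 0 ≤ b) (hn : 1 ≤ n) (hh' : h < a)
    (H : (tripleThreeA a b h n).IsCornerTriangle f (a + b, a) B l) (t : ℝ) (ht : 0 ≤ t)
    (htl : t < l) :
    (a + b + (n - 1) * t, a - t) ∈ B ∧ (a + b - t, min (a + b - t) a) ∈ B := by
  have hn' : (1 : ℝ) ≤ n := by exact_mod_cast hn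
  have hl := tripleThreeA_top_le ha hb hn hh' H
  have hnt := mul_nonneg (sub_nonneg.2 hn') ht
  rcases Int.units_eq_one_or (f 0) with hf | hf
  · have hlb := hl.2.2 hf
    have hb : 0 < b := by linarith
    rw [tripleThreeA_top_mem ha hb hn hf H, tripleThreeA_top_mem ha hb hn hf H,
      min_eq_right (by linarith)]
    refine ⟨⟨?_, ?_, ?_⟩, ?_, ?_, ?_⟩ <;> linarith
  · rw [tripleThreeA_top_mem_flip ha hb hn hf H, tripleThreeA_top_mem_flip ha hb hn hf H,
      max_eq_left (by linarith : 0 ≤ a + b + (n - 1) * t - a)]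
    -- The top edge followed by the left edge becomes the straight segment from `(a + b, a + b)` to
    -- the origin, of lattice length `a + b`.
    have : min (a + b - t) a + max (a + b - t - a) 0 = a + b - t := by
      rcases le_total (a + b - t) a with h | h
      · rw [min_eq_left h, max_eq_right (by linarith)]; simp
      · rw [min_eq_right h, max_eq_left (by linarith)]; ring
    rw [this]
    refine ⟨⟨?_, ?_, ?_⟩, ?_, ?_, ?_⟩ <;> linarith

/-- The first bound follows the right edge, which a reversal may prolong to the left of `a`, but not
beyond the line `y = x`. The second follows the bottom edge, which a reversal bends below the axis.
-/
theorem tripleThreeA_right_le (ha : 0 < a) (hb : 0 ≤ b) (hn : 1 ≤ n) (hab : a < a * n + b)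
    (H : (tripleThreeA a b h n).IsCornerTriangle f (a * n + b, 0) B l) :
    l ≤ a ∧ (f 0 = -1 → l ≤ a * n + b - a) := by
  have hn' : (1 : ℝ) ≤ n := by exact_mod_cast hn
  constructor
  · by_contra! hc
    obtain ⟨t, ht, htl⟩ := exists_between hc
    obtain ⟨x, hx⟩ : ∃ x, x = a * n + b - (n - 1) * t := ⟨_, rfl⟩
    have h1 : (x, t - (tripleThreeA a b h n).bendRight f x) ∈ B := by
      rw [tripleThreeA_right_mem ha hb hn hab H]; refine ⟨?_, ?_, ?_⟩ <;> linarith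
    have h1 := H.subset h1
    rw [mem_tripleThreeA ha hb hn, tripleThreeA_bendRight] at h1
    split_ifs at h1
    · have h2 := h1.2.1
      have h3 := h1.2.2.1
      rcases le_total x a with h | h
      · rw [max_eq_left (by linarith)] at h2; linarith
      · rw [max_eq_right (by linarith)] at h3; linarith
    · linarith [h1.2.2.1]
  · intro hf
    by_contra! hc
    obtain ⟨t, ht, htl⟩ := exists_between hc
    have h1 : (a * n + b - t, 0 - (tripleThreeA a b h n).bendRight f (a * n + b - t)) ∈ B := by
      rw [tripleThreeA_right_mem ha hb hn hab H]; refine ⟨?_, ?_, ?_⟩ <;> linarith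
    have h1 := H.subset h1
    rw [mem_tripleThreeA ha hb hn, tripleThreeA_bendRight, if_pos hf, max_eq_left (by linarith)]
      at h1
    linarith [h1.1]

theorem tripleThreeA_right_edges (ha : 0 < a) (hb : 0 ≤ b) (hn : 1 ≤ n) (hab : a < a * n + b)
    (H : (tripleThreeA a b h n).IsCornerTriangle f (a * n + b, 0) B l) (t : ℝ) (ht : 0 ≤ t)
    (htl : t < l) :
    (a * n + b - (n - 1) * t, t) ∈ B ∧ (a * n + b - t, 0) ∈ B := by
  have hn' : (1 : ℝ) ≤ n := by exact_mod_cast hn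
  have hl := tripleThreeA_right_le ha hb hn hab H
  have hnt := mul_nonneg (sub_nonneg.2 hn') (sub_nonneg.2 (htl.le.trans hl.1))
  rw [tripleThreeA_right_mem ha hb hn hab H, tripleThreeA_right_mem ha hb hn hab H,
    Triple.bendRight_eq_zero (x := a * n + b - (n - 1) * t) f (by simp [tripleThreeA]; linarith)]
  have h0 : (tripleThreeA a b h n).bendRight f (a * n + b - t) = 0 := by
    rw [tripleThreeA_bendRight]
    split_ifs with hf
    · exact max_eq_right (by linarith [hl.2 hf])
    · rfl
  rw [h0]
  refine ⟨⟨?_, ?_, ?_⟩, ?_, ?_, ?_⟩ <;> linarith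

/-- The three sums come from the right edge, the straightened union of the left and top edges, and
the bottom edge. Absent triangles enter with size 0. -/
theorem tripleThreeA_constraints (ha : 0 < a) (hb : 0 ≤ b) (hn : 1 ≤ n) (hab : a < a * n + b)
    (hh' : h < a) {𝓑 : ℝ × ℝ → Set (ℝ × ℝ)} {Λ : ℝ × ℝ → ℝ}
    (H : (tripleThreeA a b h n).IsCornerFamily 𝓑 Λ) :
    0 ≤ Λ (0, 0) ∧ 0 ≤ Λ (a + b, a) ∧ 0 ≤ Λ (a * n + b, 0) ∧ Λ (0, 0) ≤ a ∧
      Λ (a + b, a) + Λ (a * n + b, 0) ≤ a ∧ Λ (0, 0) + Λ (a + b, a) ≤ a + b ∧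
      Λ (0, 0) + Λ (a * n + b, 0) ≤ a * n + b := by
  have hn' : (1 : ℝ) ≤ n := by exact_mod_cast hn
  obtain ⟨H, hd⟩ := H
  have h1 : 0 ≤ Λ (0, 0) ∧ Λ (0, 0) ≤ a ∧ ∀ t, 0 ≤ t → t < Λ (0, 0) →
      (t, 0) ∈ 𝓑 (0, 0) ∧ (t, min t a) ∈ 𝓑 (0, 0) := by
    rcases H (0, 0) with ⟨h0, -⟩ | ⟨f, H⟩
    · rw [h0]; exact ⟨le_rfl, ha.le, fun t h1 h2 => absurd h1 (not_le.2 h2)⟩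
    · exact ⟨H.pos.le, tripleThreeA_left_le ha hb hn H, tripleThreeA_left_edges ha hb hn H⟩
  have h2 : 0 ≤ Λ (a + b, a) ∧ Λ (a + b, a) ≤ a ∧ ∀ t, 0 ≤ t → t < Λ (a + b, a) →
      (a + b + (n - 1) * t, a - t) ∈ 𝓑 (a + b, a) ∧
        (a + b - t, min (a + b - t) a) ∈ 𝓑 (a + b, a) := by
    rcases H (a + b, a) with ⟨h0, -⟩ | ⟨f, H⟩
    · rw [h0]; exact ⟨le_rfl, ha.le, fun t h1 h2 => absurd h1 (not_le.2 h2)⟩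
    · exact ⟨H.pos.le, (tripleThreeA_top_le ha hb hn hh' H).1,
        tripleThreeA_top_edges ha hb hn hh' H⟩
  have h3 : 0 ≤ Λ (a * n + b, 0) ∧ Λ (a * n + b, 0) ≤ a ∧ ∀ t, 0 ≤ t → t < Λ (a * n + b, 0) →
      (a * n + b - (n - 1) * t, t) ∈ 𝓑 (a * n + b, 0) ∧
        (a * n + b - t, 0) ∈ 𝓑 (a * n + b, 0) := by
    rcases H (a * n + b, 0) with ⟨h0, -⟩ | ⟨f, H⟩
    · rw [h0]; exact ⟨le_rfl, ha.le, fun t h1 h2 => absurd h1 (not_le.2 h2)⟩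
    · exact ⟨H.pos.le, (tripleThreeA_right_le ha hb hn hab H).1,
        tripleThreeA_right_edges ha hb hn hab H⟩
  refine ⟨h1.1, h2.1, h3.1, h1.2.1, ?_, ?_, ?_⟩
  · refine add_le_of_disjoint_edge (hd (a + b, a) (a * n + b, 0) (by simp [ha.ne'])) h2.2.1 h3.2.1
      (fun t => (a + b + (n - 1) * t, a - t)) (fun t h h' => (h2.2.2 t h h').1) fun t h h' => ?_
    convert (h3.2.2 t h h').1 using 2 <;> ring
  · refine add_le_of_disjoint_edge (hd (0, 0) (a + b, a) (by simp [ha.ne])) (by linarith) (by linarith)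
      (fun t => (t, min t a)) (fun t h h' => (h1.2.2 t h h').2) fun t h h' => (h2.2.2 t h h').2
  · refine add_le_of_disjoint_edge (hd (0, 0) (a * n + b, 0) (by simp; linarith)) (by linarith) (by linarith)
      (fun t => (t, 0)) (fun t h h' => (h1.2.2 t h h').1) fun t h h' => (h3.2.2 t h h').2

/-! ### Type (3a): explicit packings without reversed cuts -/

theorem tripleThreeA_isPackedTriangle_left (ha : 0 < a) (hb : 0 ≤ b) (hn : 1 ≤ n) :
    (tripleThreeA a b h n).IsPackedTriangle (0, 0) (cornerTriangle (1, 0) (1, 1) (0, 0) a) := by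
  have hn' : (1 : ℝ) ≤ n := by exact_mod_cast hn
  refine Triple.isPackedTriangle_of_one (by simp [det]) ha (by simp [tripleThreeA]; linarith)
    (eventually_tripleThreeA_left ha hb hn h) ?_ ?_ ?_
  · rintro ⟨x, y⟩ hq
    rw [mem_tripleThreeA ha hb hn] at hq
    simp [corner, coordA, coordB]
    constructor <;> linarith
  · rintro ⟨x, y⟩ hq
    simp [cornerTriangle, coordA, coordB] at hq
    obtain ⟨h1, h2, h3⟩ := hq
    have := mul_nonneg (sub_nonneg.2 hn') (by linarith : 0 ≤ a - y)
    rw [mem_tripleThreeA ha hb hn]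
    refine ⟨?_, ?_, ?_, ?_⟩ <;> linarith
  · intro i hq
    simp [tripleThreeA, cornerTriangle, coordA, coordB] at hq

/-- The alternative `hnl` is what keeps the right triangle strictly to the right of the vertical
line through the marked point. -/
theorem lt_of_mem_cornerTriangle_right (hb : 0 ≤ b) (hn : 1 ≤ n) (hl : l ≤ a)
    (hnl : 2 ≤ n ∨ l ≤ b) {x y : ℝ}
    (hq : (x, y) ∈ cornerTriangle (1 - n, 1) (-1, 0) (a * n + b, 0) l) :
    0 ≤ y ∧ y < l ∧ a < x ∧ x + (n - 1) * y ≤ a * n + b ∧ a * n + b - x - (n - 2) * y < l := by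
  have hn' : (1 : ℝ) ≤ n := by exact_mod_cast hn
  simp [cornerTriangle, coordA, coordB] at hq
  obtain ⟨h1, h2, h3⟩ := hq
  have h4 : y < l := by linarith
  refine ⟨h1, h4, ?_, by linarith, by linarith⟩
  rcases hnl with h5 | h5
  · have h5' : (2 : ℝ) ≤ n := by exact_mod_cast h5
    have := mul_nonneg (sub_nonneg.2 h5') (by linarith : 0 ≤ a - y)
    linarith
  · have := mul_nonneg (sub_nonneg.2 hn') (by linarith : 0 ≤ a - y)
    linarith

theorem tripleThreeA_isPackedTriangle_right (ha : 0 < a) (hb : 0 ≤ b) (hn : 1 ≤ n)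
    (hl0 : 0 < l) (hl : l ≤ a) (hnl : 2 ≤ n ∨ l ≤ b) :
    (tripleThreeA a b h n).IsPackedTriangle (a * n + b, 0)
      (cornerTriangle (1 - n, 1) (-1, 0) (a * n + b, 0) l) := by
  have hn' : (1 : ℝ) ≤ n := by exact_mod_cast hn
  have hab : a < a * n + b := by
    rcases hnl with h5 | h5
    · have h5' : (2 : ℝ) ≤ n := by exact_mod_cast h5
      have := mul_nonneg (sub_nonneg.2 h5') ha.le
      linarith
    · have := mul_nonneg (sub_nonneg.2 hn') ha.le
      linarith
  refine Triple.isPackedTriangle_of_one (by simp [det]) hl0 (by simpa [tripleThreeA] using hab.ne')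
    (eventually_tripleThreeA_right ha hb hn h) ?_ ?_ ?_
  · rintro ⟨x, y⟩ hq
    rw [mem_tripleThreeA ha hb hn] at hq
    simp [corner, coordA, coordB]
    constructor <;> linarith
  · rintro ⟨x, y⟩ hq
    obtain ⟨h1, h2, h3, h4, h5⟩ := lt_of_mem_cornerTriangle_right hb hn hl hnl hq
    rw [mem_tripleThreeA ha hb hn]
    refine ⟨?_, ?_, ?_, ?_⟩ <;> linarith
  · intro i hq
    have := lt_of_mem_cornerTriangle_right (x := a) (y := h) hb hn hl hnl
      (by simpa [tripleThreeA] using hq)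
    linarith [this.2.2.1]

theorem lt_of_mem_cornerTriangle_left {x y : ℝ}
    (hq : (x, y) ∈ cornerTriangle (1, 0) (1, 1) (0, 0) l) : 0 ≤ y ∧ y ≤ x ∧ x < l := by
  simp [cornerTriangle, coordA, coordB] at hq
  exact ⟨hq.2.1, hq.1, hq.2.2⟩

theorem tripleThreeA_exists_isPacking_two (ha : 0 < a) (hb : 0 ≤ b) (hn : 1 ≤ n)
    (hab : 2 ≤ n ∨ a ≤ b) :
    ∃ P, (tripleThreeA a b h n).IsPacking P ∧ area P = (2 * a ^ 2) / 2 := by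
  refine Triple.exists_isPacking (d := 2) (p := ![(0, 0), (a * n + b, 0)])
    (B := ![cornerTriangle (1, 0) (1, 1) (0, 0) a,
      cornerTriangle (1 - n, 1) (-1, 0) (a * n + b, 0) a]) (l := ![a, a]) ?_ ?_ ?_ ?_ ?_
      (by simp; ring)
  · intro i; fin_cases i
    · exact tripleThreeA_isPackedTriangle_left ha hb hn
    · exact tripleThreeA_isPackedTriangle_right ha hb hn ha le_rfl hab
  · intro i j hij
    fin_cases i <;> fin_cases j <;> simp at hij
    refine disjoint_left.2 ?_
    rintro ⟨x, y⟩ h1 h2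
    have h1 := lt_of_mem_cornerTriangle_left h1
    have h2 := lt_of_mem_cornerTriangle_right hb hn le_rfl hab h2
    linarith [h1.2.2, h2.2.2.1]
  · intro i; fin_cases i <;> exact measurableSet_cornerTriangle _ _ _ _
  · intro i; fin_cases i <;> exact ha
  · intro i; fin_cases i <;> exact area_cornerTriangle (by simp [det]) _ ha.le

theorem lt_of_mem_cornerTriangle_top {x y : ℝ}
    (hq : (x, y) ∈ cornerTriangle (-1, 0) (0, -1) (a + b, a) l) :
    y ≤ a ∧ x ≤ a + b ∧ 2 * a + b - l < x + y := by
  simp [cornerTriangle, coordA, coordB] at hq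
  refine ⟨?_, ?_, ?_⟩ <;> linarith [hq.1, hq.2.1, hq.2.2]

theorem tripleThreeA_isPackedTriangle_top (ha : 0 < a) (hb : 0 < b) (hh' : h < a) (hl0 : 0 < l)
    (hl : l ≤ b) (hla : l ≤ a) :
    (tripleThreeA a b h 1).IsPackedTriangle (a + b, a)
      (cornerTriangle (-1, 0) (0, -1) (a + b, a) l) := by
  refine Triple.isPackedTriangle_of_one (by simp [det]) hl0
    (by simpa [tripleThreeA] using hb.ne')
    (by simpa using eventually_tripleThreeA_top ha hb le_rfl h) ?_ ?_ ?_
  · rintro ⟨x, y⟩ hq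
    rw [mem_tripleThreeA ha hb.le le_rfl] at hq
    norm_num at hq
    simp [corner, coordA, coordB]
    constructor <;> linarith
  · rintro ⟨x, y⟩ hq
    obtain ⟨h1, h2, h3⟩ := lt_of_mem_cornerTriangle_top hq
    rw [mem_tripleThreeA ha hb.le le_rfl]
    norm_num
    refine ⟨?_, ?_, ?_, ?_⟩ <;> linarith
  · intro i hq
    have := lt_of_mem_cornerTriangle_top (x := a) (y := h) (by simpa [tripleThreeA] using hq)
    linarith [this.2.2]

/-- The right edge, of length `a`, is shared by sizes `b` and `l`, while the top edge leaves room
for `l ≤ b` beside the triangle of size `a` at the origin. -/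
theorem tripleThreeA_exists_isPacking_three (ha : 0 < a) (hb : 0 < b) (hh' : h < a) (hl0 : 0 < l)
    (hl : l ≤ b) (hla : l + b ≤ a) :
    ∃ P, (tripleThreeA a b h 1).IsPacking P ∧ area P = (a ^ 2 + b ^ 2 + l ^ 2) / 2 := by
  refine Triple.exists_isPacking (d := 3) (p := ![(0, 0), (a * (1 : ℤ) + b, 0), (a + b, a)])
    (B := ![cornerTriangle (1, 0) (1, 1) (0, 0) a,
      cornerTriangle (1 - 1, 1) (-1, 0) (a * (1 : ℤ) + b, 0) b,
      cornerTriangle (-1, 0) (0, -1) (a + b, a) l]) (l := ![a, b, l]) ?_ ?_ ?_ ?_ ?_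
      (by simp [Fin.sum_univ_three])
  · intro i; fin_cases i
    · exact tripleThreeA_isPackedTriangle_left ha hb.le le_rfl
    · exact tripleThreeA_isPackedTriangle_right ha hb.le le_rfl hb (by linarith) (Or.inr le_rfl)
    · exact tripleThreeA_isPackedTriangle_top ha hb hh' hl0 hl (by linarith)
  · have key : ∀ x y, (x, y) ∈ cornerTriangle (1 - 1, 1) (-1, 0) (a * (1 : ℤ) + b, 0) b →
        0 ≤ y ∧ y < b ∧ a < x ∧ x ≤ a + b ∧ a + y < x := by
      intro x y hq
      have := lt_of_mem_cornerTriangle_right hb.le le_rfl (by linarith) (Or.inr le_rfl) hq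
      norm_num at this
      refine ⟨?_, ?_, ?_, ?_, ?_⟩ <;> linarith
    intro i j hij
    refine disjoint_left.2 ?_
    rintro ⟨x, y⟩ h1 h2
    fin_cases i <;> fin_cases j <;> simp at hij
    · have h1 := lt_of_mem_cornerTriangle_left h1
      have h2 := key x y h2
      linarith [h1.2.2, h2.2.2.1]
    · have h1 := lt_of_mem_cornerTriangle_left h1
      have h2 := lt_of_mem_cornerTriangle_top h2
      linarith [h1.2.2, h1.2.1, h2.2.2]
    · have h1 := key x y h1
      have h2 := lt_of_mem_cornerTriangle_top h2
      linarith [h1.2.2.2, h2.2.2]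
  · intro i; fin_cases i <;> exact measurableSet_cornerTriangle _ _ _ _
  · intro i; fin_cases i
    · exact ha
    · exact hb
    · exact hl0
  · intro i; fin_cases i
    · exact area_cornerTriangle (by simp [det]) _ ha.le
    · exact area_cornerTriangle (by simp [det]) _ hb.le
    · exact area_cornerTriangle (by simp [det]) _ hl0.le

end TypeThreeA

/-! ### The quadratic maximisation problems of types (3a) and (3b) -/

theorem sum_sq_le_of_add_le {a u q w : ℝ} (hu : 0 ≤ u) (hq : 0 ≤ q) (hw : 0 ≤ w) (hua : u ≤ a)
    (hqw : q + w ≤ a) : u ^ 2 + q ^ 2 + w ^ 2 ≤ 2 * a ^ 2 := by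
  have h1 := pow_le_pow_left₀ hu hua 2
  have h2 := pow_le_pow_left₀ (add_nonneg hq hw) hqw 2
  nlinarith [mul_nonneg hq hw]

/-- The constraints are those for `n = 1`, symmetric in `q` and `w`. If the larger one `q` is at
most `b`, then `q ^ 2 + w ^ 2` is largest at `(b, a - b)`. If `q ≥ b`, then `u ≤ a + b - q` and `w ≤
a - q` bound the sum by a convex function of `q` on `[b, a]`, whose value at `b` is the maximum. -/
theorem sum_sq_le_of_lt {a b u q w : ℝ} (hb : 0 < b) (hu : 0 ≤ u) (hq : 0 ≤ q) (hw : 0 ≤ w)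
    (hua : u ≤ a) (hqw : q + w ≤ a) (huq : u + q ≤ a + b) (huw : u + w ≤ a + b) (hab : b ≤ a)
    (hab' : a ≤ 2 * b) : u ^ 2 + q ^ 2 + w ^ 2 ≤ a ^ 2 + b ^ 2 + (a - b) ^ 2 := by
  wlog h : w ≤ q generalizing q w
  · have := this hw hq (by linarith) huw huq (by linarith)
    linarith
  rcases le_total q b with hqb | hqb
  · have h1 := pow_le_pow_left₀ hu hua 2
    rcases le_total (q + w) b with h2 | h2
    · nlinarith [mul_nonneg hq hw, sq_nonneg (a - b)]
    · nlinarith [mul_nonneg (sub_nonneg.2 hqb) (by linarith : 0 ≤ b - w),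
        mul_nonneg (sub_nonneg.2 hqw) (by linarith : 0 ≤ q + w - (2 * b - a))]
  · have h1 := pow_le_pow_left₀ hu (by linarith : u ≤ a + b - q) 2
    have h2 := pow_le_pow_left₀ hw (by linarith : w ≤ a - q) 2
    nlinarith [mul_nonneg (sub_nonneg.2 hqb) (by linarith : 0 ≤ a - q)]

/-- Now `q = w = b` is compatible with `q + w ≤ a`. For `q ≥ b` one has `u ≤ a + b - q`, and `w` is
at most `q` below `a / 2` and at most `a - q` above. Both bounds are convex in `q`, so the endpoints
`b`, `a / 2`, `a` decide; at `a / 2` the comparison is `(a / 2 - b) ^ 2 ≥ 0`. -/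
theorem sum_sq_le_of_two_mul_le {a b u q w : ℝ} (hb : 0 < b) (hu : 0 ≤ u) (hq : 0 ≤ q)
    (hw : 0 ≤ w) (hua : u ≤ a) (hqw : q + w ≤ a) (huq : u + q ≤ a + b) (huw : u + w ≤ a + b)
    (hab : 2 * b ≤ a) : u ^ 2 + q ^ 2 + w ^ 2 ≤ a ^ 2 + 2 * b ^ 2 := by
  wlog h : w ≤ q generalizing q w
  · have := this hw hq (by linarith) huw huq (by linarith)
    linarith
  rcases le_total q b with hqb | hqb
  · have h1 := pow_le_pow_left₀ hu hua 2
    have h2 := pow_le_pow_left₀ hq hqb 2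
    have h3 := pow_le_pow_left₀ hw (h.trans hqb) 2
    linarith
  · have h1 := pow_le_pow_left₀ hu (by linarith : u ≤ a + b - q) 2
    rcases le_total q (a / 2) with hqa | hqa
    · have h2 := pow_le_pow_left₀ hw h 2
      nlinarith [mul_nonneg (sub_nonneg.2 hqb) (sub_nonneg.2 hqa), sq_nonneg (a / 2 - b),
        mul_nonneg (sub_nonneg.2 hqb) (sub_nonneg.2 hab)]
    · have h2 := pow_le_pow_left₀ hw (by linarith : w ≤ a - q) 2
      nlinarith [mul_nonneg (sub_nonneg.2 hqa) (by linarith : 0 ≤ a - q), sq_nonneg (a / 2 - b),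
        mul_nonneg (by linarith : 0 ≤ a - q) (sub_nonneg.2 hab)]

/-- The geometry is separated from the optimisation: each case of type (3a) supplies its own `K`
with an upper bound and a packing attaining it. -/
theorem packingDensity_minimalThreeA (a b h : ℝ) (n : ℤ) (ha : 0 < a) (hb : 0 < b) (hh : 0 < h)
    (hh' : h < a) (hn : 1 ≤ n) {K : ℝ}
    (hK : ∀ u q w : ℝ, 0 ≤ u → 0 ≤ q → 0 ≤ w → u ≤ a → q + w ≤ a → u + q ≤ a + b →
      u + w ≤ a * n + b → u ^ 2 + q ^ 2 + w ^ 2 ≤ K)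
    (hex : ∃ P, (tripleThreeA a b h n).IsPacking P ∧ area P = K / 2) :
    packingDensity (minimalThreeA a b h n ha hb hh hh' hn).semitoricPolygon =
      K / ((n * a + 2 * b) * a) := by
  have hn' : (1 : ℝ) ≤ n := by exact_mod_cast hn
  have hab : a < a * n + b := by nlinarith
  rw [packingDensity_eq (minimalThreeA a b h n ha hb hh hh' hn)
    (w := ![(0, 0), (a + b, a), (a * n + b, 0)]) (K := K) ?_ ?_ ?_ hex]
  · change _ / area (tripleThreeA a b h n).Δ = _
    rw [area_tripleThreeA ha hb.le hn, div_div_div_cancel_right₀ two_ne_zero]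
    congr 1; ring
  · intro i j; fin_cases i <;> fin_cases j <;> simp <;> intros <;> linarith
  · intro f p B l H
    rcases tripleThreeA_apex ha hb hn hh hh' H with rfl | rfl | rfl
    · exact ⟨0, rfl⟩
    · exact ⟨1, rfl⟩
    · exact ⟨2, rfl⟩
  · intro 𝓑 Λ H
    obtain ⟨h1, h2, h3, h4, h5, h6, h7⟩ := tripleThreeA_constraints ha hb.le hn hab hh' H
    simpa [Fin.sum_univ_three] using hK _ _ _ h1 h2 h3 h4 h5 h6 h7

theorem tripleThreeB_apex {a h : ℝ} {n : ℤ} {f : Fin 1 → ℤˣ} {p : ℝ × ℝ} {B : Set (ℝ × ℝ)} {l : ℝ}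
    (ha : 0 < a) (hh : 0 < h) (hh' : h < a) (hn : 2 ≤ n)
    (H : (tripleThreeB a h n).IsCornerTriangle f p B l) :
    p = (0, 0) ∨ p = (a, a) ∨ p = (a * n, 0) := by
  simpa using extremePoints_convexHull_subset
    (H.isVertex (isRepresentative_tripleThreeB ha hh hh' hn))

theorem packingDensity_minimalThreeB (a h : ℝ) (n : ℤ) (ha : 0 < a) (hh : 0 < h) (hh' : h < a)
    (hn : 2 ≤ n) :
    packingDensity (minimalThreeB a h n ha hh hh' hn).semitoricPolygon = 2 / n := by
  have hn' : (2 : ℝ) ≤ n := by exact_mod_cast hn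
  have hn1 : 1 ≤ n := by omega
  have hab : a < a * n + 0 := by nlinarith
  have hex := tripleThreeA_exists_isPacking_two (h := h) ha le_rfl hn1 (Or.inl hn)
  rw [← tripleThreeB_eq] at hex
  rw [packingDensity_eq (minimalThreeB a h n ha hh hh' hn)
    (w := ![(0, 0), (a, a), (a * n, 0)]) (K := 2 * a ^ 2) ?_ ?_ ?_ hex]
  · change _ / area (tripleThreeB a h n).Δ = _
    rw [tripleThreeB_eq, area_tripleThreeA ha le_rfl hn1]
    have : (n : ℝ) ≠ 0 := by linarith
    field_simp
    ring
  · intro i j; fin_cases i <;> fin_cases j <;> simp [ha.ne, ha.ne'] <;> omega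
  · intro f p B l H
    rcases tripleThreeB_apex ha hh hh' hn H with rfl | rfl | rfl
    · exact ⟨0, rfl⟩
    · exact ⟨1, rfl⟩
    · exact ⟨2, rfl⟩
  · intro 𝓑 Λ H
    change (tripleThreeB a h n).IsCornerFamily 𝓑 Λ at H
    rw [tripleThreeB_eq] at H
    obtain ⟨h1, h2, h3, h4, h5, -⟩ := tripleThreeA_constraints ha le_rfl hn1 hab hh' H
    have := sum_sq_le_of_add_le h1 h2 h3 h4 h5
    simpa [Fin.sum_univ_three] using this

/-! ### Type (3c) -/

theorem mem_tripleThreeC {a b : ℝ} {n : ℤ} (ha : 0 < a) (hb : b < 0) (hab : -a < b) (hn : 2 ≤ n)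
    (h x y : ℝ) : (x, y) ∈ (tripleThreeC a b h n).Δ ↔
      0 ≤ y ∧ y ≤ x ∧ (2 - n) * x + (n - 1) * y ≤ a + b ∧ x + (n - 1) * y ≤ a * n + b := by
  simp only [tripleThreeC, hullThreeC ha hb hab hn, halfPlanes, mem_ofPred_eq, Fin.forall_fin_succ]
  simp

theorem area_tripleThreeC {a b : ℝ} {n : ℤ} (ha : 0 < a) (hb : b < 0) (hab : -a < b) (hn : 2 ≤ n)
    (h : ℝ) : area (tripleThreeC a b h n).Δ = (n * a + 2 * b) * a / 2 := by
  have hn' : (2 : ℝ) ≤ n := by exact_mod_cast hn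
  obtain ⟨k, hk⟩ : ∃ k : ℝ, k = n - 1 := ⟨_, rfl⟩
  have hk1 : 1 ≤ k := by linarith
  have hk0 : k ≠ 0 := by linarith
  have hnk : (n : ℝ) = k + 1 := by linarith
  have hak := mul_nonneg ha.le (sub_nonneg.2 hk1)
  -- The upper boundary is the minimum of the lines carrying the three upper edges; the breakpoints
  -- are `a + b` and `a`.
  let w : ℝ → ℝ := fun x => min x (min (((k - 1) / k) * x + (a + b) / k)
    ((-1 / k) * x + (a * n + b) / k))
  have hw : Continuous w := by fun_prop
  have hmem : ∀ x y, (x, y) ∈ (tripleThreeC a b h n).Δ ↔ 0 ≤ y ∧ y ≤ w x := by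
    intro x y
    have hkpos : 0 < k := by linarith
    have e2 : y ≤ ((k - 1) / k) * x + (a + b) / k ↔ (2 - n) * x + (n - 1) * y ≤ a + b := by
      rw [← mul_div_right_comm, ← add_div, le_div_iff₀ hkpos, hnk]
      constructor <;> intro <;> linarith
    have e3 : y ≤ (-1 / k) * x + (a * n + b) / k ↔ x + (n - 1) * y ≤ a * n + b := by
      rw [← mul_div_right_comm, ← add_div, le_div_iff₀ hkpos, hnk]
      constructor <;> intro <;> linarith
    rw [mem_tripleThreeC ha hb hab hn, le_min_iff, le_min_iff, e2, e3]
  have hs : ∀ x, Prod.mk x ⁻¹' (tripleThreeC a b h n).Δ = Icc 0 (w x) := by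
    intro x; ext y; simp [hmem]
  have hcl : MeasurableSet (tripleThreeC a b h n).Δ := by
    simp only [tripleThreeC, hullThreeC ha hb hab hn]
    exact (isClosed_halfPlanes _ _).measurableSet
  have hkpos : 0 < k := by linarith
  have p2 : ∀ x, ((k - 1) / k) * x + (a + b) / k = ((k - 1) * x + (a + b)) / k := fun x => by
    field_simp
  have p3 : ∀ x, (-1 / k) * x + (a * n + b) / k = (a * n + b - x) / k := fun x => by
    field_simp; ring
  have w1 : ∀ x ∈ uIcc 0 (a + b), w x = 1 * x + 0 := by
    intro x hx
    rw [uIcc_of_le (by linarith)] at hx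
    have h1 : x ≤ ((k - 1) / k) * x + (a + b) / k := by
      rw [p2, le_div_iff₀ hkpos]; linarith [hx.2]
    have h2 : x ≤ (-1 / k) * x + (a * n + b) / k := by
      rw [p3, le_div_iff₀ hkpos, hnk]
      have := mul_le_mul_of_nonneg_left (hx.2.trans (by linarith : a + b ≤ a)) hkpos.le
      linarith [hx.2]
    simp only [w, min_eq_left (le_min h1 h2), one_mul, add_zero]
  have w2 : ∀ x ∈ uIcc (a + b) a, w x = ((k - 1) / k) * x + (a + b) / k := by
    intro x hx
    rw [uIcc_of_le (by linarith)] at hx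
    have h1 : ((k - 1) / k) * x + (a + b) / k ≤ x := by
      rw [p2, div_le_iff₀ hkpos]; linarith [hx.1]
    have h2 : ((k - 1) / k) * x + (a + b) / k ≤ (-1 / k) * x + (a * n + b) / k := by
      rw [p2, p3, div_le_div_iff_of_pos_right hkpos, hnk]
      have := mul_le_mul_of_nonneg_left hx.2 hkpos.le
      linarith
    simp only [w, min_eq_left h2, min_eq_right h1]
  have w3 : ∀ x ∈ uIcc a (a * n + b), w x = (-1 / k) * x + (a * n + b) / k := by
    intro x hx
    rw [uIcc_of_le (by rw [hnk]; linarith)] at hx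
    have h0 := mul_le_mul_of_nonneg_left hx.1 hkpos.le
    have h1 : (-1 / k) * x + (a * n + b) / k ≤ x := by
      rw [p3, div_le_iff₀ hkpos, hnk]; linarith [hx.1]
    have h2 : (-1 / k) * x + (a * n + b) / k ≤ ((k - 1) / k) * x + (a + b) / k := by
      rw [p2, p3, div_le_div_iff_of_pos_right hkpos, hnk]
      linarith
    simp only [w, min_eq_right h2, min_eq_right h1]
  rw [area_of_xSlices hcl (x₀ := 0) (x₁ := a * n + b) (by rw [hnk]; linarith) hw,
    ← intervalIntegral.integral_add_adjacent_intervals (b := a + b) (hw.intervalIntegrable _ _)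
      (hw.intervalIntegrable _ _),
    ← intervalIntegral.integral_add_adjacent_intervals (a := a + b) (b := a)
      (hw.intervalIntegrable _ _) (hw.intervalIntegrable _ _),
    intervalIntegral.integral_congr w1, intervalIntegral.integral_congr w2,
    intervalIntegral.integral_congr w3, integral_affine, integral_affine, integral_affine, hnk]
  · field_simp; ring
  · rintro x ⟨h1, h2⟩
    refine le_min h1 (le_min ?_ ?_)
    · rw [p2]
      exact div_nonneg (add_nonneg (mul_nonneg (by linarith) h1) (by linarith)) hkpos.le
    · rw [p3]; exact div_nonneg (by linarith) hkpos.le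
  · intro x _; rw [hs, Real.volume_Icc, sub_zero]
  · intro x hx
    rw [hs, Icc_eq_empty, measure_empty]
    intro h0
    have h1 := le_min_iff.1 h0
    have h2 := (le_min_iff.1 h1.2).2
    rw [p3, le_div_iff₀ hkpos] at h2
    exact hx ⟨h1.1, by linarith⟩

section TypeThreeC

variable {a b h : ℝ} {n : ℤ} {f : Fin 1 → ℤˣ} {p : ℝ × ℝ} {B : Set (ℝ × ℝ)} {l : ℝ}

theorem tripleThreeC_bendLeft (x : ℝ) :
    (tripleThreeC a b h n).bendLeft f x = if f 0 = -1 then max (x - a) 0 else 0 := by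
  simp [Triple.bendLeft, tripleThreeC]

theorem tripleThreeC_bendRight (x : ℝ) :
    (tripleThreeC a b h n).bendRight f x = if f 0 = -1 then max (a - x) 0 else 0 := by
  simp [Triple.bendRight, tripleThreeC]

theorem tripleThreeC_ε (i : Fin 1) : (tripleThreeC a b h n).ε i = 1 := by simp [tripleThreeC]

theorem tripleThreeC_unfold (hf : f 0 = -1) (x y : ℝ) :
    (tripleThreeC a b h n).unfold f (x, y) = (x, y + max (x - a) 0) := by
  rw [Triple.unfold, vShear, Triple.fold_eq_bendLeft tripleThreeC_ε, tripleThreeC_bendLeft,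
    if_pos hf]

/-- The end of the cut is a fake corner: reversal turns the direction `(k, -1)` of the edge on its
right into `(k, k - 1)`, that of the edge on its left, where `k = n - 1`. -/
theorem tripleThreeC_not_apex (ha : 0 < a) (hb : b < 0) (hab : -a < b) (hn : 2 ≤ n)
    (hh' : h < a + b / (n - 1)) :
    ¬ (tripleThreeC a b h n).IsCornerTriangle f (a, a + b / (n - 1)) B l := by
  intro H
  have hn' : (2 : ℝ) ≤ n := by exact_mod_cast hn
  have hf : f 0 = -1 := by
    refine (Int.units_eq_one_or (f 0)).resolve_left fun hf => ?_
    have := H.not_cut 0 rfl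
    simp [hf, tripleThreeC, sign] at this
    linarith
  obtain ⟨k, hk⟩ : ∃ k : ℝ, k = n - 1 := ⟨_, rfl⟩
  obtain ⟨d, hd⟩ : ∃ d : ℝ, d = b / (n - 1) := ⟨_, rfl⟩
  have hk1 : 1 ≤ k := by linarith
  have hnk : (n : ℝ) = k + 1 := by linarith
  have hdk : d * k = b := by rw [hd, ← hk]; field_simp
  rw [← hd] at H
  have hd0 : d < 0 := by rw [hd]; exact div_neg_of_neg_of_pos hb (by linarith)
  have hbd : b ≤ d := by nlinarith
  -- The two edges at the corner have lattice lengths `-d` and `a + d`.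
  obtain ⟨t, ht, htd, hta⟩ : ∃ t : ℝ, 0 < t ∧ t ≤ -d ∧ t ≤ a + d :=
    ⟨min (-d) (a + d), lt_min (by linarith) (by linarith), min_le_left _ _, min_le_right _ _⟩
  have h1 := mul_nonneg (sub_nonneg.2 hk1) (sub_nonneg.2 htd)
  have h2 := mul_nonneg (sub_nonneg.2 hk1) ht.le
  have h3 := mul_nonneg (sub_nonneg.2 hk1) h2
  have := H.extreme (a - k * t, a + d - (k - 1) * t) (by
      rw [mem_tripleThreeC ha hb hab hn, hnk, ← hdk]; refine ⟨?_, ?_, ?_, ?_⟩ <;> nlinarith)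
    (a + k * t, a + d - t) (by
      rw [mem_tripleThreeC ha hb hab hn, hnk, ← hdk]; refine ⟨?_, ?_, ?_, ?_⟩ <;> nlinarith) (by
      simp only [tripleThreeC_unfold hf]
      rw [max_eq_right (by nlinarith : a - k * t - a ≤ 0), max_eq_right (by linarith : a - a ≤ 0),
        max_eq_left (by nlinarith : 0 ≤ a + k * t - a)]
      ext <;> simp
      ring)
  have := congrArg Prod.fst this
  simp only at this
  nlinarith

theorem tripleThreeC_apex (ha : 0 < a) (hb : b < 0) (hab : -a < b) (hn : 2 ≤ n) (hh : 0 < h)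
    (hh' : h < a + b / (n - 1)) (H : (tripleThreeC a b h n).IsCornerTriangle f p B l) :
    p = (0, 0) ∨ p = (a + b, a + b) ∨ p = (a * n + b, 0) := by
  have hv := extremePoints_convexHull_subset
    (H.isVertex (isRepresentative_tripleThreeC ha hb hab hn hh hh'))
  rcases hv with rfl | rfl | rfl | rfl
  · exact Or.inl rfl
  · exact Or.inr (Or.inl rfl)
  · exact absurd H (tripleThreeC_not_apex ha hb hab hn hh')
  · exact Or.inr (Or.inr rfl)

theorem eventually_tripleThreeC_left (ha : 0 < a) (hb : b < 0) (hab : -a < b) (hn : 2 ≤ n)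
    (h : ℝ) : ∀ᶠ q in 𝓝 ((0 : ℝ), (0 : ℝ)), (q ∈ (tripleThreeC a b h n).Δ ↔
      q ∈ corner (1, 0) (1, 1) (0, 0)) := by
  have hn' : (2 : ℝ) ≤ n := by exact_mod_cast hn
  have hpos : 0 < a * n + b := by nlinarith
  have hc : Continuous fun q : ℝ × ℝ => q.1 + (n - 1) * q.2 := by fun_prop
  have hc' : Continuous fun q : ℝ × ℝ => (2 - n) * q.1 + (n - 1) * q.2 := by fun_prop
  filter_upwards [hc.continuousAt.eventually_lt_const (u := a * n + b) (by simpa using hpos),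
    hc'.continuousAt.eventually_lt_const (u := a + b) (by simp; linarith)] with q h1 h2
  rw [← Prod.mk.eta (p := q), mem_tripleThreeC ha hb hab hn]
  simp [corner, coordA, coordB]
  constructor
  · rintro ⟨h1, h2, -⟩; exact ⟨h2, h1⟩
  · rintro ⟨h3, h4⟩; refine ⟨h4, h3, ?_, ?_⟩ <;> linarith

theorem eventually_tripleThreeC_top (ha : 0 < a) (hb : b < 0) (hab : -a < b) (hn : 2 ≤ n)
    (h : ℝ) : ∀ᶠ q in 𝓝 (a + b, a + b), (q ∈ (tripleThreeC a b h n).Δ ↔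
      q ∈ corner (-1, -1) (n - 1, n - 2) (a + b, a + b)) := by
  have hn' : (2 : ℝ) ≤ n := by exact_mod_cast hn
  have hbn := mul_nonneg (sub_nonneg.2 hn') (neg_nonneg.2 hb.le)
  have hc : Continuous fun q : ℝ × ℝ => q.1 + (n - 1) * q.2 := by fun_prop
  have hc' : Continuous fun q : ℝ × ℝ => q.2 := by fun_prop
  filter_upwards [hc.continuousAt.eventually_lt_const (u := a * n + b) (by simp only []; linarith),
    hc'.continuousAt.eventually_const_lt (u := 0) (by simp only []; linarith)] with q h1 h2
  rw [← Prod.mk.eta (p := q), mem_tripleThreeC ha hb hab hn]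
  simp [corner, coordA, coordB]
  constructor
  · rintro ⟨h3, h4, h5, h6⟩; constructor <;> linarith
  · rintro ⟨h3, h4⟩; refine ⟨?_, ?_, ?_, ?_⟩ <;> linarith

theorem eventually_tripleThreeC_right (ha : 0 < a) (hb : b < 0) (hab : -a < b) (hn : 2 ≤ n)
    (h : ℝ) : ∀ᶠ q in 𝓝 (a * n + b, (0 : ℝ)), (q ∈ (tripleThreeC a b h n).Δ ↔
      q ∈ corner (1 - n, 1) (-1, 0) (a * n + b, 0)) := by
  have hn' : (2 : ℝ) ≤ n := by exact_mod_cast hn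
  have hpos : 0 < a * n + b := by nlinarith
  have hpos' := mul_nonneg (sub_nonneg.2 hn') hpos.le
  have hc : Continuous fun q : ℝ × ℝ => q.1 - q.2 := by fun_prop
  have hc' : Continuous fun q : ℝ × ℝ => (2 - n) * q.1 + (n - 1) * q.2 := by fun_prop
  filter_upwards [hc.continuousAt.eventually_const_lt (u := 0) (by simpa using hpos),
    hc'.continuousAt.eventually_lt_const (u := a + b) (by simp only []; linarith)] with q h1 h2
  rw [← Prod.mk.eta (p := q), mem_tripleThreeC ha hb hab hn]
  simp [corner, coordA, coordB]
  intro h0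
  constructor
  · rintro ⟨h1, h2, h3⟩; linarith
  · intro h; refine ⟨?_, ?_, ?_⟩ <;> linarith

theorem tripleThreeC_left_mem (ha : 0 < a) (hb : b < 0) (hab : -a < b) (hn : 2 ≤ n)
    (H : (tripleThreeC a b h n).IsCornerTriangle f (0, 0) B l) (x y : ℝ) :
    (x, y) ∈ B ↔ 0 ≤ y + (tripleThreeC a b h n).bendLeft f x ∧
      y + (tripleThreeC a b h n).bendLeft f x ≤ x ∧ x < l := by
  rw [H.mem_iff_left tripleThreeC_ε (by simpa [tripleThreeC] using ha) (by simp [det])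
    (eventually_tripleThreeC_left ha hb hab hn h)]
  simp [cornerTriangle, coordA, coordB]
  tauto

theorem tripleThreeC_top_mem (ha : 0 < a) (hb : b < 0) (hab : -a < b) (hn : 2 ≤ n)
    (H : (tripleThreeC a b h n).IsCornerTriangle f (a + b, a + b) B l) (x y : ℝ) :
    (x, y) ∈ B ↔ y + (tripleThreeC a b h n).bendLeft f x ≤ x ∧
      (2 - n) * x + (n - 1) * (y + (tripleThreeC a b h n).bendLeft f x) ≤ a + b ∧
      (n - 1) * x - n * (y + (tripleThreeC a b h n).bendLeft f x) + a + b < l := by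
  rw [H.mem_iff_left tripleThreeC_ε (by simpa [tripleThreeC] using hb) (by simp [det])
    (eventually_tripleThreeC_top ha hb hab hn h)]
  simp [cornerTriangle, coordA, coordB]
  constructor
  · rintro ⟨h1, h2, h3⟩; refine ⟨?_, ?_, ?_⟩ <;> linarith
  · rintro ⟨h1, h2, h3⟩; refine ⟨?_, ?_, ?_⟩ <;> linarith

theorem lt_right_tripleThreeC (ha : 0 < a) (hab : -a < b) (hn : 2 ≤ n) : a < a * n + b := by
  have hn' : (2 : ℝ) ≤ n := by exact_mod_cast hn
  nlinarith

theorem tripleThreeC_right_mem (ha : 0 < a) (hb : b < 0) (hab : -a < b) (hn : 2 ≤ n)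
    (H : (tripleThreeC a b h n).IsCornerTriangle f (a * n + b, 0) B l) (x y : ℝ) :
    (x, y) ∈ B ↔ 0 ≤ y + (tripleThreeC a b h n).bendRight f x ∧
      x + (n - 1) * (y + (tripleThreeC a b h n).bendRight f x) ≤ a * n + b ∧
      a * n + b - x - (n - 2) * (y + (tripleThreeC a b h n).bendRight f x) < l := by
  rw [H.mem_iff_right tripleThreeC_ε
    (by simpa [tripleThreeC] using lt_right_tripleThreeC ha hab hn) (by simp [det])
    (eventually_tripleThreeC_right ha hb hab hn h)]
  simp [cornerTriangle, coordA, coordB]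
  refine fun _ => ⟨fun h => ⟨?_, ?_⟩, fun h => ⟨?_, ?_⟩⟩ <;> linarith [h.1, h.2]

/-! ### Type (3c): constraints on the sizes -/

theorem tripleThreeC_left_le (ha : 0 < a) (hb : b < 0) (hab : -a < b) (hn : 2 ≤ n)
    (H : (tripleThreeC a b h n).IsCornerTriangle f (0, 0) B l) : l ≤ a + b := by
  by_contra! hc
  -- Staying below `a` keeps the test point off the bend, so both choices of the cut are treated at
  -- once.
  obtain ⟨t, ht, htl⟩ := exists_between (lt_min hc (by linarith : a + b < a))
  obtain ⟨htl, hta⟩ := lt_min_iff.1 htl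
  have h1 : (t, t) ∈ B := by
    rw [tripleThreeC_left_mem ha hb hab hn H,
      Triple.bendLeft_eq_zero f (by simp [tripleThreeC]; linarith)]
    refine ⟨?_, ?_, ?_⟩ <;> linarith
  have h1 := H.subset h1
  rw [mem_tripleThreeC ha hb hab hn] at h1
  linarith [h1.2.2.1]

theorem tripleThreeC_left_edge (ha : 0 < a) (hb : b < 0) (hab : -a < b) (hn : 2 ≤ n)
    (H : (tripleThreeC a b h n).IsCornerTriangle f (0, 0) B l) (t : ℝ) (ht : 0 ≤ t) (htl : t < l) :
    (t, t) ∈ B := by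
  have hl := tripleThreeC_left_le ha hb hab hn H
  rw [tripleThreeC_left_mem ha hb hab hn H,
    Triple.bendLeft_eq_zero f (by simp [tripleThreeC]; linarith)]
  simpa [ht] using htl

theorem tripleThreeC_top_edge (ha : 0 < a) (hb : b < 0) (hab : -a < b) (hn : 2 ≤ n)
    (H : (tripleThreeC a b h n).IsCornerTriangle f (a + b, a + b) B l) (t : ℝ) (ht : 0 ≤ t)
    (htl : t < l) : (a + b - t, a + b - t) ∈ B := by
  rw [tripleThreeC_top_mem ha hb hab hn H,
    Triple.bendLeft_eq_zero f (by simp [tripleThreeC]; linarith)]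
  refine ⟨?_, ?_, ?_⟩ <;> linarith

theorem tripleThreeC_top_le (ha : 0 < a) (hb : b < 0) (hab : -a < b) (hn : 2 ≤ n)
    (H : (tripleThreeC a b h n).IsCornerTriangle f (a + b, a + b) B l) : l ≤ a + b := by
  by_contra! hc
  obtain ⟨t, ht, htl⟩ := exists_between hc
  have h1 := H.subset (tripleThreeC_top_edge ha hb hab hn H t (by linarith) htl)
  rw [mem_tripleThreeC ha hb hab hn] at h1
  linarith [h1.1]

/-- Without reversal the right edge has length `a + d`, where `d = b / (n - 1)`, and this is below
both bounds. With reversal, the first bound is the size at which the triangle reaches the marked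
point, and the second the one at which the prolonged right edge hits the line `y = x`. -/
theorem tripleThreeC_right_le (ha : 0 < a) (hb : b < 0) (hab : -a < b) (hn : 2 ≤ n) (hh : 0 < h)
    (hh' : h < a + b / (n - 1))
    (H : (tripleThreeC a b h n).IsCornerTriangle f (a * n + b, 0) B l) :
    l ≤ (n - 1) * a + b - (n - 2) * h ∧ l ≤ a := by
  have hn' : (2 : ℝ) ≤ n := by exact_mod_cast hn
  obtain ⟨k, hk⟩ : ∃ k : ℝ, k = n - 1 := ⟨_, rfl⟩
  obtain ⟨d, hd⟩ : ∃ d : ℝ, d = b / (n - 1) := ⟨_, rfl⟩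
  have hk1 : 1 ≤ k := by linarith
  have hnk : (n : ℝ) = k + 1 := by linarith
  have hdk : d * k = b := by rw [hd, ← hk]; field_simp
  rw [← hd] at hh'
  have hd0 : d < 0 := by rw [hd]; exact div_neg_of_neg_of_pos hb (by linarith)
  have hkh := mul_nonneg (sub_nonneg.2 hk1) (sub_nonneg.2 hh'.le)
  rcases Int.units_eq_one_or (f 0) with hf | hf
  · have hl : l ≤ a + d := by
      by_contra! hc
      obtain ⟨t, ht, htl⟩ := exists_between hc
      have h1 : (a * n + b - k * t, t) ∈ B := by
        rw [tripleThreeC_right_mem ha hb hab hn H, tripleThreeC_bendRight, if_neg (by simp [hf]),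
          hnk]
        refine ⟨?_, ?_, ?_⟩ <;> linarith
      have h1 := H.subset h1
      rw [mem_tripleThreeC ha hb hab hn, hnk, ← hdk] at h1
      have h2 : k ^ 2 * t ≤ k ^ 2 * (a + d) := by linarith [h1.2.2.1]
      linarith [le_of_mul_le_mul_left h2 (by positivity)]
    rw [hnk, ← hdk]
    constructor <;> linarith
  · constructor
    · by_contra! hc
      refine H.not_marked 0 ?_
      change (a, h) ∈ B
      rw [tripleThreeC_right_mem ha hb hab hn H, tripleThreeC_bendRight, if_pos hf,
        max_eq_right (by linarith), hnk, ← hdk]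
      rw [hnk, ← hdk] at hc
      refine ⟨?_, ?_, ?_⟩ <;> linarith
    · by_contra! hc
      obtain ⟨t, ht, htl⟩ := exists_between hc
      obtain ⟨x, hx⟩ : ∃ x, x = a * n + b - k * t := ⟨_, rfl⟩
      have hxa : x < a := by
        have := mul_lt_mul_of_pos_left ht (by linarith : 0 < k)
        rw [hnk] at hx
        linarith
      have h1 : (x, t - (a - x)) ∈ B := by
        rw [tripleThreeC_right_mem ha hb hab hn H, tripleThreeC_bendRight, if_pos hf,
          max_eq_left (by linarith), hx, hnk]
        refine ⟨?_, ?_, ?_⟩ <;> linarith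
      have h1 := H.subset h1
      rw [mem_tripleThreeC ha hb hab hn] at h1
      linarith [h1.2.1]

theorem tripleThreeC_sum_sq_le (ha : 0 < a) (hb : b < 0) (hab : -a < b) (hn : 2 ≤ n) (hh : 0 < h)
    (hh' : h < a + b / (n - 1)) {𝓑 : ℝ × ℝ → Set (ℝ × ℝ)} {Λ : ℝ × ℝ → ℝ}
    (H : (tripleThreeC a b h n).IsCornerFamily 𝓑 Λ) :
    Λ (0, 0) ^ 2 + Λ (a + b, a + b) ^ 2 + Λ (a * n + b, 0) ^ 2 ≤
      (a + b) ^ 2 + min (((n - 1) * a + b - (n - 2) * h) ^ 2) (a ^ 2) := by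
  obtain ⟨H, hd⟩ := H
  have h1 : 0 ≤ Λ (0, 0) ∧ Λ (0, 0) ≤ a + b ∧ ∀ t, 0 ≤ t → t < Λ (0, 0) → (t, t) ∈ 𝓑 (0, 0) := by
    rcases H (0, 0) with ⟨h0, -⟩ | ⟨f, H⟩
    · rw [h0]; exact ⟨le_rfl, by linarith, fun t h1 h2 => absurd h1 (not_le.2 h2)⟩
    · exact ⟨H.pos.le, tripleThreeC_left_le ha hb hab hn H, tripleThreeC_left_edge ha hb hab hn H⟩
  have h2 : 0 ≤ Λ (a + b, a + b) ∧ Λ (a + b, a + b) ≤ a + b ∧ ∀ t, 0 ≤ t → t < Λ (a + b, a + b) →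
      (a + b - t, a + b - t) ∈ 𝓑 (a + b, a + b) := by
    rcases H (a + b, a + b) with ⟨h0, -⟩ | ⟨f, H⟩
    · rw [h0]; exact ⟨le_rfl, by linarith, fun t h1 h2 => absurd h1 (not_le.2 h2)⟩
    · exact ⟨H.pos.le, tripleThreeC_top_le ha hb hab hn H, tripleThreeC_top_edge ha hb hab hn H⟩
  have h3 : Λ (a * n + b, 0) ^ 2 ≤ min (((n - 1) * a + b - (n - 2) * h) ^ 2) (a ^ 2) := by
    rcases H (a * n + b, 0) with ⟨h0, -⟩ | ⟨f, H⟩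
    · rw [h0, zero_pow two_ne_zero]; exact le_min (sq_nonneg _) (sq_nonneg _)
    · have hl := tripleThreeC_right_le ha hb hab hn hh hh' H
      exact le_min (pow_le_pow_left₀ H.pos.le hl.1 2) (pow_le_pow_left₀ H.pos.le hl.2 2)
  have h4 := add_le_of_disjoint_edge (hd (0, 0) (a + b, a + b) (by simp; linarith)) h1.2.1 h2.2.1
    (fun t => (t, t)) h1.2.2 h2.2.2
  have h5 := pow_le_pow_left₀ (add_nonneg h1.1 h2.1) h4 2
  linarith [mul_nonneg h1.1 h2.1]

/-! ### Type (3c): the optimal packing -/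

theorem lt_of_mem_cornerTriangle_right_bend (hn : 2 ≤ n) (hl : l ≤ a) {x Y : ℝ}
    (hq : (x, Y) ∈ cornerTriangle (1 - n, 1) (-1, 0) (a * n + b, 0) l) :
    0 ≤ Y ∧ Y < l ∧ a + b < x ∧ x + (n - 1) * Y ≤ a * n + b ∧ a * n + b - x - (n - 2) * Y < l := by
  have hn' : (2 : ℝ) ≤ n := by exact_mod_cast hn
  simp [cornerTriangle, coordA, coordB] at hq
  obtain ⟨h1, h2, h3⟩ := hq
  have h4 : Y < l := by linarith
  have := mul_nonneg (sub_nonneg.2 hn') (by linarith : 0 ≤ a - Y)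
  refine ⟨h1, h4, ?_, ?_, ?_⟩ <;> linarith

theorem tripleThreeC_isPackedTriangle_right (ha : 0 < a) (hb : b < 0) (hab : -a < b) (hn : 2 ≤ n)
    (hl0 : 0 < l) (hl : l ≤ a) (hl' : l ≤ (n - 1) * a + b - (n - 2) * h) :
    (tripleThreeC a b h n).IsPackedTriangle (a * n + b, 0)
      (vShear (fun x => max (a - x) 0) ⁻¹'
        cornerTriangle (1 - n, 1) (-1, 0) (a * n + b, 0) l) := by
  have hn' : (2 : ℝ) ≤ n := by exact_mod_cast hn
  have hab' := lt_right_tripleThreeC ha hab hn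
  have hφ0 : ∀ x : ℝ, (x ≤ a ∧ max (a - x) 0 = a - x) ∨ (a ≤ x ∧ max (a - x) 0 = 0) := by
    intro x
    rcases le_total x a with h | h
    · exact Or.inl ⟨h, max_eq_left (by linarith)⟩
    · exact Or.inr ⟨h, max_eq_right (by linarith)⟩
  -- These values come from `max (x - a) 0 = x - a + max (a - x) 0`.
  refine Triple.isPackedTriangle_of_bend (fun _ => -1) (k := 1) (s := -a) (fun x => ?_) ?_
    (by simp [det]) hl0 (by simpa [tripleThreeC] using hab'.ne')
    (eventually_tripleThreeC_right ha hb hab hn h) ?_ ?_ ?_ ?_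
  · rw [Triple.fold_eq_bendLeft tripleThreeC_ε, tripleThreeC_bendLeft, if_pos rfl]
    rcases le_total x a with h | h
    · rw [max_eq_right (by linarith), max_eq_left (by linarith)]; push_cast; ring
    · rw [max_eq_left (by linarith), max_eq_right (by linarith)]; push_cast; ring
  · filter_upwards [Ioi_mem_nhds hab'] with x hx
    exact max_eq_right (by linarith [mem_Ioi.1 hx])
  · rintro ⟨x, y⟩ hq
    rw [mem_tripleThreeC ha hb hab hn] at hq
    simp [corner, coordA, coordB]
    constructor <;> linarith
  · rintro ⟨x, y⟩ hq
    rw [mem_tripleThreeC ha hb hab hn] at hq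
    simp [corner, coordA, coordB]
    rcases hφ0 x with ⟨h1, h2⟩ | ⟨h1, h2⟩ <;> rw [h2] <;> constructor <;> linarith
  · rintro ⟨x, y⟩ hq
    obtain ⟨h1, h2, h3, h4, h5⟩ := lt_of_mem_cornerTriangle_right_bend hn hl hq
    rw [mem_tripleThreeC ha hb hab hn]
    simp only at h1 h2 h4 h5
    rcases hφ0 x with ⟨h6, h7⟩ | ⟨h6, h7⟩ <;> rw [h7] at h1 h2 h4 h5
    · have hy : 0 ≤ y := by
        -- The bent triangle must stay above the bottom edge. For `n = 2` the hypothesis `hl'` reads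
        -- `l ≤ a + b`, so no point has `x ≤ a`; for `n ≥ 3` the bound `l ≤ a` suffices.
        rcases hn.eq_or_lt with h8 | h8
        · subst h8; norm_num at *; linarith
        · have h8' : (3 : ℝ) ≤ n := by exact_mod_cast h8
          have := mul_nonneg (sub_nonneg.2 h8') (by linarith :
            0 ≤ a * n + b - x - (n - 1) * (y + (a - x)))
          have := mul_nonneg (sub_nonneg.2 hn') (by linarith :
            0 ≤ a - (a * n + b - x - (n - 2) * (y + (a - x))))
          nlinarith
      have := mul_nonneg (sub_nonneg.2 hn') (sub_nonneg.2 h6)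
      refine ⟨?_, ?_, ?_, ?_⟩ <;> linarith
    · have := mul_nonneg (sub_nonneg.2 hn') (sub_nonneg.2 h6)
      refine ⟨?_, ?_, ?_, ?_⟩ <;> linarith
  · intro i hq
    obtain ⟨h1, h2, h3, h4, h5⟩ := lt_of_mem_cornerTriangle_right_bend (x := a)
      (Y := h) hn hl (by simpa [tripleThreeC] using hq)
    linarith

theorem tripleThreeC_exists_isPacking (ha : 0 < a) (hb : b < 0) (hab : -a < b) (hn : 2 ≤ n)
    (hl0 : 0 < l) (hl : l ≤ a) (hl' : l ≤ (n - 1) * a + b - (n - 2) * h) :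
    ∃ P, (tripleThreeC a b h n).IsPacking P ∧ area P = ((a + b) ^ 2 + l ^ 2) / 2 := by
  have hn' : (2 : ℝ) ≤ n := by exact_mod_cast hn
  have hbn := mul_nonneg (sub_nonneg.2 hn') (neg_nonneg.2 hb.le)
  have hφ : Continuous fun x : ℝ => max (a - x) 0 := by fun_prop
  -- The edge of length `a + b` is given entirely to the origin. Its triangle lies in `x < a + b`
  -- and the bent one in `x > a + b`.
  refine Triple.exists_isPacking (d := 2) (p := ![(0, 0), (a * n + b, 0)])
    (B := ![cornerTriangle (1, 0) (1, 1) (0, 0) (a + b),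
      vShear (fun x => max (a - x) 0) ⁻¹' cornerTriangle (1 - n, 1) (-1, 0) (a * n + b, 0) l])
    (l := ![a + b, l]) ?_ ?_ ?_ ?_ ?_ (by simp)
  · intro i; fin_cases i
    · refine Triple.isPackedTriangle_of_one (by simp [det]) (by linarith)
        (by simp [tripleThreeC]; linarith) (eventually_tripleThreeC_left ha hb hab hn h) ?_ ?_ ?_
      · rintro ⟨x, y⟩ hq
        rw [mem_tripleThreeC ha hb hab hn] at hq
        simp [corner, coordA, coordB]
        constructor <;> linarith
      · rintro ⟨x, y⟩ hq
        obtain ⟨h1, h2, h3⟩ := lt_of_mem_cornerTriangle_left hq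
        have := mul_nonneg (sub_nonneg.2 hn') (sub_nonneg.2 h2)
        have := mul_nonneg (by linarith : (0 : ℝ) ≤ n - 1) (by linarith : 0 ≤ a + b - y)
        rw [mem_tripleThreeC ha hb hab hn]
        refine ⟨?_, ?_, ?_, ?_⟩ <;> linarith
      · intro i hq
        have := lt_of_mem_cornerTriangle_left (x := a) (y := h) (by simpa [tripleThreeC] using hq)
        linarith [this.2.2]
    · exact tripleThreeC_isPackedTriangle_right ha hb hab hn hl0 hl hl'
  · intro i j hij
    fin_cases i <;> fin_cases j <;> simp at hij
    refine disjoint_left.2 ?_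
    rintro ⟨x, y⟩ h1 h2
    have h1 := lt_of_mem_cornerTriangle_left h1
    have h2 := lt_of_mem_cornerTriangle_right_bend hn hl h2
    linarith [h1.2.2, h2.2.2.1]
  · intro i; fin_cases i
    · exact measurableSet_cornerTriangle _ _ _ _
    · exact measurableSet_vShear_preimage hφ _ _ _ _
  · intro i; fin_cases i
    · exact (by linarith : 0 < a + b)
    · exact hl0
  · intro i; fin_cases i
    · exact area_cornerTriangle (by simp [det]) _ (by linarith : 0 ≤ a + b)
    · exact area_vShear_preimage hφ (by simp [det]) _ hl0

end TypeThreeC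

theorem packingDensity_minimalThreeC (a b h : ℝ) (n : ℤ) (ha : 0 < a) (hb : b < 0) (hab : -a < b)
    (hn : 2 ≤ n) (hh : 0 < h) (hh' : h < a + b / (n - 1)) :
    packingDensity (minimalThreeC a b h n ha hb hab hn hh hh').semitoricPolygon =
      ((a + b) ^ 2 + min (((n - 1) * a + b - (n - 2) * h) ^ 2) (a ^ 2)) /
        ((n * a + 2 * b) * a) := by
  have hn' : (2 : ℝ) ≤ n := by exact_mod_cast hn
  -- Since `h < a`, this quantity is at least `a + b`. Its positivity makes the minimum of the
  -- squares the square of the minimum.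
  have hX : 0 < (n - 1) * a + b - (n - 2) * h := by
    have h1 : h < a := hh'.trans (by
      have := div_neg_of_neg_of_pos hb (by linarith : (0 : ℝ) < n - 1)
      linarith)
    have := mul_nonneg (sub_nonneg.2 hn') (sub_nonneg.2 h1.le)
    linarith
  have hex : ∃ P, (tripleThreeC a b h n).IsPacking P ∧ area P =
      ((a + b) ^ 2 + min (((n - 1) * a + b - (n - 2) * h) ^ 2) (a ^ 2)) / 2 := by
    rcases le_total ((n - 1) * a + b - (n - 2) * h) a with h1 | h1
    · rw [min_eq_left (pow_le_pow_left₀ hX.le h1 2)]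
      exact tripleThreeC_exists_isPacking ha hb hab hn hX h1 le_rfl
    · rw [min_eq_right (pow_le_pow_left₀ ha.le h1 2)]
      exact tripleThreeC_exists_isPacking ha hb hab hn ha le_rfl h1
  have hr := lt_right_tripleThreeC ha hab hn
  rw [packingDensity_eq (minimalThreeC a b h n ha hb hab hn hh hh')
    (w := ![(0, 0), (a + b, a + b), (a * n + b, 0)]) ?_ ?_ ?_ hex]
  · change _ / area (tripleThreeC a b h n).Δ = _
    rw [area_tripleThreeC ha hb hab hn, div_div_div_cancel_right₀ two_ne_zero]
  · intro i j; fin_cases i <;> fin_cases j <;> simp <;> intros <;> linarith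
  · intro f p B l H
    rcases tripleThreeC_apex ha hb hab hn hh hh' H with rfl | rfl | rfl
    · exact ⟨0, rfl⟩
    · exact ⟨1, rfl⟩
    · exact ⟨2, rfl⟩
  · intro 𝓑 Λ H
    rw [Fin.sum_univ_three]
    exact tripleThreeC_sum_sq_le ha hb hab hn hh hh' H

end Semitoric

end

theorem mainTheorem4 :
    -- type (1)
    (∀ (a h : ℝ) (ha : 0 < a) (hh : 0 < h) (hh' : h < a / 2),
      Semitoric.packingDensity (Semitoric.minimalOne a h ha hh hh').semitoricPolygon =
        (a ^ 2 + 2 * h ^ 2 - 2 * a * h) / a ^ 2) ∧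
    -- type (2)
    (∀ (a b h₁ h₂ : ℝ) (ha : 0 < a) (hb : 0 ≤ b) (hh₁ : 0 < h₁) (hh₁' : h₁ < a) (hh₂ : 0 < h₂)
      (hh₂' : h₂ < a),
      Semitoric.packingDensity
        (Semitoric.minimalTwo a b h₁ h₂ ha hb hh₁ hh₁' hh₂ hh₂').semitoricPolygon = a / (a + b)) ∧
    -- type (3a)
    (∀ (a b h : ℝ) (n : ℤ) (ha : 0 < a) (hb : 0 < b) (hh : 0 < h) (hh' : h < a) (hn : 1 ≤ n),
      (1 < n →
        Semitoric.packingDensity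
          (Semitoric.minimalThreeA a b h n ha hb hh hh' hn).semitoricPolygon =
            2 * a / (n * a + 2 * b)) ∧
      (n = 1 → a ≤ b →
        Semitoric.packingDensity
          (Semitoric.minimalThreeA a b h n ha hb hh hh' hn).semitoricPolygon =
            2 * a / (a + 2 * b)) ∧
      (n = 1 → b < a → a < 2 * b →
        Semitoric.packingDensity
          (Semitoric.minimalThreeA a b h n ha hb hh hh' hn).semitoricPolygon =
            (a ^ 2 + b ^ 2 + (a - b) ^ 2) / ((a + 2 * b) * a)) ∧
      (n = 1 → 2 * b ≤ a →
        Semitoric.packingDensity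
          (Semitoric.minimalThreeA a b h n ha hb hh hh' hn).semitoricPolygon =
            (a ^ 2 + 2 * b ^ 2) / ((a + 2 * b) * a))) ∧
    -- type (3b)
    (∀ (a h : ℝ) (n : ℤ) (ha : 0 < a) (hh : 0 < h) (hh' : h < a) (hn : 2 ≤ n),
      Semitoric.packingDensity
        (Semitoric.minimalThreeB a h n ha hh hh' hn).semitoricPolygon = 2 / n) ∧
    -- type (3c)
    (∀ (a b h : ℝ) (n : ℤ) (ha : 0 < a) (hb : b < 0) (hab : -a < b) (hn : 2 ≤ n) (hh : 0 < h)
      (hh' : h < a + b / (n - 1)),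
      Semitoric.packingDensity
        (Semitoric.minimalThreeC a b h n ha hb hab hn hh hh').semitoricPolygon =
          ((a + b) ^ 2 + min (((n - 1) * a + b - (n - 2) * h) ^ 2) (a ^ 2)) /
            ((n * a + 2 * b) * a)) := by
  refine ⟨Semitoric.packingDensity_minimalOne, Semitoric.packingDensity_minimalTwo,
    fun a b h n ha hb hh hh' hn => ⟨fun hn1 => ?_, fun hn1 hab => ?_, fun hn1 hba hab => ?_,
      fun hn1 hab => ?_⟩, Semitoric.packingDensity_minimalThreeB,
    Semitoric.packingDensity_minimalThreeC⟩
  · rw [Semitoric.packingDensity_minimalThreeA a b h n ha hb hh hh' hn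
      (fun u q w hu hq hw hua hqw _ _ => Semitoric.sum_sq_le_of_add_le hu hq hw hua hqw)
      (Semitoric.tripleThreeA_exists_isPacking_two ha hb.le hn (Or.inl hn1)), sq, ← mul_assoc,
      mul_div_mul_right _ _ ha.ne']
  · rw [Semitoric.packingDensity_minimalThreeA a b h n ha hb hh hh' hn
      (fun u q w hu hq hw hua hqw _ _ => Semitoric.sum_sq_le_of_add_le hu hq hw hua hqw)
      (Semitoric.tripleThreeA_exists_isPacking_two ha hb.le hn (Or.inr hab)), sq, ← mul_assoc,
      mul_div_mul_right _ _ ha.ne', hn1]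
    simp
  · subst hn1
    rw [Semitoric.packingDensity_minimalThreeA a b h 1 ha hb hh hh' hn
      (fun u q w hu hq hw hua hqw huq huw => Semitoric.sum_sq_le_of_lt hb hu hq hw hua hqw huq
        (by simpa using huw) hba.le hab.le)
      -- The third size is `a - b`, exhausting the right edge; in the last case it is `b`, limited
      -- by the top edge instead.
      (Semitoric.tripleThreeA_exists_isPacking_three ha hb hh' (sub_pos.2 hba) (by linarith)
        (by linarith))]
    simp
  · subst hn1
    rw [Semitoric.packingDensity_minimalThreeA a b h 1 ha hb hh hh' hn
      (fun u q w hu hq hw hua hqw huq huw => Semitoric.sum_sq_le_of_two_mul_le hb hu hq hw hua hqw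
        huq (by simpa using huw) hab)
      (by
        have := Semitoric.tripleThreeA_exists_isPacking_three ha hb hh' hb le_rfl (by linarith)
        rwa [add_assoc, ← two_mul] at this)]
    simp
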